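/- Consider the modified Zakharov–Kuznetsov equation in the coordinates $(x_a,x_b)\in\mathbb{R}^2$, $$\partial_t u+\partial_{x_a}^3u+\partial_{x_b}^3u+(\partial_{x_a}+\partial_{x_b})(u^3)=0 .\qquad(1)$$ For $T>1$ let $u:[1,T]\times\mathbb{R}^2\to\mathbb{R}$ be a solution of (1), meaning that $u\in C([1,T];H^3(\mathbb{R}^2))$ and that (1) holds in the sense of distributions on $\mathbb{R}^2$ for every $t\in[1,T]$, i.e. for every $\varphi\in C_c^\infty(\mathbb{R}^2)$ the function $t\mapsto\int u(t)\varphi\,dx$ is differentiable on $[1,T]$ (one-sidedly at the end points) with derivative $\int \big(u(t)(\partial_{x_a}^3\varphi+\partial_{x_b}^3\varphi)+u(t)^3(\partial_{x_a}\varphi+\partial_{x_b}\varphi)\big)\,dx$. Let $f(t)=K_{-t}*u(t)$ be the profile of $u$, where $K_t$ is the kernel of the linear evolution, given by $\widehat{K_t}(\xi_a,\xi_b)=e^{it(\xi_a^3+\xi_b^3)}$, so that $\widehat f(t,\xi)=e^{-it(\xi_a^3+\xi_b^3)}\widehat u(t,\xi)$ with $\widehat g(\xi)=\int_{\mathbb{R}^2}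 e^{-ix\cdot\xi}g(x)\,dx$. Let $$\|g\|_{H^3}=\Big(\frac{1}{(2\pi)^2}\int_{\mathbb{R}^2}(1+|\xi|^2)^3|\widehat g(\xi)|^2\,d\xi\Big)^{1/2},\qquad \|u\|_{X,T}=\sup_{t\in[1,T]}\max\big(\|u(t)\|_{H^3},\ \|x_af(t)\|_{L^2},\ \|x_bf(t)\|_{L^2}\big)\in[0,\infty].$$ **Proposition (energy estimate).** There is a universal constant $C>0$ such that for every $T>1$, every such solution $u$, and every $t\in[1,T]$, $$\|u(t)\|_{H^3}\le\|u(1)\|_{H^3}+C\,\|u\|_{X,T}^2 .$$ -/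

import Mathlib

open MeasureTheory Set Filter Topology FourierTransform
open scoped ENNReal NNReal ContDiff

namespace MZK

/-- The plane with coordinates `x 0 = x_a` and `x 1 = x_b`. -/
abbrev Plane : Type := EuclideanSpace ℝ (Fin 2)

/-- The inclusion of real-valued into complex-valued square-integrable functions. -/
noncomputable def complexify (g : Lp ℝ 2 (volume : Measure Plane)) :
    Lp ℂ 2 (volume : Measure Plane) :=
  Complex.ofRealCLM.compLp g

/-- The norm of `H³(ℝ²)`, equal to `∞` exactly for the functions outside `H³`:
`‖g‖² = ∫ (1 + |ζ|²)³ |ĝ(ζ)|² dζ`, where `ζ = 2πξ` is the angular frequency, since the Fourier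
transform `𝓕` of Mathlib has the kernel `exp (-2πi ⟨x, ξ⟩)`. -/
noncomputable def normH3 (g : Lp ℝ 2 (volume : Measure Plane)) : ℝ≥0∞ :=
  (∫⁻ ξ : Plane, ENNReal.ofReal ((1 + ‖(2 * Real.pi) • ξ‖ ^ 2) ^ 3) *
    ‖(𝓕 (complexify g) : Lp ℂ 2 (volume : Measure Plane)) ξ‖ₑ ^ 2) ^ (1 / 2 : ℝ)

/-- The Fourier symbol `exp (i t (ζ_a³ + ζ_b³))` of the linear evolution of
`∂_t u + ∂_a³ u + ∂_b³ u = 0`, with `ζ = 2πξ`. -/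
noncomputable def airySymbol (t : ℝ) (ξ : Plane) : ℂ :=
  Complex.exp (Complex.I * (t * ((2 * Real.pi * ξ 0) ^ 3 + (2 * Real.pi * ξ 1) ^ 3) : ℝ))

theorem norm_airySymbol (t : ℝ) (ξ : Plane) : ‖airySymbol t ξ‖ = 1 := by
  rw [airySymbol, mul_comm]
  exact Complex.norm_exp_ofReal_mul_I _

theorem continuous_airySymbol (t : ℝ) : Continuous (airySymbol t) := by
  unfold airySymbol
  fun_prop

theorem memLp_airySymbol_mul (t : ℝ) (g : Lp ℂ 2 (volume : Measure Plane)) :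
    MemLp (fun ξ => airySymbol t ξ * g ξ) 2 (volume : Measure Plane) := by
  refine (Lp.memLp g).of_le
    ((continuous_airySymbol t).aestronglyMeasurable.mul (Lp.aestronglyMeasurable g)) ?_
  exact Eventually.of_forall fun ξ => by simp [norm_airySymbol]

/-- The linear evolution `g ↦ K_t ∗ g` on `L²`, with `K_t` the inverse Fourier transform of
`airySymbol t`. -/
noncomputable def linearEvolution (t : ℝ) (g : Lp ℂ 2 (volume : Measure Plane)) :
    Lp ℂ 2 (volume : Measure Plane) :=
  𝓕⁻ ((memLp_airySymbol_mul t (𝓕 g)).toLp)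

/-- The profile `f(t) = K_{-t} ∗ u(t)`. -/
noncomputable def profile (u : ℝ → Lp ℝ 2 (volume : Measure Plane)) (t : ℝ) :
    Lp ℂ 2 (volume : Measure Plane) :=
  linearEvolution (-t) (complexify (u t))

/-- `‖x_i f‖_{L²}`, possibly infinite. -/
noncomputable def weightedNorm (i : Fin 2) (f : Lp ℂ 2 (volume : Measure Plane)) : ℝ≥0∞ :=
  eLpNorm (fun x : Plane => (x i : ℂ) * f x) 2 volume

/-- The norm `‖u‖_{X,T}`, the supremum over `t ∈ [1,T]` of `‖u(t)‖_{H³}`, `‖x_a f(t)‖_{L²}` and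
`‖x_b f(t)‖_{L²}`. -/
noncomputable def normX (T : ℝ) (u : ℝ → Lp ℝ 2 (volume : Measure Plane)) : ℝ≥0∞ :=
  ⨆ t ∈ Icc (1 : ℝ) T,
    max (normH3 (u t)) (max (weightedNorm 0 (profile u t)) (weightedNorm 1 (profile u t)))

/-- The partial derivative in the `i`-th coordinate. -/
noncomputable def pderiv (i : Fin 2) (φ : Plane → ℝ) (x : Plane) : ℝ :=
  fderiv ℝ φ x (EuclideanSpace.single i 1)

/-- `u ∈ C([1,T]; H³)` solves `∂_t u + ∂_a³ u + ∂_b³ u + (∂_a + ∂_b)(u³) = 0` on `[1,T] × ℝ²`, the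
equation being understood in the sense of distributions on `ℝ²` for every `t` (with one-sided time
derivatives at the end points). Only the values of `u` on `[1,T]` matter. -/
structure IsSolution (T : ℝ) (u : ℝ → Lp ℝ 2 (volume : Measure Plane)) : Prop where
  mem_H3 : ∀ t ∈ Icc (1 : ℝ) T, normH3 (u t) < (⊤ : ℝ≥0∞)
  continuous_H3 : ∀ t ∈ Icc (1 : ℝ) T,
    Tendsto (fun s => normH3 (u s - u t)) (𝓝[Icc 1 T] t) (𝓝 0)
  equation : ∀ φ : Plane → ℝ, ContDiff ℝ (∞ : ℕ∞ω) φ → HasCompactSupport φ → ∀ t ∈ Icc (1 : ℝ) T,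
    HasDerivWithinAt (fun s => ∫ x : Plane, u s x * φ x)
      (∫ x : Plane, (u t x * (pderiv 0 (pderiv 0 (pderiv 0 φ)) x
          + pderiv 1 (pderiv 1 (pderiv 1 φ)) x)
        + u t x ^ 3 * (pderiv 0 φ x + pderiv 1 φ x)))
      (Icc 1 T) t

end MZK

/-!
The squared `H³` norm is differentiated in time. Its growth is governed by the pairing of `u` with
`(∂_a + ∂_b)(u³)` in `H³`, which is at most `C K(t)² ‖u(t)‖²_{H³}` if `K(t)` bounds `u(t)` and its
first derivatives uniformly. Dispersive decay gives `K(t) ≤ C t^{-31/60} ‖u‖_X`. Since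
`t^{-31/30}` is integrable on `[1, ∞)`, the squared `H³` norm grows by at most `C ‖u‖_X⁴`, and
taking square roots gives the theorem.

*Decay* (`exists_norm_synth_le`). With `U` the Fourier transform of `u(t)`, the values of `u(t)` and
of its first derivatives are integrals of `e^{2πi⟨ξ,x⟩}` against `U` and `ξ_j U`. Frequencies
outside the square of side `t^{3/5}` are controlled by the `H³` norm. Inside, Plancherel turns the
integral into the pairing of the profile with a truncated kernel, a product of one-dimensional
oscillatory integrals which decays by van der Corput's lemma. One spatial moment of the
profile leaves the weight `(1 + |y|²)⁻¹` on the square of the kernel, which just fails to be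
integrable on the plane; interpolation with the `L²` norm of the kernel loses a power `t^{1/60}`,
for which there is room.

*Growth* (`exists_norm_lossForm_le`). For a real Schwartz function `p`, the pairing is expanded into
pairings of `∂^α p` with `∂_j ∂^α (p³)`. The terms in which all of `∂^α` falls on one factor are a
commutator of the frequency cutoff with the Lipschitz function `3p²`, since the symbol `i ζ_j` is
odd. In the remaining terms no factor carries more than three derivatives, and they are estimated
by the Gagliardo–Nirenberg inequality. Every estimate is uniform in the cutoff. Approximation by
Schwartz functions extends the bound to `H³` (`exists_norm_lossForm_cube_le`).

*Time derivative* (`IsSolution.hasDerivWithinAt_energy`). A solution satisfies its equation only in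
the sense of distributions, so the energy is cut off at frequency `1 / r`. The equation is
integrated in time, extended to Schwartz test functions and transferred to the Fourier side, which
shows that the cut-off of `U` is differentiable in time with values in `L²`. The dispersive part of
the derivative has an imaginary symbol and does not contribute. Finally `r → 0` by Fatou's lemma.
-/

namespace MZK

open scoped SchwartzMap LineDeriv

/-! ### Oscillatory integrals on the line -/

/-- The first-derivative test for an increasing, positive phase derivative. -/
theorem norm_integral_exp_le_of_le_deriv {φ φ' φ'' : ℝ → ℝ} {a b l : ℝ}
    (h1 : ∀ s, HasDerivAt φ (φ' s) s) (h2 : ∀ s, HasDerivAt φ' (φ'' s) s)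
    (hc : Continuous φ'') (hab : a ≤ b) (hl : 0 < l)
    (hφ' : ∀ s ∈ Icc a b, l ≤ φ' s) (hφ'' : ∀ s ∈ Icc a b, 0 ≤ φ'' s) :
    ‖∫ s in a..b, Complex.exp (φ s * Complex.I)‖ ≤ 3 / l := by
  have hcφ : Continuous φ := continuous_iff_continuousAt.2 fun s => (h1 s).continuousAt
  have hcφ' : Continuous φ' := continuous_iff_continuousAt.2 fun s => (h2 s).continuousAt
  have hpos : ∀ s ∈ uIcc a b, 0 < φ' s := fun s hs => hl.trans_le (hφ' s (uIcc_of_le hab ▸ hs))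
  set e : ℝ → ℂ := fun s => Complex.exp (φ s * Complex.I) with he
  have hce : Continuous e := by fun_prop
  have hne : ∀ s, ‖e s‖ = 1 := fun s => Complex.norm_exp_ofReal_mul_I _
  -- `e` is the derivative of `e / (i φ')` up to the error term `e φ'' / (i φ'²)`
  have hd : ∀ s ∈ uIcc a b, HasDerivAt (fun s => e s * (-Complex.I) * (φ' s : ℂ)⁻¹)
      (e s - e s * (-Complex.I) * (φ'' s / φ' s ^ 2 : ℝ)) s := by
    intro s hs
    have hne0 : (φ' s : ℂ) ≠ 0 := by exact_mod_cast (hpos s hs).ne'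
    have h3 : HasDerivAt e (e s * (φ' s * Complex.I)) s := by
      have := ((h1 s).ofReal_comp.mul_const Complex.I).cexp
      exact this
    have h4 := (h3.mul_const (-Complex.I)).mul ((h2 s).ofReal_comp.inv hne0)
    refine h4.congr_deriv ?_
    simp only [Pi.inv_apply]
    push_cast
    field_simp
    ring_nf
    rw [Complex.I_sq]
    ring
  have hcont1 : ContinuousOn (fun s => φ'' s / φ' s ^ 2) (uIcc a b) :=
    hc.continuousOn.div (hcφ'.pow 2).continuousOn fun s hs => (pow_pos (hpos s hs) 2).ne'
  have hcont : ContinuousOn (fun s => e s * (-Complex.I) * (φ'' s / φ' s ^ 2 : ℝ)) (uIcc a b) :=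
    (hce.mul continuous_const).continuousOn.mul (Complex.continuous_ofReal.comp_continuousOn hcont1)
  have hint := intervalIntegral.integral_eq_sub_of_hasDerivAt hd
    ((hce.continuousOn.sub hcont).intervalIntegrable)
  rw [intervalIntegral.integral_sub (hce.intervalIntegrable _ _) hcont.intervalIntegrable] at hint
  have hd2 : ∀ s ∈ uIcc a b, HasDerivAt (fun s => -(φ' s)⁻¹) (φ'' s / φ' s ^ 2) s := by
    intro s hs
    refine ((h2 s).inv (hpos s hs).ne').neg.congr_deriv ?_
    ring
  have hint2 := intervalIntegral.integral_eq_sub_of_hasDerivAt hd2 hcont1.intervalIntegrable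
  have hb := hφ' b ⟨hab, le_rfl⟩
  have ha := hφ' a ⟨le_rfl, hab⟩
  have hval : ∀ s, l ≤ φ' s → ‖e s * (-Complex.I) * (φ' s : ℂ)⁻¹‖ ≤ l⁻¹ := by
    intro s hs
    rw [norm_mul, norm_mul, hne, norm_neg, Complex.norm_I, norm_inv, Complex.norm_real,
      Real.norm_of_nonneg (hl.le.trans hs)]
    simpa using inv_anti₀ hl hs
  have herr : ‖∫ s in a..b, e s * (-Complex.I) * (φ'' s / φ' s ^ 2 : ℝ)‖ ≤ l⁻¹ := by
    calc _ ≤ ∫ s in a..b, φ'' s / φ' s ^ 2 := by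
          refine intervalIntegral.norm_integral_le_of_norm_le hab ?_ hcont1.intervalIntegrable
          refine Eventually.of_forall fun s hs => ?_
          have hs' : s ∈ Icc a b := Ioc_subset_Icc_self hs
          rw [norm_mul, norm_mul, hne, norm_neg, Complex.norm_I, Complex.norm_real,
            Real.norm_of_nonneg (div_nonneg (hφ'' s hs') (sq_nonneg _))]
          simp
      _ ≤ l⁻¹ := by
          rw [hint2]
          have := inv_nonneg.2 (hl.le.trans hb)
          have := inv_anti₀ hl ha
          linarith
  have hfin : ∫ s in a..b, e s = e b * (-Complex.I) * (φ' b : ℂ)⁻¹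
      - e a * (-Complex.I) * (φ' a : ℂ)⁻¹
      + ∫ s in a..b, e s * (-Complex.I) * (φ'' s / φ' s ^ 2 : ℝ) := by
    rw [← hint]; ring
  rw [hfin]
  calc _ ≤ l⁻¹ + l⁻¹ + l⁻¹ :=
        (norm_add_le _ _).trans (add_le_add ((norm_sub_le _ _).trans
          (add_le_add (hval b hb) (hval a ha))) herr)
    _ = 3 / l := by ring

/-- The second-derivative test when the phase is nondecreasing on the interval. -/
theorem norm_integral_exp_le_of_deriv_nonneg {φ φ' φ'' : ℝ → ℝ} {a b δ : ℝ}
    (h1 : ∀ s, HasDerivAt φ (φ' s) s) (h2 : ∀ s, HasDerivAt φ' (φ'' s) s)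
    (hc : Continuous φ'') (hab : a ≤ b) (hδ : 0 < δ)
    (ha : 0 ≤ φ' a) (hφ'' : ∀ s ∈ Icc a b, 1 ≤ φ'' s * δ ^ 2) :
    ‖∫ s in a..b, Complex.exp (φ s * Complex.I)‖ ≤ 4 * δ := by
  have hcφ : Continuous φ := continuous_iff_continuousAt.2 fun s => (h1 s).continuousAt
  have hce : Continuous fun s => Complex.exp (φ s * Complex.I) := by fun_prop
  have triv : ∀ c d : ℝ, c ≤ d → ‖∫ s in c..d, Complex.exp (φ s * Complex.I)‖ ≤ d - c := by
    intro c d hcd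
    refine (intervalIntegral.norm_integral_le_of_norm_le_const (C := 1) fun s _ => ?_).trans ?_
    · exact (Complex.norm_exp_ofReal_mul_I _).le
    · rw [abs_of_nonneg (sub_nonneg.2 hcd), one_mul]
  rcases le_or_gt b (a + δ) with hb | hb
  · exact (triv a b hab).trans (by linarith)
  have hpos : ∀ s ∈ Icc a b, (δ ^ 2)⁻¹ ≤ φ'' s := fun s hs => by
    rw [inv_le_iff_one_le_mul₀ (by positivity)]; exact hφ'' s hs
  -- beyond distance `δ` from `a` the phase derivative is at least `δ⁻¹`
  have hgrow : ∀ s ∈ Icc (a + δ) b, δ⁻¹ ≤ φ' s := by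
    intro s hs
    have := (convex_Icc a b).mul_sub_le_image_sub_of_le_deriv (f := φ') (C := (δ ^ 2)⁻¹)
      (fun x _ => (h2 x).continuousAt.continuousWithinAt)
      (fun x _ => (h2 x).differentiableAt.differentiableWithinAt)
      (fun x hx => by rw [(h2 x).deriv]; exact hpos x (interior_subset hx))
      a ⟨le_rfl, hab⟩ s ⟨by linarith [hs.1], hs.2⟩ (by linarith [hs.1])
    have h5 : (δ ^ 2)⁻¹ * δ ≤ (δ ^ 2)⁻¹ * (s - a) :=
      mul_le_mul_of_nonneg_left (by linarith [hs.1]) (by positivity)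
    have h6 : (δ ^ 2)⁻¹ * δ = δ⁻¹ := by field_simp
    linarith
  have h3 := norm_integral_exp_le_of_le_deriv h1 h2 hc hb.le (inv_pos.2 hδ) hgrow
    (fun s hs => le_trans (by positivity) (hpos s ⟨by linarith [hs.1], hs.2⟩))
  rw [← intervalIntegral.integral_add_adjacent_intervals (hce.intervalIntegrable a (a + δ))
    (hce.intervalIntegrable (a + δ) b)]
  refine (norm_add_le _ _).trans ((add_le_add (triv a (a + δ) (by linarith)) h3).trans ?_)
  rw [div_inv_eq_mul]
  linarith

/-- The second-derivative test when the phase is nonincreasing on the interval. -/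
theorem norm_integral_exp_le_of_deriv_nonpos {φ φ' φ'' : ℝ → ℝ} {a b δ : ℝ}
    (h1 : ∀ s, HasDerivAt φ (φ' s) s) (h2 : ∀ s, HasDerivAt φ' (φ'' s) s)
    (hc : Continuous φ'') (hab : a ≤ b) (hδ : 0 < δ)
    (hb : φ' b ≤ 0) (hφ'' : ∀ s ∈ Icc a b, 1 ≤ φ'' s * δ ^ 2) :
    ‖∫ s in a..b, Complex.exp (φ s * Complex.I)‖ ≤ 4 * δ := by
  have h := norm_integral_exp_le_of_deriv_nonneg (φ := fun s => φ (-s))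
    (φ' := fun s => -φ' (-s)) (φ'' := fun s => φ'' (-s)) (a := -b) (b := -a) (δ := δ)
    (fun s => ((h1 (-s)).comp s (hasDerivAt_neg s)).congr_deriv (by ring))
    (fun s => (((h2 (-s)).comp s (hasDerivAt_neg s)).neg).congr_deriv (by ring))
    (by fun_prop) (by linarith) hδ (by simpa using hb)
    (fun s hs => hφ'' (-s) ⟨by linarith [hs.2], by linarith [hs.1]⟩)
  rwa [intervalIntegral.integral_comp_neg (fun s => Complex.exp (φ s * Complex.I)), neg_neg,
    neg_neg] at h

/-- Van der Corput's second-derivative test: if `φ'' ≥ δ⁻²`, then the oscillatory integral is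
`O(δ)`. -/
theorem norm_integral_exp_le {φ φ' φ'' : ℝ → ℝ} {a b δ : ℝ}
    (h1 : ∀ s, HasDerivAt φ (φ' s) s) (h2 : ∀ s, HasDerivAt φ' (φ'' s) s)
    (hc : Continuous φ'') (hab : a ≤ b) (hδ : 0 < δ)
    (hφ'' : ∀ s ∈ Icc a b, 1 ≤ φ'' s * δ ^ 2) :
    ‖∫ s in a..b, Complex.exp (φ s * Complex.I)‖ ≤ 8 * δ := by
  have hcφ : Continuous φ := continuous_iff_continuousAt.2 fun s => (h1 s).continuousAt
  have hcφ' : Continuous φ' := continuous_iff_continuousAt.2 fun s => (h2 s).continuousAt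
  have hce : Continuous fun s => Complex.exp (φ s * Complex.I) := by fun_prop
  rcases le_or_gt 0 (φ' a) with ha | ha
  · exact (norm_integral_exp_le_of_deriv_nonneg h1 h2 hc hab hδ ha hφ'').trans (by linarith)
  rcases le_or_gt (φ' b) 0 with hb | hb
  · exact (norm_integral_exp_le_of_deriv_nonpos h1 h2 hc hab hδ hb hφ'').trans (by linarith)
  obtain ⟨c, hcI, hc0⟩ := intermediate_value_Icc hab hcφ'.continuousOn ⟨ha.le, hb.le⟩
  have hl := norm_integral_exp_le_of_deriv_nonpos h1 h2 hc hcI.1 hδ hc0.le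
    (fun s hs => hφ'' s ⟨hs.1, hs.2.trans hcI.2⟩)
  have hr := norm_integral_exp_le_of_deriv_nonneg h1 h2 hc hcI.2 hδ hc0.ge
    (fun s hs => hφ'' s ⟨hcI.1.trans hs.1, hs.2⟩)
  rw [← intervalIntegral.integral_add_adjacent_intervals (hce.intervalIntegrable a c)
    (hce.intervalIntegrable c b)]
  exact (norm_add_le _ _).trans (by linarith)

/-- The cubic phase `α s³ + β s`. -/
def cubicPhase (α β s : ℝ) : ℝ := α * s ^ 3 + β * s

theorem continuous_cubicPhase (α β : ℝ) : Continuous (cubicPhase α β) := by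
  unfold cubicPhase; fun_prop

theorem norm_integral_exp_cubicPhase_le {α β a b : ℝ} (hα : 0 < α) (ha : 0 < a) (hab : a ≤ b) :
    ‖∫ s in a..b, Complex.exp (cubicPhase α β s * Complex.I)‖ ≤ 8 * (α * a) ^ (-(1 / 2) : ℝ) := by
  refine norm_integral_exp_le (φ' := fun s => α * (3 * s ^ 2) + β)
    (φ'' := fun s => α * (3 * (2 * s))) (fun s => ?_) (fun s => ?_) (by fun_prop) hab
    (by positivity) (fun s hs => ?_)
  · exact (((hasDerivAt_pow 3 s).const_mul α).add ((hasDerivAt_id s).const_mul β)).congr_deriv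
      (by norm_num)
  · exact (((hasDerivAt_pow 2 s).const_mul 3).const_mul α).add_const β |>.congr_deriv (by norm_num)
  · rw [← Real.rpow_natCast ((α * a) ^ _) 2, ← Real.rpow_mul (by positivity)]
    norm_num
    rw [Real.rpow_neg_one, ← div_eq_mul_inv]
    rw [le_div_iff₀ (by positivity)]
    nlinarith [hs.1, mul_pos hα ha, mul_le_mul_of_nonneg_left hs.1 hα.le]

/-- Uniform decay of the truncated Airy integral over the half-line. -/
theorem norm_integral_exp_cubicPhase_zero_le {α β N : ℝ} (hα : 0 < α) (hN : 0 ≤ N) :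
    ‖∫ s in (0)..N, Complex.exp (cubicPhase α β s * Complex.I)‖ ≤ 9 * α ^ (-(1 / 3) : ℝ) := by
  have hce : Continuous fun s => Complex.exp (cubicPhase α β s * Complex.I) := by
    have := continuous_cubicPhase α β; fun_prop
  have triv : ∀ d : ℝ, 0 ≤ d → ‖∫ s in (0)..d, Complex.exp (cubicPhase α β s * Complex.I)‖ ≤ d := by
    intro d hd
    refine (intervalIntegral.norm_integral_le_of_norm_le_const (C := 1) fun s _ => ?_).trans ?_
    · exact (Complex.norm_exp_ofReal_mul_I _).le
    · rw [sub_zero, abs_of_nonneg hd, one_mul]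
  -- the trivial bound and the second-derivative test balance at `α^{-1/3}`
  set c := α ^ (-(1 / 3) : ℝ) with hcdef
  have hc : 0 < c := by positivity
  rcases le_or_gt N c with h | h
  · exact (triv N hN).trans (by linarith)
  have h2 := norm_integral_exp_cubicPhase_le (β := β) hα hc h.le
  have h3 : (α * c) ^ (-(1 / 2) : ℝ) = c := by
    rw [hcdef, ← Real.rpow_one_add' hα.le (by norm_num), ← Real.rpow_mul hα.le]
    norm_num
  rw [h3] at h2
  rw [← intervalIntegral.integral_add_adjacent_intervals (hce.intervalIntegrable 0 c)
    (hce.intervalIntegrable c N)]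
  exact (norm_add_le _ _).trans (by linarith [triv c hc.le])

/-- With the amplitude `s` the truncated Airy integral still decays, with a loss of half a
derivative. Integrating by parts, the amplitude is traded for the tail integrals
`∫_s^N`, to which the second-derivative test applies. -/
theorem norm_integral_mul_exp_cubicPhase_zero_le {α β N : ℝ} (hα : 0 < α) (hN : 0 ≤ N) :
    ‖∫ s in (0)..N, (s : ℂ) * Complex.exp (cubicPhase α β s * Complex.I)‖ ≤
      16 * (α ^ (-(1 / 2) : ℝ) * N ^ (1 / 2 : ℝ)) := by
  set e : ℝ → ℂ := fun s => Complex.exp (cubicPhase α β s * Complex.I) with he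
  have hce : Continuous e := by
    have := continuous_cubicPhase α β; fun_prop
  set F : ℝ → ℂ := fun s => ∫ r in s..N, e r with hF
  have hdF : ∀ s, HasDerivAt F (-e s) s := fun s =>
    intervalIntegral.integral_hasDerivAt_left (hce.intervalIntegrable _ _)
      hce.stronglyMeasurable.stronglyMeasurableAtFilter hce.continuousAt
  have hcF : Continuous F := continuous_iff_continuousAt.2 fun s => (hdF s).continuousAt
  have hparts := intervalIntegral.integral_mul_deriv_eq_deriv_mul (a := 0) (b := N)
    (u := fun s : ℝ => (s : ℂ)) (u' := fun _ => 1) (v := F) (v' := fun s => -e s)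
    (fun s _ => by simpa using (hasDerivAt_id s).ofReal_comp) (fun s _ => hdF s)
    (continuous_const.intervalIntegrable _ _) (hce.neg.intervalIntegrable _ _)
  have hFN : F N = 0 := by simp [hF]
  have heq : ∫ s in (0)..N, (s : ℂ) * e s = ∫ s in (0)..N, F s := by
    simp only [mul_neg, intervalIntegral.integral_neg, hFN, Complex.ofReal_zero, zero_mul, mul_zero,
      sub_zero, zero_sub, one_mul] at hparts
    exact neg_injective hparts
  rw [heq]
  have hint : IntervalIntegrable (fun s : ℝ => 8 * α ^ (-(1 / 2) : ℝ) * s ^ (-(1 / 2) : ℝ))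
      volume 0 N := (intervalIntegral.intervalIntegrable_rpow' (by norm_num)).const_mul _
  refine (intervalIntegral.norm_integral_le_of_norm_le hN
    (Eventually.of_forall fun s hs => ?_) hint).trans ?_
  · refine (norm_integral_exp_cubicPhase_le hα hs.1 hs.2).trans_eq ?_
    rw [Real.mul_rpow hα.le hs.1.le, mul_assoc]
  · rw [intervalIntegral.integral_const_mul, integral_rpow (Or.inl (by norm_num))]
    norm_num
    linarith

/-- A conjugation symmetry reduces an integral over `[-N, N]` to one over `[0, N]`. -/
theorem norm_integral_symm_le {f : ℝ → ℂ} (hf : Continuous f) {c : ℂ} (hc : ‖c‖ = 1)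
    (hfc : ∀ s, f (-s) = c * starRingEnd ℂ (f s)) (N : ℝ) :
    ‖∫ s in (-N)..N, f s‖ ≤ 2 * ‖∫ s in (0)..N, f s‖ := by
  rw [← intervalIntegral.integral_add_adjacent_intervals (hf.intervalIntegrable (-N) 0)
    (hf.intervalIntegrable 0 N)]
  have h : ∫ s in (-N)..0, f s = c * starRingEnd ℂ (∫ s in (0)..N, f s) := by
    have := intervalIntegral.integral_comp_neg (a := 0) (b := N) f
    rw [neg_zero] at this
    rw [← this]
    simp only [hfc, intervalIntegral.integral_const_mul]
    rw [intervalIntegral.intervalIntegral_eq_integral_uIoc,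
      intervalIntegral.intervalIntegral_eq_integral_uIoc, integral_conj]
    simp only [Complex.real_smul, map_mul, Complex.conj_ofReal]
  rw [h]
  refine (norm_add_le _ _).trans ?_
  rw [norm_mul, hc, RCLike.norm_conj]
  linarith

theorem conj_exp_cubicPhase (α β s : ℝ) : Complex.exp (cubicPhase α β (-s) * Complex.I) =
    starRingEnd ℂ (Complex.exp (cubicPhase α β s * Complex.I)) := by
  rw [← Complex.exp_conj]
  congr 1
  simp only [cubicPhase, map_mul, Complex.conj_ofReal, Complex.conj_I]
  push_cast
  ring

theorem norm_airyIntegral_le {α : ℝ} (β : ℝ) {N : ℝ} (hα : 0 < α) (hN : 0 ≤ N) :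
    ‖∫ s in (-N)..N, Complex.exp (cubicPhase α β s * Complex.I)‖ ≤ 18 * α ^ (-(1 / 3) : ℝ) := by
  have := continuous_cubicPhase α β
  refine (norm_integral_symm_le (c := 1) (by fun_prop) (by simp)
    (fun s => by rw [one_mul, conj_exp_cubicPhase]) N).trans ?_
  linarith [norm_integral_exp_cubicPhase_zero_le (β := β) hα hN]

theorem norm_airyIntegral_deriv_le {α : ℝ} (β : ℝ) {N : ℝ} (hα : 0 < α) (hN : 0 ≤ N) :
    ‖∫ s in (-N)..N, (s : ℂ) * Complex.exp (cubicPhase α β s * Complex.I)‖ ≤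
      32 * (α ^ (-(1 / 2) : ℝ) * N ^ (1 / 2 : ℝ)) := by
  have := continuous_cubicPhase α β
  refine (norm_integral_symm_le (c := -1) (by fun_prop) (by simp)
    (fun s => by rw [conj_exp_cubicPhase]; simp) N).trans ?_
  linarith [norm_integral_mul_exp_cubicPhase_zero_le (β := β) hα hN]

/-! ### The truncated kernel of the linear evolution -/

/-- On `L¹ ∩ L²` the `L²` inverse Fourier transform is given by the integral. -/
theorem fourierInv_toLp_ae_eq {G : Plane → ℂ} (h1 : Integrable G) (h2 : MemLp G 2 volume) :
    (𝓕⁻ h2.toLp : Lp ℂ 2 (volume : Measure Plane)) =ᵐ[volume] 𝓕⁻ G := by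
  have hflip : 𝓕⁻ G = fun x => 𝓕 G (-x) := by
    ext x; rw [Real.fourierInv_eq_fourier_neg]
  have hcont : Continuous (𝓕⁻ G) := by
    rw [hflip]
    exact (VectorFourier.fourierIntegral_continuous Real.continuous_fourierChar
      (L := innerₗ Plane) continuous_inner h1).comp continuous_neg
  refine ae_eq_of_integral_contDiff_smul_eq
    ((Lp.memLp _).locallyIntegrable (by norm_num)) hcont.locallyIntegrable ?_
  intro g hg hgc
  have hg₁ : HasCompactSupport (Complex.ofRealCLM ∘ g) := hgc.comp_left rfl
  have hg₂ : ContDiff ℝ ∞ (Complex.ofRealCLM ∘ g) := by fun_prop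
  set ψ : SchwartzMap Plane ℂ := hg₁.toSchwartzMap hg₂ with hψ
  have e1 := congrArg (fun T => T ψ) (Lp.fourierInv_toTemperedDistribution_eq (h2.toLp G))
  simp only [TemperedDistribution.fourierInv_apply, Lp.toTemperedDistribution_apply] at e1
  have e2 : ∫ x, (𝓕⁻ ψ) x • (h2.toLp G) x = ∫ x, (𝓕⁻ ψ) x • G x := by
    refine integral_congr_ae ?_
    filter_upwards [h2.coeFn_toLp] with x hx
    rw [hx]
  have e3 : ∫ x, (𝓕⁻ ψ) x • G x = ∫ x, ψ x • (𝓕⁻ G) x := by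
    have hflip2 := VectorFourier.integral_fourierIntegral_smul_eq_flip (𝕜 := ℝ) (L := innerₗ Plane)
      (μ := volume) (ν := volume) (f := ψ) (g := fun x => G (-x))
      Real.continuous_fourierChar continuous_inner ψ.integrable h1.comp_neg
    rw [← integral_neg_eq_self]
    have a1 : ∀ x, (𝓕⁻ ψ) (-x) = (𝓕 ψ) x := fun x => by
      rw [SchwartzMap.fourierInv_coe, Real.fourierInv_eq_fourier_neg, neg_neg,
        SchwartzMap.fourier_coe]
    have a2 : ∀ x, (𝓕⁻ G) x = 𝓕 (fun x => G (-x)) x := fun x => by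
      rw [Real.fourierInv_eq_fourier_comp_neg]
    simp only [a1, a2]
    simpa using! hflip2
  have e4 : ∀ x, ψ x = (g x : ℂ) := fun x => rfl
  have := (e2.symm.trans e1).symm.trans e3
  simp only [e4] at this
  simpa [Complex.real_smul] using this

/-- The real amplitude `1` (for `none`) or `ξ j` (for `some j`): the synthesis of a function or of
its `j`-th partial derivative from its Fourier transform. -/
def amp : Option (Fin 2) → Plane → ℝ
  | none, _ => 1
  | some j, ξ => ξ j

/-- The closed frequency square of half-side `N`. -/
def freqSquare (N : ℝ) : Set Plane := {ξ | ∀ i, |ξ i| ≤ N}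

theorem measurableSet_freqSquare (N : ℝ) : MeasurableSet (freqSquare N) := by
  have : freqSquare N = ⋂ i, {ξ : Plane | |ξ i| ≤ N} := by ext; simp [freqSquare]
  rw [this]
  exact MeasurableSet.iInter fun i =>
    (isClosed_le (by fun_prop) continuous_const).measurableSet

theorem continuous_amp (o : Option (Fin 2)) : Continuous (amp o) := by
  cases o with
  | none => exact continuous_const
  | some j =>
    change Continuous fun ξ : Plane => ξ j
    fun_prop

theorem abs_amp_le {o : Option (Fin 2)} {N : ℝ} (hN : 1 ≤ N) {ξ : Plane} (h : ξ ∈ freqSquare N) :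
    |amp o ξ| ≤ N := by
  cases o with
  | none => simpa [amp] using hN
  | some j => exact h j

theorem integral_prod_plane (f : Fin 2 → ℝ → ℂ) :
    ∫ ξ : Plane, f 0 (ξ 0) * f 1 (ξ 1) = (∫ s, f 0 s) * ∫ s, f 1 s := by
  have h := (PiLp.volume_preserving_toLp (Fin 2)).integral_comp
    (MeasurableEquiv.toLp 2 (Fin 2 → ℝ)).measurableEmbedding
    (fun ξ : Plane => f 0 (ξ 0) * f 1 (ξ 1))
  rw [← h]
  have h2 := integral_fintype_prod_volume_eq_prod (𝕜 := ℂ) f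
  simp only [Fin.prod_univ_two] at h2
  exact h2

theorem volume_freqSquare (N : ℝ) :
    volume (freqSquare N) = ENNReal.ofReal (2 * N) ^ 2 := by
  have h := (PiLp.volume_preserving_toLp (Fin 2)).measure_preimage_equiv
    (f := MeasurableEquiv.toLp 2 (Fin 2 → ℝ)) (freqSquare N)
  rw [← h]
  have : (MeasurableEquiv.toLp 2 (Fin 2 → ℝ)) ⁻¹' freqSquare N = Set.pi univ fun _ => Icc (-N) N := by
    ext x; simp [freqSquare, abs_le, Pi.le_def, forall_and]
  rw [this, volume_pi_pi]
  simp only [Real.volume_Icc, Finset.prod_const, Finset.card_univ, Fintype.card_fin]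
  ring_nf

/-- The kernel of the linear evolution at time `t`, restricted to the frequency square. -/
noncomputable def truncKernel (o : Option (Fin 2)) (t N : ℝ) (z : Plane) : ℂ :=
  ∫ ξ : Plane in freqSquare N, (amp o ξ : ℂ) * airySymbol t ξ *
    Complex.exp ((2 * Real.pi * inner ℝ ξ z : ℝ) * Complex.I)

/-- The truncated kernel is a product of two truncated Airy integrals, of which at most one carries
an amplitude. With the amplitude, the side `t^{3/5}` of the square makes the decay
`t^{-1/2} t^{3/10} = t^{-1/5}`. -/
theorem norm_truncKernel_le {t N : ℝ} (ht : 1 ≤ t) (hN : N = t ^ (3 / 5 : ℝ))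
    (o : Option (Fin 2)) (z : Plane) : ‖truncKernel o t N z‖ ≤ 600 * t ^ (-(8 / 15) : ℝ) := by
  have ht0 : 0 < t := by linarith
  have hN0 : 0 ≤ N := by rw [hN]; positivity
  set α := t * (2 * Real.pi) ^ 3 with hα
  have hpi : 1 ≤ 2 * Real.pi := by linarith [Real.two_le_pi]
  have htα : t ≤ α := by
    rw [hα]; exact le_mul_of_one_le_right ht0.le (one_le_pow₀ hpi)
  have hα0 : 0 < α := by linarith
  set f : Fin 2 → ℝ → ℂ := fun i => (Icc (-N) N).indicator fun s =>
    (if o = some i then (s : ℂ) else 1) *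
      Complex.exp (cubicPhase α (2 * Real.pi * z i) s * Complex.I) with hf
  have hprod : truncKernel o t N z = (∫ s, f 0 s) * ∫ s, f 1 s := by
    rw [← integral_prod_plane, truncKernel, ← integral_indicator (measurableSet_freqSquare N)]
    refine integral_congr_ae (Eventually.of_forall fun ξ => ?_)
    by_cases h : ξ ∈ freqSquare N
    · have h0 : ξ 0 ∈ Icc (-N) N := abs_le.1 (h 0)
      have h1 : ξ 1 ∈ Icc (-N) N := abs_le.1 (h 1)
      have hexp : airySymbol t ξ * Complex.exp ((2 * Real.pi * inner ℝ ξ z : ℝ) * Complex.I) =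
          Complex.exp (cubicPhase α (2 * Real.pi * z 0) (ξ 0) * Complex.I) *
          Complex.exp (cubicPhase α (2 * Real.pi * z 1) (ξ 1) * Complex.I) := by
        rw [airySymbol, ← Complex.exp_add, ← Complex.exp_add]
        congr 1
        simp only [PiLp.inner_apply, Fin.sum_univ_two, cubicPhase, hα, RCLike.inner_apply,
          conj_trivial]
        push_cast
        ring
      have hamp : (amp o ξ : ℂ) = (if o = some 0 then (ξ 0 : ℂ) else 1) *
          (if o = some 1 then (ξ 1 : ℂ) else 1) := by
        rcases o with _ | j
        · simp [amp]
        · fin_cases j <;> simp [amp]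
      rw [indicator_of_mem h, mul_assoc, hexp, hamp]
      simp only [hf, indicator_of_mem h0, indicator_of_mem h1]
      ring
    · rw [indicator_of_notMem h]
      have : ∃ i, ξ i ∉ Icc (-N) N := by
        by_contra! hc
        exact h fun i => abs_le.2 (hc i)
      obtain ⟨i, hi⟩ := this
      fin_cases i
      · simp only [Fin.zero_eta] at hi
        simp [hf, indicator_of_notMem hi]
      · simp only [Fin.mk_one] at hi
        simp [hf, indicator_of_notMem hi]
  have hfi : ∀ i, ∫ s, f i s = ∫ s in (-N)..N, (if o = some i then (s : ℂ) else 1) *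
      Complex.exp (cubicPhase α (2 * Real.pi * z i) s * Complex.I) := fun i => by
    rw [hf, integral_indicator measurableSet_Icc, integral_Icc_eq_integral_Ioc,
      ← intervalIntegral.integral_of_le (by linarith)]
  have hαt : ∀ r : ℝ, r ≤ 0 → α ^ r ≤ t ^ r := fun r hr =>
    Real.rpow_le_rpow_of_nonpos ht0 htα hr
  have hplain : ∀ i, o ≠ some i → ‖∫ s, f i s‖ ≤ 18 * t ^ (-(1 / 3) : ℝ) := fun i hi => by
    rw [hfi]
    simp only [if_neg hi, one_mul]
    refine (norm_airyIntegral_le _ hα0 hN0).trans ?_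
    have := hαt (-(1 / 3)) (by norm_num)
    linarith
  have hderiv : ∀ i, o = some i → ‖∫ s, f i s‖ ≤ 32 * t ^ (-(1 / 5) : ℝ) := fun i hi => by
    rw [hfi]
    simp only [if_pos hi]
    refine (norm_airyIntegral_deriv_le _ hα0 hN0).trans ?_
    have h1 := hαt (-(1 / 2)) (by norm_num)
    have h2 : t ^ (-(1 / 2) : ℝ) * N ^ (1 / 2 : ℝ) = t ^ (-(1 / 5) : ℝ) := by
      rw [hN, ← Real.rpow_mul ht0.le, ← Real.rpow_add ht0]
      norm_num
    have h3 := mul_le_mul_of_nonneg_right h1 (show 0 ≤ N ^ (1 / 2 : ℝ) by positivity)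
    linarith
  have hmul : t ^ (-(1 / 3) : ℝ) * t ^ (-(1 / 5) : ℝ) = t ^ (-(8 / 15) : ℝ) := by
    rw [← Real.rpow_add ht0]; norm_num
  rw [hprod, norm_mul]
  have hmix : ∀ i j, o = some i → o ≠ some j → ‖∫ s, f i s‖ * ‖∫ s, f j s‖ ≤
      600 * t ^ (-(8 / 15) : ℝ) := fun i j hi hj => by
    calc _ ≤ (32 * t ^ (-(1 / 5) : ℝ)) * (18 * t ^ (-(1 / 3) : ℝ)) :=
          mul_le_mul (hderiv i hi) (hplain j hj) (norm_nonneg _) (by positivity)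
      _ = 576 * t ^ (-(8 / 15) : ℝ) := by rw [← hmul]; ring
      _ ≤ _ := by gcongr; norm_num
  rcases o with _ | j
  · calc _ ≤ (18 * t ^ (-(1 / 3) : ℝ)) * (18 * t ^ (-(1 / 3) : ℝ)) :=
          mul_le_mul (hplain 0 (by simp)) (hplain 1 (by simp)) (norm_nonneg _) (by positivity)
      _ = 324 * t ^ (-(2 / 3) : ℝ) := by
          rw [show (-(2 / 3) : ℝ) = -(1 / 3) + -(1 / 3) by norm_num, Real.rpow_add ht0]; ring
      _ ≤ 600 * t ^ (-(8 / 15) : ℝ) := by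
          have := Real.rpow_le_rpow_of_exponent_le ht
            (show (-(2 / 3) : ℝ) ≤ -(8 / 15) by norm_num)
          have := Real.rpow_nonneg ht0.le (-(8 / 15) : ℝ)
          linarith
  · fin_cases j
    · exact hmix 0 1 rfl (by simp)
    · rw [mul_comm]; exact hmix 1 0 rfl (by simp)

/-! ### Dispersive decay -/

theorem lintegral_mul_le_sqrt {α : Type*} [MeasurableSpace α] {μ : Measure α} {f g : α → ℝ≥0∞}
    (hf : AEMeasurable f μ) (hg : AEMeasurable g μ) :
    ∫⁻ x, f x * g x ∂μ ≤
      (∫⁻ x, f x ^ 2 ∂μ) ^ (1 / 2 : ℝ) * (∫⁻ x, g x ^ 2 ∂μ) ^ (1 / 2 : ℝ) := by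
  have := ENNReal.lintegral_mul_le_Lp_mul_Lq μ Real.HolderConjugate.two_two hf hg
  simpa using this

theorem eLpNorm_two_sq {α F : Type*} [MeasurableSpace α] {μ : Measure α} [NormedAddCommGroup F]
    (f : α → F) : eLpNorm f 2 μ ^ 2 = ∫⁻ x, ‖f x‖ₑ ^ 2 ∂μ := by
  have := eLpNorm_nnreal_pow_eq_lintegral (f := f) (μ := μ) (p := 2) (by norm_num)
  simpa using! this

/-- The weight `1 + |ζ|²`, where `ζ = 2πξ`. -/
noncomputable def bracket (ξ : Plane) : ℝ := 1 + ‖(2 * Real.pi) • ξ‖ ^ 2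

theorem continuous_bracket : Continuous bracket := by unfold bracket; fun_prop

theorem one_le_bracket (ξ : Plane) : 1 ≤ bracket ξ := by unfold bracket; nlinarith [norm_nonneg ξ]

theorem bracket_pos (ξ : Plane) : 0 < bracket ξ := by linarith [one_le_bracket ξ]

theorem one_add_sq_le_bracket (ξ : Plane) : 1 + ‖ξ‖ ^ 2 ≤ bracket ξ := by
  unfold bracket
  rw [norm_smul, Real.norm_of_nonneg (by positivity), mul_pow]
  have : 1 ≤ (2 * Real.pi) ^ 2 := one_le_pow₀ (by linarith [Real.two_le_pi])
  nlinarith [sq_nonneg ‖ξ‖]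

theorem norm_sq_plane (ξ : Plane) : ‖ξ‖ ^ 2 = ξ 0 ^ 2 + ξ 1 ^ 2 := by
  rw [EuclideanSpace.norm_sq_eq]; simp

theorem amp_sq_le_bracket (o : Option (Fin 2)) (ξ : Plane) : amp o ξ ^ 2 ≤ bracket ξ := by
  refine le_trans ?_ (one_add_sq_le_bracket ξ)
  rw [norm_sq_plane]
  rcases o with _ | j
  · simp only [amp]; nlinarith [sq_nonneg (ξ 0), sq_nonneg (ξ 1)]
  · fin_cases j <;> simp only [amp, Fin.zero_eta, Fin.mk_one] <;>
      nlinarith [sq_nonneg (ξ 0), sq_nonneg (ξ 1)]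

/-- The squared `H³` norm of a function with Fourier transform `U`. -/
noncomputable def sobolevSq (U : Plane → ℂ) : ℝ≥0∞ :=
  ∫⁻ ξ, ENNReal.ofReal (bracket ξ ^ 3) * ‖U ξ‖ₑ ^ 2

/-- Cauchy–Schwarz against the `H³` norm. -/
theorem lintegral_le_sobolevSq {h : Plane → ℝ} (hh : Measurable h) {U : Plane → ℂ}
    (hU : AEStronglyMeasurable U) :
    ∫⁻ ξ, ENNReal.ofReal |h ξ| * ‖U ξ‖ₑ ≤
      (∫⁻ ξ, ENNReal.ofReal (h ξ ^ 2 / bracket ξ ^ 3)) ^ (1 / 2 : ℝ) *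
        sobolevSq U ^ (1 / 2 : ℝ) := by
  have hb := continuous_bracket.measurable
  have hs : ∀ ξ, 0 < Real.sqrt (bracket ξ ^ 3) := fun ξ => Real.sqrt_pos.2 (pow_pos (bracket_pos ξ) 3)
  have key := lintegral_mul_le_sqrt (μ := (volume : Measure Plane))
    (f := fun ξ => ENNReal.ofReal (|h ξ| / Real.sqrt (bracket ξ ^ 3)))
    (g := fun ξ => ENNReal.ofReal (Real.sqrt (bracket ξ ^ 3)) * ‖U ξ‖ₑ)
    (by fun_prop) (by fun_prop)
  convert key using 3 with ξ ξ
  · rw [← mul_assoc, ← ENNReal.ofReal_mul (by have := hs ξ; positivity),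
      div_mul_cancel₀ _ (hs ξ).ne']
  · congr with ξ
    rw [← ENNReal.ofReal_pow (by have := hs ξ; positivity), div_pow, sq_abs,
      Real.sq_sqrt (by have := bracket_pos ξ; positivity)]
  · rw [sobolevSq]
    congr with ξ
    rw [mul_pow, ← ENNReal.ofReal_pow (hs ξ).le, Real.sq_sqrt (by have := bracket_pos ξ; positivity)]

theorem finrank_plane_lt {r : ℝ} (hr : 2 < r) : (Module.finrank ℝ Plane : ℝ) < r := by
  simpa using hr

theorem integrable_bracket_rpow {r : ℝ} (hr : 1 < r) :
    Integrable fun ξ : Plane => (1 + ‖ξ‖ ^ 2) ^ (-r) := by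
  have := integrable_rpow_neg_one_add_norm_sq (μ := (volume : Measure Plane)) (r := 2 * r)
    (finrank_plane_lt (by linarith))
  convert this using 3
  ring

theorem lintegral_amp_le_sobolevSq (o : Option (Fin 2)) :
    ∫⁻ ξ, ENNReal.ofReal (amp o ξ ^ 2 / bracket ξ ^ 3) ≤
      ENNReal.ofReal (∫ ξ : Plane, (1 + ‖ξ‖ ^ 2) ^ (-2 : ℝ)) := by
  rw [ofReal_integral_eq_lintegral_ofReal (integrable_bracket_rpow (by norm_num))
    (Eventually.of_forall fun ξ => by positivity)]
  refine lintegral_mono fun ξ => ENNReal.ofReal_le_ofReal ?_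
  have h1 := bracket_pos ξ
  have h2 := one_add_sq_le_bracket ξ
  have h3 : (0 : ℝ) < 1 + ‖ξ‖ ^ 2 := by positivity
  rw [Real.rpow_neg h3.le, show (2 : ℝ) = ((2 : ℕ) : ℝ) by norm_num, Real.rpow_natCast,
    div_le_iff₀ (by positivity), inv_mul_eq_div, le_div_iff₀ (by positivity)]
  calc _ ≤ bracket ξ * bracket ξ ^ 2 := by
        gcongr
        exact amp_sq_le_bracket o ξ
    _ = bracket ξ ^ 3 := by ring

theorem exists_lintegral_amp_le :
    ∃ C : ℝ, 0 < C ∧ ∀ (o : Option (Fin 2)) {U : Plane → ℂ}, AEStronglyMeasurable U →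
      ∫⁻ ξ, ENNReal.ofReal |amp o ξ| * ‖U ξ‖ₑ ≤ ENNReal.ofReal C * sobolevSq U ^ (1 / 2 : ℝ) := by
  refine ⟨Real.sqrt (∫ ξ : Plane, (1 + ‖ξ‖ ^ 2) ^ (-2 : ℝ)) + 1, by positivity, fun o U hU => ?_⟩
  refine (lintegral_le_sobolevSq (continuous_amp o).measurable hU).trans ?_
  gcongr
  refine (ENNReal.rpow_le_rpow (lintegral_amp_le_sobolevSq o) (by norm_num)).trans ?_
  rw [ENNReal.ofReal_rpow_of_nonneg (integral_nonneg fun ξ => by positivity) (by norm_num),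
    ← Real.sqrt_eq_rpow]
  exact ENNReal.ofReal_le_ofReal (by linarith)

/-- The synthesis `x ↦ ∫ e^{2πi⟨ξ,x⟩} a(ξ) U(ξ) dξ` with amplitude `a = amp o`. -/
noncomputable def synth (o : Option (Fin 2)) (U : Plane → ℂ) (x : Plane) : ℂ :=
  ∫ ξ, Complex.exp ((2 * Real.pi * inner ℝ ξ x : ℝ) * Complex.I) * ((amp o ξ : ℂ) * U ξ)

theorem integrable_synth (o : Option (Fin 2)) {U : Plane → ℂ} (hU : AEStronglyMeasurable U)
    (hfin : sobolevSq U ≠ ⊤) (x : Plane) :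
    Integrable fun ξ =>
      Complex.exp ((2 * Real.pi * inner ℝ ξ x : ℝ) * Complex.I) * ((amp o ξ : ℂ) * U ξ) := by
  obtain ⟨C, -, hC⟩ := exists_lintegral_amp_le
  have hca := continuous_amp o
  refine ⟨(by fun_prop : Continuous fun ξ : Plane =>
      Complex.exp ((2 * Real.pi * inner ℝ ξ x : ℝ) * Complex.I)).aestronglyMeasurable.mul
    ((Complex.continuous_ofReal.comp hca).aestronglyMeasurable.mul hU), ?_⟩
  rw [hasFiniteIntegral_iff_enorm]
  refine lt_of_eq_of_lt (lintegral_congr fun ξ => ?_) ((hC o hU).trans_lt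
    (ENNReal.mul_lt_top ENNReal.ofReal_lt_top (ENNReal.rpow_lt_top_of_nonneg (by norm_num) hfin)))
  rw [enorm_mul, enorm_mul, ← ofReal_norm (Complex.exp _), Complex.norm_exp_ofReal_mul_I,
    ENNReal.ofReal_one, one_mul, ← ofReal_norm (amp o ξ : ℂ), Complex.norm_real, Real.norm_eq_abs]

theorem enorm_exp_mul_I (r : ℝ) : ‖Complex.exp (r * Complex.I)‖ₑ = 1 := by
  rw [← ofReal_norm, Complex.norm_exp_ofReal_mul_I, ENNReal.ofReal_one]

theorem enorm_amp (o : Option (Fin 2)) (ξ : Plane) : ‖(amp o ξ : ℂ)‖ₑ = ENNReal.ofReal |amp o ξ| := by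
  rw [← ofReal_norm, Complex.norm_real, Real.norm_eq_abs]

/-- Frequencies outside the square of side `t^{3/5}` are controlled by the `H³` norm alone. -/
theorem exists_highFreq_le : ∃ C : ℝ, 0 < C ∧ ∀ (o : Option (Fin 2)) {U : Plane → ℂ},
    AEStronglyMeasurable U → ∀ {t M : ℝ}, 1 ≤ t → 0 ≤ M → sobolevSq U ≤ ENNReal.ofReal (M ^ 2) →
      ∀ x, ‖∫ ξ in (freqSquare (t ^ (3 / 5 : ℝ)))ᶜ,
        Complex.exp ((2 * Real.pi * inner ℝ ξ x : ℝ) * Complex.I) * ((amp o ξ : ℂ) * U ξ)‖ ≤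
          C * t ^ (-(31 / 60) : ℝ) * M := by
  set I := ∫ ξ : Plane, (1 + ‖ξ‖ ^ 2) ^ (-(41 / 36) : ℝ) with hI
  have hI0 : 0 ≤ I := integral_nonneg fun ξ => by positivity
  refine ⟨Real.sqrt I + 1, by positivity, fun o U hU t M ht hM hUM x => ?_⟩
  set N := t ^ (3 / 5 : ℝ) with hN
  have ht0 : 0 < t := by linarith
  have hN0 : 0 < N := by positivity
  set h : Plane → ℝ := (freqSquare N)ᶜ.indicator (amp o) with hh
  have hmeas : Measurable h :=
    (continuous_amp o).measurable.indicator (measurableSet_freqSquare N).compl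
  have hbase : ‖∫ ξ in (freqSquare N)ᶜ,
      Complex.exp ((2 * Real.pi * inner ℝ ξ x : ℝ) * Complex.I) * ((amp o ξ : ℂ) * U ξ)‖ₑ ≤
      ∫⁻ ξ, ENNReal.ofReal |h ξ| * ‖U ξ‖ₑ := by
    rw [← integral_indicator (measurableSet_freqSquare N).compl]
    refine (enorm_integral_le_lintegral_enorm _).trans (lintegral_mono fun ξ => ?_)
    by_cases hξ : ξ ∈ (freqSquare N)ᶜ
    · simp only [hh, indicator_of_mem hξ]
      rw [enorm_mul, enorm_mul, enorm_exp_mul_I, one_mul, enorm_amp]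
    · simp [hh, indicator_of_notMem hξ]
  have hw : ∫⁻ ξ, ENNReal.ofReal (h ξ ^ 2 / bracket ξ ^ 3) ≤
      ENNReal.ofReal ((t ^ (-(31 / 60) : ℝ)) ^ 2 * I) := by
    rw [hI, ← integral_const_mul, ofReal_integral_eq_lintegral_ofReal
      ((integrable_bracket_rpow (by norm_num)).const_mul _)
      (Eventually.of_forall fun ξ => by positivity)]
    refine lintegral_mono fun ξ => ENNReal.ofReal_le_ofReal ?_
    by_cases hξ : ξ ∈ (freqSquare N)ᶜ
    · simp only [hh, indicator_of_mem hξ]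
      have h1 := bracket_pos ξ
      have h2 := one_add_sq_le_bracket ξ
      have h3 : (0 : ℝ) < 1 + ‖ξ‖ ^ 2 := by positivity
      have hNb : N ^ 2 ≤ bracket ξ := by
        obtain ⟨i, hi⟩ : ∃ i, N < |ξ i| := by
          by_contra! hc; exact hξ hc
        refine le_trans ?_ h2
        have h4 : N ^ 2 ≤ |ξ i| ^ 2 := pow_le_pow_left₀ hN0.le hi.le 2
        rw [sq_abs] at h4
        rw [norm_sq_plane]
        fin_cases i <;> simp at h4 <;> nlinarith [sq_nonneg (ξ 0), sq_nonneg (ξ 1)]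
      have e1 : amp o ξ ^ 2 / bracket ξ ^ 3 ≤ bracket ξ ^ (-2 : ℝ) := by
        rw [Real.rpow_neg h1.le, show (2 : ℝ) = ((2 : ℕ) : ℝ) by norm_num, Real.rpow_natCast,
          div_le_iff₀ (by positivity), inv_mul_eq_div, le_div_iff₀ (by positivity)]
        calc _ ≤ bracket ξ * bracket ξ ^ 2 := by
              gcongr
              exact amp_sq_le_bracket o ξ
          _ = bracket ξ ^ 3 := by ring
      -- split off just enough decay for the rate `t^{-31/30}`; the rest is still integrable
      have e2 : bracket ξ ^ (-2 : ℝ) = bracket ξ ^ (-(31 / 36) : ℝ) * bracket ξ ^ (-(41 / 36) : ℝ) := by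
        rw [← Real.rpow_add h1]; norm_num
      have e3 : bracket ξ ^ (-(31 / 36) : ℝ) ≤ (t ^ (-(31 / 60) : ℝ)) ^ 2 := by
        refine (Real.rpow_le_rpow_of_nonpos (by positivity) hNb (by norm_num)).trans_eq ?_
        rw [hN, ← Real.rpow_natCast, ← Real.rpow_natCast, ← Real.rpow_mul ht0.le,
          ← Real.rpow_mul ht0.le, ← Real.rpow_mul ht0.le]
        norm_num
      have e4 : bracket ξ ^ (-(41 / 36) : ℝ) ≤ (1 + ‖ξ‖ ^ 2) ^ (-(41 / 36) : ℝ) :=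
        Real.rpow_le_rpow_of_nonpos h3 h2 (by norm_num)
      rw [e2] at e1
      exact e1.trans (mul_le_mul e3 e4 (by positivity) (by positivity))
    · simp only [hh, indicator_of_notMem hξ]
      have : (0 : ℝ) ≤ (t ^ (-(31 / 60) : ℝ)) ^ 2 * (1 + ‖ξ‖ ^ 2) ^ (-(41 / 36) : ℝ) := by positivity
      simpa using this
  have hfin := hbase.trans ((lintegral_le_sobolevSq hmeas hU).trans
    (mul_le_mul' (ENNReal.rpow_le_rpow hw (by norm_num)) (ENNReal.rpow_le_rpow hUM (by norm_num))))
  rw [ENNReal.ofReal_rpow_of_nonneg (by positivity) (by norm_num),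
    ENNReal.ofReal_rpow_of_nonneg (by positivity) (by norm_num), ← ENNReal.ofReal_mul (by positivity),
    ← Real.sqrt_eq_rpow, ← Real.sqrt_eq_rpow, Real.sqrt_sq hM, Real.sqrt_mul (by positivity),
    Real.sqrt_sq (by positivity), ← ofReal_norm,
    ENNReal.ofReal_le_ofReal_iff (by positivity)] at hfin
  refine hfin.trans ?_
  rw [mul_comm (t ^ _)]
  gcongr
  linarith

theorem conj_airySymbol (t : ℝ) (ξ : Plane) :
    starRingEnd ℂ (airySymbol t ξ) = airySymbol (-t) ξ := by
  rw [airySymbol, airySymbol, ← Complex.exp_conj]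
  congr 1
  simp only [map_mul, Complex.conj_I, Complex.conj_ofReal]
  push_cast
  ring

theorem airySymbol_mul_neg (t : ℝ) (ξ : Plane) : airySymbol t ξ * airySymbol (-t) ξ = 1 := by
  rw [airySymbol, airySymbol, ← Complex.exp_add, ← Complex.exp_zero]
  congr 1
  push_cast
  ring

theorem fourier_linearEvolution (t : ℝ) (g : Lp ℂ 2 (volume : Measure Plane)) :
    (𝓕 (linearEvolution t g) : Lp ℂ 2 (volume : Measure Plane)) =ᵐ[volume]
      fun ξ => airySymbol t ξ * (𝓕 g : Lp ℂ 2 (volume : Measure Plane)) ξ := by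
  rw [linearEvolution, FourierTransform.fourier_fourierInv_eq]
  exact MemLp.coeFn_toLp _

/-- Interpolation between a supremum bound and an `L²` bound of `k` against the weight
`(1 + |y|²)⁻¹`, which just fails to be integrable on the plane. -/
theorem lintegral_sq_mul_weight_le {k : Plane → ℂ} (hk : AEStronglyMeasurable k) {B R : ℝ}
    (hB : ∀ᵐ y, ‖k y‖ ≤ B) (hR : 1 ≤ R) :
    ∫⁻ y, ‖k y‖ₑ ^ 2 * ENNReal.ofReal ((1 + ‖y‖ ^ 2)⁻¹) ≤
      ENNReal.ofReal (B ^ 2 * R ^ (1 / 120 : ℝ) * ∫ y : Plane, (1 + ‖y‖ ^ 2) ^ (-(121 / 120) : ℝ)) +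
        ENNReal.ofReal R⁻¹ * eLpNorm k 2 ^ 2 := by
  have hR0 : 0 < R := by linarith
  rw [← integral_const_mul, ofReal_integral_eq_lintegral_ofReal
      ((integrable_bracket_rpow (by norm_num)).const_mul _)
      (Eventually.of_forall fun ξ => by positivity), eLpNorm_two_sq,
      ← lintegral_const_mul'' _ (by fun_prop), ← lintegral_add_left (by fun_prop)]
  refine lintegral_mono_ae ?_
  filter_upwards [hB] with y hy
  have h3 : (0 : ℝ) < 1 + ‖y‖ ^ 2 := by positivity
  rcases le_total (1 + ‖y‖ ^ 2) R with h | h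
  · refine le_trans ?_ le_self_add
    rw [← ofReal_norm, ← ENNReal.ofReal_pow (norm_nonneg _), ← ENNReal.ofReal_mul (by positivity)]
    refine ENNReal.ofReal_le_ofReal ?_
    have e1 : (1 + ‖y‖ ^ 2)⁻¹ = (1 + ‖y‖ ^ 2) ^ (1 / 120 : ℝ) * (1 + ‖y‖ ^ 2) ^ (-(121 / 120) : ℝ) := by
      rw [← Real.rpow_add h3, ← Real.rpow_neg_one]; norm_num
    have e2 : (1 + ‖y‖ ^ 2) ^ (1 / 120 : ℝ) ≤ R ^ (1 / 120 : ℝ) :=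
      Real.rpow_le_rpow h3.le h (by norm_num)
    rw [e1, ← mul_assoc]
    gcongr
  · refine le_trans ?_ le_add_self
    rw [mul_comm]
    gcongr

theorem lintegral_weight_sq_le {f : Lp ℂ 2 (volume : Measure Plane)} {M : ℝ}
    (h0 : eLpNorm f 2 volume ≤ ENNReal.ofReal M) (hw : ∀ i, weightedNorm i f ≤ ENNReal.ofReal M) :
    ∫⁻ y : Plane, ENNReal.ofReal (1 + ‖y‖ ^ 2) * ‖f y‖ₑ ^ 2 ≤ 3 * ENNReal.ofReal M ^ 2 := by
  have hf := Lp.aestronglyMeasurable f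
  have e : ∀ y : Plane, ENNReal.ofReal (1 + ‖y‖ ^ 2) * ‖f y‖ₑ ^ 2 =
      ‖f y‖ₑ ^ 2 + ‖(y 0 : ℂ) * f y‖ₑ ^ 2 + ‖(y 1 : ℂ) * f y‖ₑ ^ 2 := by
    intro y
    simp only [enorm_mul, mul_pow, ← ofReal_norm (y _ : ℂ), Complex.norm_real, Real.norm_eq_abs]
    rw [norm_sq_plane, ENNReal.ofReal_add (by norm_num) (by positivity),
      ENNReal.ofReal_add (by positivity) (by positivity), ← ENNReal.ofReal_pow (abs_nonneg _),
      ← ENNReal.ofReal_pow (abs_nonneg _), sq_abs, sq_abs, ENNReal.ofReal_one]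
    ring
  simp only [e]
  rw [lintegral_add_left' (by fun_prop), lintegral_add_left' (by fun_prop), ← eLpNorm_two_sq,
    ← eLpNorm_two_sq, ← eLpNorm_two_sq]
  have h1 := hw 0
  have h2 := hw 1
  unfold weightedNorm at h1 h2
  calc _ ≤ ENNReal.ofReal M ^ 2 + ENNReal.ofReal M ^ 2 + ENNReal.ofReal M ^ 2 := by gcongr
    _ = _ := by ring

theorem eLpNorm_le_sobolevSq {U : Plane → ℂ} : eLpNorm U 2 volume ^ 2 ≤ sobolevSq U := by
  rw [eLpNorm_two_sq]
  refine lintegral_mono fun ξ => ?_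
  calc ‖U ξ‖ₑ ^ 2 = 1 * ‖U ξ‖ₑ ^ 2 := (one_mul _).symm
    _ ≤ _ := by
      gcongr
      rw [← ENNReal.ofReal_one]
      exact ENNReal.ofReal_le_ofReal (one_le_pow₀ (one_le_bracket ξ))

theorem eLpNorm_fourier (g : Lp ℂ 2 (volume : Measure Plane)) :
    eLpNorm (𝓕 g : Lp ℂ 2 (volume : Measure Plane)) 2 volume = eLpNorm g 2 volume := by
  have := Lp.norm_fourier_eq g
  rw [Lp.norm_def, Lp.norm_def] at this
  exact (ENNReal.toReal_eq_toReal_iff' (Lp.eLpNorm_ne_top _) (Lp.eLpNorm_ne_top _)).1 this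

theorem ENNReal_sq_le_sq {a b : ℝ≥0∞} (h : a ^ 2 ≤ b ^ 2) : a ≤ b :=
  (ENNReal.pow_le_pow_left_iff two_ne_zero).1 h

/-- Frequencies inside the square of side `t^{3/5}`: by Plancherel, the synthesis is the pairing of
the profile with the truncated kernel, whose supremum decays in time. -/
theorem exists_lowFreq_le : ∃ C : ℝ, 0 < C ∧ ∀ (o : Option (Fin 2))
    (g : Lp ℂ 2 (volume : Measure Plane)) {t M : ℝ}, 1 ≤ t → 0 ≤ M →
    sobolevSq (𝓕 g : Lp ℂ 2 (volume : Measure Plane)) ≤ ENNReal.ofReal (M ^ 2) →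
    (∀ i, weightedNorm i (linearEvolution (-t) g) ≤ ENNReal.ofReal M) →
      ∀ x, ‖∫ ξ in freqSquare (t ^ (3 / 5 : ℝ)),
        Complex.exp ((2 * Real.pi * inner ℝ ξ x : ℝ) * Complex.I) *
          ((amp o ξ : ℂ) * (𝓕 g : Lp ℂ 2 (volume : Measure Plane)) ξ)‖ ≤
          C * t ^ (-(31 / 60) : ℝ) * M := by
  set J := ∫ y : Plane, (1 + ‖y‖ ^ 2) ^ (-(121 / 120) : ℝ) with hJ
  have hJ0 : 0 ≤ J := integral_nonneg fun ξ => by positivity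
  refine ⟨Real.sqrt (600 ^ 2 * J + 4) * 2, by positivity, fun o g t M ht hM hU hw x => ?_⟩
  set N := t ^ (3 / 5 : ℝ) with hN
  have ht0 : 0 < t := by linarith
  have hN1 : 1 ≤ N := Real.one_le_rpow ht (by norm_num)
  set f := linearEvolution (-t) g with hf
  have hQ := measurableSet_freqSquare N
  have hvol : volume (freqSquare N) ≠ ⊤ := by rw [volume_freqSquare]; finiteness
  set G : Plane → ℂ := (freqSquare N).indicator fun ξ => (amp o ξ : ℂ) * airySymbol (-t) ξ *
    Complex.exp (-(2 * Real.pi * inner ℝ ξ x : ℝ) * Complex.I) with hG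
  have hcont : Continuous fun ξ : Plane => (amp o ξ : ℂ) * airySymbol (-t) ξ *
      Complex.exp (-(2 * Real.pi * inner ℝ ξ x : ℝ) * Complex.I) := by
    have := continuous_amp o
    have := continuous_airySymbol (-t)
    fun_prop
  have hbd : ∀ ξ, ‖G ξ‖ ≤ (freqSquare N).indicator (fun _ => N) ξ := fun ξ => by
    by_cases h : ξ ∈ freqSquare N
    · simp only [hG, indicator_of_mem h]
      rw [norm_mul, norm_mul, norm_airySymbol, ← Complex.ofReal_neg,
        Complex.norm_exp_ofReal_mul_I, Complex.norm_real, mul_one, mul_one]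
      exact abs_amp_le hN1 h
    · simp [hG, indicator_of_notMem h]
  have hGm : AEStronglyMeasurable G := (hcont.measurable.indicator hQ).aestronglyMeasurable
  have hG1 : Integrable G := by
    refine Integrable.mono' ((integrable_indicator_iff hQ).2 ?_) hGm (Eventually.of_forall hbd)
    exact integrableOn_const hvol
  have hG2 : MemLp G 2 volume :=
    (memLp_indicator_const 2 hQ N (Or.inr hvol)).of_le hGm
      (Eventually.of_forall fun ξ => (hbd ξ).trans (le_abs_self _))
  have hGn : eLpNorm G 2 volume ^ 2 ≤ ENNReal.ofReal (4 * N ^ 4) := by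
    calc eLpNorm G 2 volume ^ 2 ≤ eLpNorm ((freqSquare N).indicator fun _ => N) 2 volume ^ 2 := by
          gcongr
          exact eLpNorm_mono fun ξ => (hbd ξ).trans (le_abs_self _)
      _ = ∫⁻ ξ, (freqSquare N).indicator (fun _ => ENNReal.ofReal N ^ 2) ξ := by
          rw [eLpNorm_two_sq]
          refine lintegral_congr fun ξ => ?_
          by_cases h : ξ ∈ freqSquare N
          · simp only [indicator_of_mem h]
            rw [Real.enorm_eq_ofReal (by linarith)]
          · simp [indicator_of_notMem h]
      _ = ENNReal.ofReal (4 * N ^ 4) := by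
          rw [lintegral_indicator_const hQ, volume_freqSquare, ← mul_pow,
            ← ENNReal.ofReal_mul (by linarith), ← ENNReal.ofReal_pow (by positivity)]
          congr 1; ring
  -- `k` is the truncated kernel centred at `x`, up to complex conjugation and reflection
  set k : Lp ℂ 2 (volume : Measure Plane) := 𝓕⁻ hG2.toLp with hk
  have hkn : eLpNorm k 2 volume ^ 2 ≤ ENNReal.ofReal (4 * N ^ 4) := by
    have := eLpNorm_fourier k
    rw [hk, FourierTransform.fourier_fourierInv_eq] at this
    rw [hk, ← this, eLpNorm_congr_ae hG2.coeFn_toLp]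
    exact hGn
  have hkB : ∀ᵐ y, ‖k y‖ ≤ 600 * t ^ (-(8 / 15) : ℝ) := by
    filter_upwards [fourierInv_toLp_ae_eq hG1 hG2] with y hy
    rw [hk, hy, Real.fourierInv_eq']
    refine le_trans (le_of_eq ?_) (norm_truncKernel_le ht hN o (x - y))
    rw [← RCLike.norm_conj, truncKernel, ← integral_conj, ← integral_indicator hQ]
    congr 1
    refine integral_congr_ae (Eventually.of_forall fun ξ => ?_)
    by_cases h : ξ ∈ freqSquare N
    · simp only [hG, indicator_of_mem h, smul_eq_mul, map_mul, conj_airySymbol, neg_neg,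
        Complex.conj_ofReal, ← Complex.exp_conj, Complex.conj_I, inner_sub_right, map_neg]
      have e1 : ∀ a b c d : ℂ, a * (b * c * d) = b * c * (a * d) := fun a b c d => by ring
      rw [e1, ← Complex.exp_add]
      congr 2
      push_cast
      ring
    · simp [hG, indicator_of_notMem h]
  -- the synthesis is the pairing of the kernel with the profile
  have hpair : ∫ ξ in freqSquare N, Complex.exp ((2 * Real.pi * inner ℝ ξ x : ℝ) * Complex.I) *
      ((amp o ξ : ℂ) * (𝓕 g : Lp ℂ 2 (volume : Measure Plane)) ξ) = inner ℂ k f := by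
    rw [← Lp.inner_fourier_eq, hk, FourierTransform.fourier_fourierInv_eq, L2.inner_def,
      ← integral_indicator hQ]
    refine integral_congr_ae ?_
    filter_upwards [hG2.coeFn_toLp, fourier_linearEvolution (-t) g] with ξ h1 h2
    rw [hf, h1, h2]
    by_cases h : ξ ∈ freqSquare N
    · simp only [hG, indicator_of_mem h, RCLike.inner_apply, map_mul, conj_airySymbol, neg_neg,
        Complex.conj_ofReal, ← Complex.exp_conj, Complex.conj_I, map_neg]
      have := airySymbol_mul_neg t ξ
      rw [show -((2 * Real.pi * inner ℝ ξ x : ℝ) : ℂ) * -Complex.I =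
        (2 * Real.pi * inner ℝ ξ x : ℝ) * Complex.I by ring]
      linear_combination (-(Complex.exp ((2 * Real.pi * inner ℝ ξ x : ℝ) * Complex.I) *
        ((amp o ξ : ℂ) * (𝓕 g : Lp ℂ 2 (volume : Measure Plane)) ξ))) * this
    · simp [hG, indicator_of_notMem h]
  have hf0 : eLpNorm f 2 volume ≤ ENNReal.ofReal M := by
    rw [← eLpNorm_fourier, eLpNorm_congr_ae (fourier_linearEvolution (-t) g)]
    refine ENNReal_sq_le_sq ?_
    rw [← ENNReal.ofReal_pow hM]
    refine le_trans (le_of_eq ?_) (eLpNorm_le_sobolevSq.trans hU)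
    rw [eLpNorm_two_sq, eLpNorm_two_sq]
    refine lintegral_congr fun ξ => ?_
    rw [enorm_mul, ← ofReal_norm (airySymbol _ _), norm_airySymbol, ENNReal.ofReal_one, one_mul]
  have hcs : ‖inner ℂ k f‖ₑ ≤
      (∫⁻ y : Plane, ‖k y‖ₑ ^ 2 * ENNReal.ofReal ((1 + ‖y‖ ^ 2)⁻¹)) ^ (1 / 2 : ℝ) *
      (∫⁻ y : Plane, ENNReal.ofReal (1 + ‖y‖ ^ 2) * ‖f y‖ₑ ^ 2) ^ (1 / 2 : ℝ) := by
    have hkm := (Lp.aestronglyMeasurable k).enorm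
    have hfm := (Lp.aestronglyMeasurable f).enorm
    have key := lintegral_mul_le_sqrt (μ := (volume : Measure Plane))
      (f := fun y => ‖k y‖ₑ * ENNReal.ofReal (Real.sqrt (1 + ‖y‖ ^ 2))⁻¹)
      (g := fun y => ENNReal.ofReal (Real.sqrt (1 + ‖y‖ ^ 2)) * ‖f y‖ₑ)
      (hkm.mul (by fun_prop)) ((by fun_prop : Measurable _).aemeasurable.mul hfm)
    have hs : ∀ y : Plane, 0 < Real.sqrt (1 + ‖y‖ ^ 2) := fun y => Real.sqrt_pos.2 (by positivity)
    rw [L2.inner_def]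
    refine (enorm_integral_le_lintegral_enorm _).trans (le_trans (le_of_eq ?_)
      (key.trans (le_of_eq ?_)))
    · refine lintegral_congr fun y => ?_
      rw [mul_assoc, ← mul_assoc (ENNReal.ofReal _), ← ENNReal.ofReal_mul (inv_nonneg.2 (hs y).le),
        inv_mul_cancel₀ (hs y).ne', ENNReal.ofReal_one, one_mul, RCLike.inner_apply, enorm_mul,
        mul_comm, RCLike.enorm_conj]
    · congr 2
      · refine lintegral_congr fun y => ?_
        rw [mul_pow, ← ENNReal.ofReal_pow (inv_nonneg.2 (hs y).le), inv_pow,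
          Real.sq_sqrt (by positivity)]
      · refine lintegral_congr fun y => ?_
        rw [mul_pow, ← ENNReal.ofReal_pow (hs y).le, Real.sq_sqrt (by positivity)]
  -- with `R = t⁴` the loss `R^{1/120}` is `t^{1/30}`, and the `L²` contribution `N⁴ / R` is small
  have hR : 1 ≤ t ^ 4 := one_le_pow₀ ht
  have hA := lintegral_sq_mul_weight_le (Lp.aestronglyMeasurable k) hkB hR
  have hA2 : ∫⁻ y : Plane, ‖k y‖ₑ ^ 2 * ENNReal.ofReal ((1 + ‖y‖ ^ 2)⁻¹) ≤
      ENNReal.ofReal ((600 ^ 2 * J + 4) * (t ^ (-(31 / 60) : ℝ)) ^ 2) := by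
    refine (hA.trans (add_le_add_right (mul_le_mul_right hkn _) _)).trans ?_
    rw [← ENNReal.ofReal_mul (by positivity), ← ENNReal.ofReal_add (by positivity) (by positivity)]
    refine ENNReal.ofReal_le_ofReal ?_
    have p1 : (t ^ (-(8 / 15) : ℝ)) ^ 2 * (t ^ 4) ^ (1 / 120 : ℝ) = (t ^ (-(31 / 60) : ℝ)) ^ 2 := by
      simp only [← Real.rpow_natCast, ← Real.rpow_mul ht0.le, ← Real.rpow_add ht0]
      norm_num
    have p2 : (t ^ 4)⁻¹ * (4 * N ^ 4) ≤ 4 * (t ^ (-(31 / 60) : ℝ)) ^ 2 := by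
      have : (t ^ 4)⁻¹ * (4 * N ^ 4) = 4 * t ^ (-(8 / 5) : ℝ) := by
        rw [hN, ← Real.rpow_natCast t 4, ← Real.rpow_neg ht0.le, ← Real.rpow_natCast (t ^ _) 4,
          ← Real.rpow_mul ht0.le, mul_left_comm, ← Real.rpow_add ht0]
        norm_num
      rw [this, ← Real.rpow_natCast, ← Real.rpow_mul ht0.le]
      gcongr
      norm_num
    rw [mul_pow, mul_assoc (600 ^ 2 : ℝ), p1]
    linarith
  have hB2 := lintegral_weight_sq_le hf0 hw
  have hfin := hcs.trans (mul_le_mul' (ENNReal.rpow_le_rpow hA2 (by norm_num))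
    (ENNReal.rpow_le_rpow (hB2.trans (show _ ≤ ENNReal.ofReal (4 * M ^ 2) by
      rw [ENNReal.ofReal_mul (by norm_num), ENNReal.ofReal_pow hM]
      gcongr
      norm_num)) (by norm_num)))
  rw [ENNReal.ofReal_rpow_of_nonneg (by positivity) (by norm_num),
    ENNReal.ofReal_rpow_of_nonneg (by positivity) (by norm_num), ← ENNReal.ofReal_mul (by positivity),
    ← Real.sqrt_eq_rpow, ← Real.sqrt_eq_rpow, Real.sqrt_mul (by positivity),
    Real.sqrt_sq (by positivity), show 4 * M ^ 2 = (2 * M) ^ 2 by ring,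
    Real.sqrt_sq (by positivity), ← ofReal_norm,
    ENNReal.ofReal_le_ofReal_iff (by positivity)] at hfin
  rw [hpair]
  exact hfin.trans_eq (by ring)

/-- The dispersive estimate: a function in `H³` whose profile has one spatial moment decays, with
its first derivatives, like `t^{-31/60}`, which is faster than the critical rate `t^{-1/2}`. -/
theorem exists_norm_synth_le : ∃ C : ℝ, 0 < C ∧ ∀ (o : Option (Fin 2))
    (g : Lp ℂ 2 (volume : Measure Plane)) {t M : ℝ}, 1 ≤ t → 0 ≤ M →
    sobolevSq (𝓕 g : Lp ℂ 2 (volume : Measure Plane)) ≤ ENNReal.ofReal (M ^ 2) →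
    (∀ i, weightedNorm i (linearEvolution (-t) g) ≤ ENNReal.ofReal M) →
      ∀ x, ‖synth o (𝓕 g : Lp ℂ 2 (volume : Measure Plane)) x‖ ≤ C * t ^ (-(31 / 60) : ℝ) * M := by
  obtain ⟨C₁, h1, H1⟩ := exists_highFreq_le
  obtain ⟨C₂, h2, H2⟩ := exists_lowFreq_le
  refine ⟨C₁ + C₂, by positivity, fun o g t M ht hM hU hw x => ?_⟩
  have hm := Lp.aestronglyMeasurable (𝓕 g : Lp ℂ 2 (volume : Measure Plane))
  have hint := integrable_synth o hm (ne_top_of_le_ne_top ENNReal.ofReal_ne_top hU) x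
  rw [synth, ← integral_add_compl (measurableSet_freqSquare (t ^ (3 / 5 : ℝ))) hint]
  refine (norm_add_le _ _).trans ((add_le_add (H2 o g ht hM hU hw x)
    (H1 o hm ht hM hU x)).trans_eq (by ring))

/-! ### The commutator estimate -/

/-- The coordinate vector `e_j`. -/
noncomputable abbrev unitVec (j : Fin 2) : Plane := EuclideanSpace.single j 1

theorem inner_unitVec (ξ : Plane) (j : Fin 2) : inner ℝ ξ (unitVec j) = ξ j := by
  simp [unitVec, EuclideanSpace.inner_single_right]

/-- A smooth even cutoff on the plane, equal to `1` on the unit ball. -/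
noncomputable def bump : ContDiffBump (0 : Plane) := ⟨1, 2, one_pos, one_lt_two⟩

/-- The frequency cutoff at scale `1 / r`. -/
noncomputable def cut (r : ℝ) (ξ : Plane) : ℝ := bump (r • ξ)

theorem contDiff_cut (r : ℝ) : ContDiff ℝ ∞ (cut r) :=
  bump.contDiff.comp (contDiff_const_smul r)

theorem hasCompactSupport_cut {r : ℝ} (hr : 0 < r) : HasCompactSupport (cut r) :=
  bump.hasCompactSupport.comp_smul hr.ne'

theorem cut_nonneg (r : ℝ) (ξ : Plane) : 0 ≤ cut r ξ := bump.nonneg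

theorem cut_le_one (r : ℝ) (ξ : Plane) : cut r ξ ≤ 1 := bump.le_one

theorem cut_neg (r : ℝ) (ξ : Plane) : cut r (-ξ) = cut r ξ := by
  rw [cut, cut, smul_neg, bump.neg]

theorem cut_eq_one {r : ℝ} {ξ : Plane} (h : ‖r • ξ‖ ≤ 1) : cut r ξ = 1 :=
  bump.one_of_mem_closedBall (by simpa [bump] using h)

/-- The symbol `2πi ξ_j` of `∂_j`, cut off at frequency `1 / r`. -/
noncomputable def derivSymbol (j : Fin 2) (r : ℝ) (ξ : Plane) : ℂ :=
  2 * Real.pi * Complex.I * (ξ j * cut r ξ : ℝ)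

theorem contDiff_derivSymbol (j : Fin 2) (r : ℝ) : ContDiff ℝ ∞ (derivSymbol j r) := by
  have h1 : ContDiff ℝ ∞ fun ξ : Plane => ξ j := by fun_prop
  exact contDiff_const.mul (Complex.ofRealCLM.contDiff.comp (h1.mul (contDiff_cut r)))

theorem hasCompactSupport_derivSymbol (j : Fin 2) {r : ℝ} (hr : 0 < r) :
    HasCompactSupport (derivSymbol j r) := by
  refine (hasCompactSupport_cut hr).mono' fun ξ hξ => subset_tsupport _ ?_
  intro h0
  exact hξ (by simp [derivSymbol, h0])

/-- The truncated derivative symbol as a Schwartz function. -/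
noncomputable def derivSymbolS (j : Fin 2) {r : ℝ} (hr : 0 < r) : 𝓢(Plane, ℂ) :=
  (hasCompactSupport_derivSymbol j hr).toSchwartzMap (contDiff_derivSymbol j r)

theorem derivSymbolS_apply (j : Fin 2) {r : ℝ} (hr : 0 < r) (ξ : Plane) :
    derivSymbolS j hr ξ = derivSymbol j r ξ := rfl

/-- The convolution kernel of the truncated derivative. -/
noncomputable def derivKernel (j : Fin 2) {r : ℝ} (hr : 0 < r) : 𝓢(Plane, ℂ) :=
  𝓕⁻ (derivSymbolS j hr)

theorem derivKernel_apply (j : Fin 2) {r : ℝ} (hr : 0 < r) (z : Plane) : derivKernel j hr z =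
    ∫ ξ, Complex.exp ((2 * Real.pi * inner ℝ ξ z : ℝ) * Complex.I) * derivSymbol j r ξ := by
  rw [derivKernel, SchwartzMap.fourierInv_coe, Real.fourierInv_eq']
  rfl

theorem derivKernel_neg (j : Fin 2) {r : ℝ} (hr : 0 < r) (z : Plane) :
    derivKernel j hr (-z) = -derivKernel j hr z := by
  rw [derivKernel_apply, derivKernel_apply, ← integral_neg, ← integral_neg_eq_self]
  refine integral_congr_ae (Eventually.of_forall fun ξ => ?_)
  simp [derivSymbol, cut_neg]

theorem derivKernel_scale (j : Fin 2) {r : ℝ} (hr : 0 < r) (z : Plane) :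
    derivKernel j hr z = ((r ^ 3)⁻¹ : ℝ) * derivKernel j one_pos (r⁻¹ • z) := by
  rw [derivKernel_apply, derivKernel_apply]
  have h := Measure.integral_comp_smul (volume : Measure Plane) (fun ξ : Plane =>
    Complex.exp ((2 * Real.pi * inner ℝ ξ (r⁻¹ • z) : ℝ) * Complex.I) * derivSymbol j 1 ξ) r
  have h2 : (∫ ξ : Plane, Complex.exp ((2 * Real.pi * inner ℝ ξ (r⁻¹ • z) : ℝ) * Complex.I) *
      derivSymbol j 1 ξ) = ((r ^ 2 : ℝ) : ℂ) * ∫ ξ : Plane, Complex.exp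
        ((2 * Real.pi * inner ℝ (r • ξ) (r⁻¹ • z) : ℝ) * Complex.I) * derivSymbol j 1 (r • ξ) := by
    rw [h]
    simp only [finrank_euclideanSpace, Fintype.card_fin, abs_inv, Complex.real_smul]
    rw [abs_of_pos (by positivity), ← mul_assoc, ← Complex.ofReal_mul,
      mul_inv_cancel₀ (by positivity), Complex.ofReal_one, one_mul]
  rw [h2, ← mul_assoc, ← Complex.ofReal_mul, ← integral_const_mul]
  refine integral_congr_ae (Eventually.of_forall fun ξ => ?_)
  simp only [inner_smul_left, inner_smul_right, conj_trivial]
  rw [inv_mul_cancel_left₀ hr.ne']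
  simp only [derivSymbol, cut, one_smul, PiLp.smul_apply, smul_eq_mul]
  push_cast
  have : (r : ℂ) ≠ 0 := by exact_mod_cast hr.ne'
  field_simp

/-- The first moment of the kernel of the truncated derivative does not depend on the cutoff. -/
theorem integral_norm_mul_derivKernel (j : Fin 2) {r : ℝ} (hr : 0 < r) :
    ∫ z, ‖z‖ * ‖derivKernel j hr z‖ = ∫ z, ‖z‖ * ‖derivKernel j one_pos z‖ := by
  have h := Measure.integral_comp_smul (volume : Measure Plane)
    (fun z : Plane => ‖z‖ * ‖derivKernel j one_pos z‖) r⁻¹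
  have h2 : ∀ z, ‖z‖ * ‖derivKernel j hr z‖ =
      (r ^ 2)⁻¹ * (‖r⁻¹ • z‖ * ‖derivKernel j one_pos (r⁻¹ • z)‖) := fun z => by
    rw [derivKernel_scale j hr z, norm_mul, Complex.norm_real, norm_smul,
      Real.norm_of_nonneg (by positivity), Real.norm_of_nonneg (by positivity)]
    field_simp
  simp only [h2]
  rw [integral_const_mul, h]
  simp only [finrank_euclideanSpace, Fintype.card_fin, abs_inv, smul_eq_mul]
  rw [abs_of_pos (by positivity), ← mul_assoc]
  have : (r ^ 2)⁻¹ * (r⁻¹ ^ 2)⁻¹ = 1 := by field_simp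
  rw [this, one_mul]

/-- A real Schwartz function regarded as complex valued. -/
noncomputable def cx (f : 𝓢(Plane, ℝ)) : 𝓢(Plane, ℂ) :=
  SchwartzMap.postcompCLM (𝕜 := ℝ) Complex.ofRealCLM f

@[simp] theorem cx_apply (f : 𝓢(Plane, ℝ)) (x : Plane) : cx f x = (f x : ℂ) := rfl

/-- The truncated `L²` pairing `∫ χ(rξ) conj (f̂ ξ) (ĝ ξ) dξ`. -/
noncomputable def cutForm (r : ℝ) (f g : 𝓢(Plane, ℂ)) : ℂ :=
  ∫ ξ, (cut r ξ : ℂ) * (starRingEnd ℂ (𝓕 f ξ) * 𝓕 g ξ)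

theorem fourier_deriv_apply (j : Fin 2) (f : 𝓢(Plane, ℂ)) (ξ : Plane) :
    𝓕 (∂_{unitVec j} f) ξ = 2 * Real.pi * Complex.I * ξ j * 𝓕 f ξ := by
  rw [SchwartzMap.fourier_lineDerivOp_eq, smul_apply,
    SchwartzMap.smulLeftCLM_apply_apply (by fun_prop), inner_unitVec, smul_eq_mul,
    Complex.real_smul]
  ring

theorem cutForm_deriv_eq (j : Fin 2) {r : ℝ} (hr : 0 < r) (v w : 𝓢(Plane, ℝ)) :
    cutForm r (cx v) (∂_{unitVec j} (cx w)) =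
      ∫ x, (v x : ℂ) * ∫ t, derivKernel j hr t * (w (x - t) : ℂ) := by
  set B := ContinuousLinearMap.mul ℂ ℂ
  have h := SchwartzMap.integral_inner_fourier_fourier (cx v)
    (SchwartzMap.convolution B (derivKernel j hr) (cx w))
  simp only [SchwartzMap.convolution_apply, SchwartzMap.fourier_convolution,
    SchwartzMap.pairing_apply_apply, derivKernel, FourierTransform.fourier_fourierInv_eq] at h
  rw [cutForm]
  convert h using 1
  · refine integral_congr_ae (Eventually.of_forall fun ξ => ?_)
    simp only [fourier_deriv_apply, RCLike.inner_apply, derivSymbolS_apply, derivSymbol, B,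
      ContinuousLinearMap.mul_apply']
    push_cast
    ring
  · refine integral_congr_ae (Eventually.of_forall fun x => ?_)
    simp only [RCLike.inner_apply, cx_apply, Complex.conj_ofReal, convolution, B,
      ContinuousLinearMap.mul_apply', derivKernel]
    ring

/-- Since the kernel of `∂_j χ(rD)` is odd, only differences of the coefficient `b` enter
`⟨v, ∂_j χ(rD) (b v)⟩`: no derivative falls on `v`. -/
theorem exists_norm_cutForm_deriv_mul_le : ∃ C : ℝ, 0 < C ∧ ∀ (j : Fin 2) {r : ℝ}, 0 < r →
    ∀ (v b w : 𝓢(Plane, ℝ)) (L : ℝ), 0 ≤ L → (∀ x y, |b x - b y| ≤ L * ‖x - y‖) →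
      (∀ x, w x = b x * v x) →
      ‖cutForm r (cx v) (∂_{unitVec j} (cx w))‖ ≤ C * L * ∫ x, v x ^ 2 := by
  set C₀ : Fin 2 → ℝ := fun j => ∫ z, ‖z‖ * ‖derivKernel j one_pos z‖ with hC₀
  have hC₀0 : ∀ j, 0 ≤ C₀ j := fun j => integral_nonneg fun z => by positivity
  refine ⟨C₀ 0 + C₀ 1 + 1, by have := hC₀0 0; have := hC₀0 1; positivity,
    fun j r hr v b w L hL hb hw => ?_⟩
  set κ := derivKernel j hr with hκ
  have hv2 : Integrable fun x => v x ^ 2 := by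
    have := (v.memLp 2).integrable_sq
    simpa using this
  have hV0 : 0 ≤ ∫ x, v x ^ 2 := integral_nonneg fun x => sq_nonneg _
  obtain ⟨A, hA⟩ : ∃ A, ∀ x, ‖w x‖ ≤ A :=
    ⟨_, fun x => SchwartzMap.norm_le_seminorm ℝ w x⟩
  have hvw : ∀ t, Integrable fun x => v x * w (x - t) := fun t =>
    v.integrable.mul_bdd (c := A) (by
      have := w.continuous; fun_prop) (Eventually.of_forall fun x => hA _)
  have hvw' : ∀ t, Integrable fun x => v (x - t) * w x := fun t =>
    (v.integrable.comp_sub_right t).mul_bdd (c := A) w.continuous.aestronglyMeasurable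
      (Eventually.of_forall fun x => hA _)
  -- the form is the integral of the odd kernel against the correlation `G` of `v` and `w`, so only
  -- the odd part of `G` contributes
  set G : Plane → ℝ := fun t => ∫ x, v x * w (x - t) with hG
  have hswap : cutForm r (cx v) (∂_{unitVec j} (cx w)) = ∫ t, κ t * (G t : ℂ) := by
    rw [cutForm_deriv_eq j hr]
    have hint : Integrable (fun p : Plane × Plane => (v p.1 : ℂ) * (κ p.2 * (w (p.1 - p.2) : ℂ)))
        (volume.prod volume) := by
      have h1 := ((v.integrable (μ := volume)).ofReal (𝕜 := ℂ)).mul_prod (κ.integrable (μ := volume))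
      have h2 := h1.mul_bdd (c := A) (g := fun p : Plane × Plane => (w (p.1 - p.2) : ℂ))
        (by have := w.continuous; fun_prop)
        (Eventually.of_forall fun p => by rw [Complex.norm_real]; exact hA _)
      refine h2.congr (Eventually.of_forall fun p => ?_)
      exact mul_assoc _ _ _
    simp_rw [← integral_const_mul]
    rw [integral_integral_swap hint]
    refine integral_congr_ae (Eventually.of_forall fun t => ?_)
    simp only [hG]
    rw [← integral_complex_ofReal, ← integral_const_mul]
    refine integral_congr_ae (Eventually.of_forall fun x => ?_)
    push_cast
    ring
  have hGneg : ∀ t, |G t - G (-t)| ≤ L * ‖t‖ * ∫ x, v x ^ 2 := by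
    intro t
    have h1 : G (-t) = ∫ x, v (x - t) * w x := by
      refine (integral_sub_right_eq_self (fun x => v x * w (x - -t)) t).symm.trans
        (integral_congr_ae (Eventually.of_forall fun x => ?_))
      simp
    have hv2' : Integrable fun x => v (x - t) ^ 2 := hv2.comp_sub_right t
    have h2 : ∫ x, v (x - t) ^ 2 = ∫ x, v x ^ 2 :=
      integral_sub_right_eq_self (fun x => v x ^ 2) t
    rw [h1, hG, ← integral_sub (hvw t) (hvw' t)]
    calc ‖∫ x, (v x * w (x - t) - v (x - t) * w x)‖
        ≤ ∫ x, L * ‖t‖ * ((v x ^ 2 + v (x - t) ^ 2) / 2) := by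
          refine norm_integral_le_of_norm_le (g := fun x => L * ‖t‖ * ((v x ^ 2 + v (x - t) ^ 2) / 2))
            (((hv2.add hv2').div_const 2).const_mul _)
            (Eventually.of_forall fun x => ?_)
          rw [hw, hw, Real.norm_eq_abs, show v x * (b (x - t) * v (x - t)) - v (x - t) * (b x * v x)
            = (b (x - t) - b x) * (v x * v (x - t)) by ring, abs_mul]
          have h3 := hb (x - t) x
          rw [show x - t - x = -t by abel, norm_neg] at h3
          refine mul_le_mul h3 ?_ (abs_nonneg _) (by positivity)
          rw [abs_le]
          constructor <;> nlinarith [sq_nonneg (v x - v (x - t)), sq_nonneg (v x + v (x - t))]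
      _ = L * ‖t‖ * ∫ x, v x ^ 2 := by
          rw [integral_const_mul, integral_div, integral_add hv2 hv2', h2]
          ring
  have hGb : ∀ t, |G t| ≤ A * ∫ x, |v x| := fun t => by
    rw [← integral_const_mul, ← Real.norm_eq_abs]
    refine norm_integral_le_of_norm_le (v.integrable.abs.const_mul A)
      (Eventually.of_forall fun x => ?_)
    rw [norm_mul, mul_comm, Real.norm_eq_abs (v x)]
    exact mul_le_mul_of_nonneg_right (hA _) (abs_nonneg _)
  have hGm : Continuous G := by
    refine continuous_of_dominated (bound := fun x => A * |v x|)
      (fun t => (hvw t).aestronglyMeasurable) (fun t => Eventually.of_forall fun x => ?_)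
      (v.integrable.abs.const_mul A) (Eventually.of_forall fun x => ?_)
    · rw [norm_mul, mul_comm, Real.norm_eq_abs (v x)]
      exact mul_le_mul_of_nonneg_right (hA _) (abs_nonneg _)
    · have := w.continuous; fun_prop
  have hκG : Integrable fun t => κ t * (G t : ℂ) :=
    κ.integrable.mul_bdd (c := A * ∫ x, |v x|) (by fun_prop)
      (Eventually.of_forall fun t => by rw [Complex.norm_real]; exact hGb t)
  have hanti : (2 : ℂ) * ∫ t, κ t * (G t : ℂ) = ∫ t, κ t * ((G t - G (-t) : ℝ) : ℂ) := by
    have h1 : ∫ t, κ t * (G (-t) : ℂ) = -∫ t, κ t * (G t : ℂ) := by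
      rw [← integral_neg_eq_self, ← integral_neg]
      refine integral_congr_ae (Eventually.of_forall fun t => ?_)
      simp only [neg_neg, hκ, derivKernel_neg]
      ring
    have h2 : Integrable fun t => κ t * (G (-t) : ℂ) := by
      have := hκG.comp_neg.neg
      refine this.congr (Eventually.of_forall fun t => ?_)
      simp [hκ, derivKernel_neg]
    have h3 := integral_sub hκG h2
    rw [h1] at h3
    simp only [Complex.ofReal_sub, mul_sub]
    rw [h3]; ring
  have hmom : ∫ z, ‖z‖ * ‖κ z‖ = C₀ j := integral_norm_mul_derivKernel j hr
  have hmint : Integrable fun z => ‖z‖ * ‖κ z‖ := by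
    simpa using κ.integrable_pow_mul volume 1
  have hbound : ‖∫ t, κ t * ((G t - G (-t) : ℝ) : ℂ)‖ ≤ C₀ j * L * ∫ x, v x ^ 2 := by
    rw [← hmom, mul_assoc, mul_comm, ← integral_const_mul]
    refine norm_integral_le_of_norm_le (hmint.const_mul _) (Eventually.of_forall fun t => ?_)
    rw [norm_mul, Complex.norm_real, Real.norm_eq_abs]
    refine (mul_le_mul_of_nonneg_left (hGneg t) (norm_nonneg _)).trans_eq (by ring)
  rw [hswap]
  rw [← hanti, norm_mul, Complex.norm_ofNat] at hbound
  have hj : C₀ j ≤ C₀ 0 + C₀ 1 + 1 := by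
    have := hC₀0 0; have := hC₀0 1
    fin_cases j <;> simp <;> linarith
  have hLV : 0 ≤ L * ∫ x, v x ^ 2 := by positivity
  have := mul_le_mul_of_nonneg_right hj hLV
  nlinarith [norm_nonneg (∫ t, κ t * (G t : ℂ))]

/-! ### The energy estimate for real Schwartz functions -/

/-- The pointwise product of real Schwartz functions. -/
noncomputable instance : Mul 𝓢(Plane, ℝ) :=
  ⟨fun f g => SchwartzMap.pairing (ContinuousLinearMap.mul ℝ ℝ) f g⟩

@[simp] theorem schwartz_mul_apply (f g : 𝓢(Plane, ℝ)) (x : Plane) : (f * g) x = f x * g x := rfl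

/-- The partial derivative of a real Schwartz function. -/
noncomputable def D (j : Fin 2) (f : 𝓢(Plane, ℝ)) : 𝓢(Plane, ℝ) := ∂_{unitVec j} f

theorem D_apply (j : Fin 2) (f : 𝓢(Plane, ℝ)) (x : Plane) : D j f x = fderiv ℝ f x (unitVec j) := by
  rw [D, SchwartzMap.lineDerivOp_apply_eq_fderiv]

theorem D_add (j : Fin 2) (f g : 𝓢(Plane, ℝ)) : D j (f + g) = D j f + D j g :=
  LineDeriv.lineDerivOp_add _ _ _

theorem D_smul (j : Fin 2) (c : ℝ) (f : 𝓢(Plane, ℝ)) : D j (c • f) = c • D j f :=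
  LineDeriv.lineDerivOp_smul _ _ _

theorem D_mul (j : Fin 2) (f g : 𝓢(Plane, ℝ)) : D j (f * g) = D j f * g + f * D j g := by
  ext x
  have h : (⇑(f * g) : Plane → ℝ) = fun x => f x * g x := rfl
  rw [D_apply, h, fderiv_fun_mul f.differentiableAt g.differentiableAt]
  simp [D_apply]
  ring

theorem cx_D (j : Fin 2) (f : 𝓢(Plane, ℝ)) : cx (D j f) = ∂_{unitVec j} (cx f) := by
  ext x
  rw [SchwartzMap.lineDerivOp_apply_eq_fderiv, cx_apply, D_apply]
  have h : (⇑(cx f) : Plane → ℂ) = Complex.ofRealCLM ∘ f := rfl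
  rw [h, fderiv_comp x Complex.ofRealCLM.differentiableAt f.differentiableAt]
  simp

theorem cx_add (f g : 𝓢(Plane, ℝ)) : cx (f + g) = cx f + cx g := map_add _ _ _

theorem fourier_cx_D (j : Fin 2) (f : 𝓢(Plane, ℝ)) (ξ : Plane) :
    𝓕 (cx (D j f)) ξ = 2 * Real.pi * Complex.I * ξ j * 𝓕 (cx f) ξ := by
  rw [cx_D, fourier_deriv_apply]

/-- The `L²` norm of a Schwartz function. -/
noncomputable def nrm {F : Type*} [NormedAddCommGroup F] [NormedSpace ℝ F] (f : 𝓢(Plane, F)) : ℝ :=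
  ‖f.toLp 2 volume‖

section nrm

variable {F : Type*} [NormedAddCommGroup F] [NormedSpace ℝ F]

theorem nrm_nonneg (f : 𝓢(Plane, F)) : 0 ≤ nrm f := norm_nonneg _

theorem nrm_add_le (f g : 𝓢(Plane, F)) : nrm (f + g) ≤ nrm f + nrm g := by
  have : (f + g).toLp 2 (volume : Measure Plane) = f.toLp 2 volume + g.toLp 2 volume :=
    map_add (SchwartzMap.toLpCLM ℝ F 2 volume) f g
  rw [nrm, this]
  exact norm_add_le _ _

theorem nrm_smul (c : ℝ) (f : 𝓢(Plane, F)) : nrm (c • f) = |c| * nrm f := by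
  have : (c • f).toLp 2 (volume : Measure Plane) = c • f.toLp 2 volume :=
    map_smul (SchwartzMap.toLpCLM ℝ F 2 volume) c f
  rw [nrm, this, norm_smul, nrm, Real.norm_eq_abs]

theorem nrm_le {G : Type*} [NormedAddCommGroup G] [NormedSpace ℝ G] {f : 𝓢(Plane, F)}
    {g : 𝓢(Plane, G)} {c : ℝ} (h : ∀ x, ‖f x‖ ≤ c * ‖g x‖) : nrm f ≤ c * nrm g := by
  refine Lp.norm_le_mul_norm_of_ae_le_mul ?_
  filter_upwards [f.coeFn_toLp 2 volume, g.coeFn_toLp 2 volume] with x h1 h2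
  rw [h1, h2]
  exact h x

theorem nrm_sq (f : 𝓢(Plane, F)) : nrm f ^ 2 = ∫ x, ‖f x‖ ^ 2 := by
  have h := SchwartzMap.norm_toLp' (μ := (volume : Measure Plane)) (f := f) (p := 2)
    (by norm_num) (by norm_num)
  rw [nrm]
  simp only [ENNReal.toReal_ofNat, Real.rpow_ofNat] at h
  rw [h, ← one_div, ← Real.sqrt_eq_rpow, Real.sq_sqrt (integral_nonneg fun x => by positivity)]

end nrm

theorem integral_norm_mul_le {F G : Type*} [NormedAddCommGroup F] [NormedSpace ℝ F]
    [NormedAddCommGroup G] [NormedSpace ℝ G] (f : 𝓢(Plane, F)) (g : 𝓢(Plane, G)) :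
    ∫ x, ‖f x‖ * ‖g x‖ ≤ nrm f * nrm g := by
  have h := integral_mul_norm_le_Lp_mul_Lq (μ := (volume : Measure Plane))
    (f := fun x => ‖f x‖) (g := fun x => ‖g x‖) Real.HolderConjugate.two_two
    (by simpa using (f.memLp 2).norm) (by simpa using (g.memLp 2).norm)
  simp only [norm_norm, Real.rpow_ofNat, ← nrm_sq, ← Real.sqrt_eq_rpow,
    Real.sqrt_sq (nrm_nonneg _)] at h
  exact h

theorem norm_cutForm_integrand_le (r : ℝ) (f g : 𝓢(Plane, ℂ)) (ξ : Plane) :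
    ‖(cut r ξ : ℂ) * (starRingEnd ℂ (𝓕 f ξ) * 𝓕 g ξ)‖ ≤ ‖𝓕 f ξ‖ * ‖𝓕 g ξ‖ := by
  rw [norm_mul, norm_mul, RCLike.norm_conj, Complex.norm_real,
    Real.norm_of_nonneg (cut_nonneg r ξ)]
  exact mul_le_of_le_one_left (by positivity) (cut_le_one r ξ)

theorem integrable_norm_mul {F G : Type*} [NormedAddCommGroup F] [NormedSpace ℝ F]
    [NormedAddCommGroup G] [NormedSpace ℝ G] (f : 𝓢(Plane, F)) (g : 𝓢(Plane, G)) :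
    Integrable fun x => ‖f x‖ * ‖g x‖ :=
  (f.memLp 2 volume).norm.integrable_mul (g.memLp 2 volume).norm

theorem integrable_cutForm (r : ℝ) (f g : 𝓢(Plane, ℂ)) :
    Integrable fun ξ => (cut r ξ : ℂ) * (starRingEnd ℂ (𝓕 f ξ) * 𝓕 g ξ) := by
  refine (integrable_norm_mul (𝓕 f) (𝓕 g)).mono' ?_
    (Eventually.of_forall (norm_cutForm_integrand_le r f g))
  have h1 := (contDiff_cut r).continuous
  have h2 := (𝓕 f).continuous
  have h3 := (𝓕 g).continuous
  exact (by fun_prop : Continuous _).aestronglyMeasurable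

theorem norm_cutForm_le (r : ℝ) (f g : 𝓢(Plane, ℂ)) : ‖cutForm r f g‖ ≤ nrm f * nrm g := by
  have h := integral_norm_mul_le (𝓕 f) (𝓕 g)
  rw [nrm, nrm, SchwartzMap.norm_fourier_toL2_eq, SchwartzMap.norm_fourier_toL2_eq] at h
  exact (norm_integral_le_of_norm_le (integrable_norm_mul (𝓕 f) (𝓕 g))
    (Eventually.of_forall (norm_cutForm_integrand_le r f g))).trans h

theorem cutForm_add_right (r : ℝ) (f g h : 𝓢(Plane, ℂ)) :
    cutForm r f (g + h) = cutForm r f g + cutForm r f h := by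
  rw [cutForm, cutForm, cutForm, ← integral_add (integrable_cutForm r f g)
    (integrable_cutForm r f h)]
  refine integral_congr_ae (Eventually.of_forall fun ξ => ?_)
  simp only [FourierTransform.fourier_add, add_apply]
  ring

theorem nrm_cx (f : 𝓢(Plane, ℝ)) : nrm (cx f) = nrm f := by
  rw [← Real.sqrt_sq (nrm_nonneg (cx f)), nrm_sq, ← Real.sqrt_sq (nrm_nonneg f), nrm_sq]
  simp [Complex.norm_real]

theorem norm_sub_le_of_D_le {p : 𝓢(Plane, ℝ)} {K : ℝ} (h : ∀ j x, |D j p x| ≤ K) (x y : Plane) :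
    |p x - p y| ≤ 2 * K * ‖x - y‖ := by
  have hK : 0 ≤ K := (abs_nonneg _).trans (h 0 0)
  refine Convex.norm_image_sub_le_of_norm_fderiv_le (𝕜 := ℝ) (f := p) (s := univ) (C := 2 * K)
    (fun z _ => p.differentiableAt) (fun z _ => ?_) convex_univ (mem_univ y) (mem_univ x)
  refine ContinuousLinearMap.opNorm_le_bound _ (by positivity) fun v => ?_
  have hv : v = v 0 • unitVec 0 + v 1 • unitVec 1 := by
    ext i; fin_cases i <;> simp [unitVec]
  have h1 : fderiv ℝ p z v = v 0 * D 0 p z + v 1 * D 1 p z := by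
    conv_lhs => rw [hv]
    simp [D_apply]
  have hc : ∀ i, |v i| ≤ ‖v‖ := fun i => by simpa using PiLp.norm_apply_le v i
  rw [h1, Real.norm_eq_abs]
  refine (abs_add_le _ _).trans ?_
  rw [abs_mul, abs_mul]
  have h2 := mul_le_mul (hc 0) (h 0 z) (abs_nonneg _) (norm_nonneg v)
  have h3 := mul_le_mul (hc 1) (h 1 z) (abs_nonneg _) (norm_nonneg v)
  linarith

/-- Gagliardo–Nirenberg: `‖∂_m h‖_{L⁴}² ≤ 3 ‖h‖_∞ ‖∂_m² h‖_{L²}`. -/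
theorem nrm_D_sq_le (m : Fin 2) {h : 𝓢(Plane, ℝ)} {K : ℝ} (hK : ∀ x, |h x| ≤ K) :
    nrm (D m h * D m h) ≤ 3 * K * nrm (D m (D m h)) := by
  have hK0 : 0 ≤ K := (abs_nonneg _).trans (hK 0)
  set a := D m h with ha
  set b := D m a with hb
  have hparts : ∫ x, (a * a * a) x * a x = -∫ x, D m (a * a * a) x * h x :=
    SchwartzMap.integral_mul_lineDerivOp_right_eq_neg_left (a * a * a) h (unitVec m)
  have h4 : nrm (a * a) ^ 2 = ∫ x, (a * a * a) x * a x := by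
    rw [nrm_sq]
    refine integral_congr_ae (Eventually.of_forall fun x => ?_)
    simp only [schwartz_mul_apply, Real.norm_eq_abs, sq_abs]
    ring
  have h5 : nrm (a * a) ^ 2 ≤ 3 * K * (nrm (a * a) * nrm b) := by
    rw [h4, hparts]
    refine (le_abs_self _).trans ?_
    rw [abs_neg]
    refine le_trans ?_ (mul_le_mul_of_nonneg_left (integral_norm_mul_le (a * a) b)
      (by positivity : (0 : ℝ) ≤ 3 * K))
    rw [← integral_const_mul, ← Real.norm_eq_abs]
    refine norm_integral_le_of_norm_le ((integrable_norm_mul (F := ℝ) (G := ℝ) (a * a) b).const_mul (3 * K))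
      (Eventually.of_forall fun x => ?_)
    simp only [D_mul, add_apply, schwartz_mul_apply, ← hb, Real.norm_eq_abs]
    rw [show ((b x * a x + a x * b x) * a x + a x * a x * b x) * h x =
      3 * h x * ((a x * a x) * b x) by ring, abs_mul, abs_mul (a x * a x), abs_mul 3,
      abs_of_pos (by norm_num : (0 : ℝ) < 3)]
    gcongr
    exact hK x
  rcases (nrm_nonneg (a * a)).eq_or_lt with h0 | h0
  · rw [← h0]
    exact mul_nonneg (by positivity) (nrm_nonneg _)
  · refine le_of_mul_le_mul_left ?_ h0
    calc nrm (a * a) * nrm (a * a) = nrm (a * a) ^ 2 := (sq _).symm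
      _ ≤ _ := h5
      _ = _ := by ring

/-- A product of three factors, two of them bounded. -/
theorem nrm_mul_mul_le {a b c : 𝓢(Plane, ℝ)} {K : ℝ} (ha : ∀ x, |a x| ≤ K) (hb : ∀ x, |b x| ≤ K) :
    nrm (a * b * c) ≤ K ^ 2 * nrm c := by
  have hK0 : 0 ≤ K := (abs_nonneg _).trans (ha 0)
  refine nrm_le fun x => ?_
  simp only [schwartz_mul_apply, norm_mul, Real.norm_eq_abs]
  rw [sq]
  gcongr
  · exact ha x
  · exact hb x

/-- A product of three factors, one of them bounded and two in `L⁴`. -/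
theorem nrm_mul_mul_le_of_sq {a b c : 𝓢(Plane, ℝ)} {K A : ℝ} (ha : ∀ x, |a x| ≤ K)
    (hb : nrm (b * b) ≤ A) (hc : nrm (c * c) ≤ A) : nrm (a * b * c) ≤ K * A := by
  have hK0 : 0 ≤ K := (abs_nonneg _).trans (ha 0)
  have h1 : nrm (a * b * c) ≤ K * nrm ((1 / 2 : ℝ) • (b * b + c * c)) := by
    refine nrm_le fun x => ?_
    simp only [schwartz_mul_apply, smul_apply, add_apply, smul_eq_mul, norm_mul, Real.norm_eq_abs]
    rw [mul_assoc]
    refine mul_le_mul (ha x) ?_ (by positivity) hK0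
    rw [abs_of_pos (by norm_num : (0 : ℝ) < 1 / 2), abs_of_nonneg
      (add_nonneg (mul_self_nonneg (b x)) (mul_self_nonneg (c x)))]
    nlinarith [sq_nonneg (|b x| - |c x|), sq_abs (b x), sq_abs (c x)]
  refine h1.trans (mul_le_mul_of_nonneg_left ?_ hK0)
  rw [nrm_smul, abs_of_pos (by norm_num : (0 : ℝ) < 1 / 2)]
  have := nrm_add_le (b * b) (c * c)
  linarith

/-- The bounds on a real Schwartz function that enter the energy estimate: `K` bounds `p` and its
first derivatives uniformly, and `H` bounds its derivatives up to order three in `L²`. -/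
structure EnergyBound (p : 𝓢(Plane, ℝ)) (K H : ℝ) : Prop where
  sup0 : ∀ x, |p x| ≤ K
  sup1 : ∀ j x, |D j p x| ≤ K
  l2_0 : nrm p ≤ H
  l2_1 : ∀ k, nrm (D k p) ≤ H
  l2_2 : ∀ k l, nrm (D l (D k p)) ≤ H
  l2_3 : ∀ k l m, nrm (D m (D l (D k p))) ≤ H

section energy

variable {p : 𝓢(Plane, ℝ)} {K H : ℝ}

theorem EnergyBound.K_nonneg (h : EnergyBound p K H) : 0 ≤ K := (abs_nonneg _).trans (h.sup0 0)

theorem EnergyBound.H_nonneg (h : EnergyBound p K H) : 0 ≤ H := (nrm_nonneg _).trans h.l2_0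

theorem EnergyBound.lip (h : EnergyBound p K H) (x y : Plane) :
    |(p * p) x - (p * p) y| ≤ 4 * K ^ 2 * ‖x - y‖ := by
  have h1 := norm_sub_le_of_D_le h.sup1 x y
  have h2 : |p x + p y| ≤ 2 * K :=
    (abs_add_le _ _).trans (by linarith [h.sup0 x, h.sup0 y])
  rw [schwartz_mul_apply, schwartz_mul_apply,
    show p x * p x - p y * p y = (p x + p y) * (p x - p y) by ring, abs_mul]
  calc _ ≤ 2 * K * (2 * K * ‖x - y‖) :=
        mul_le_mul h2 h1 (abs_nonneg _) (by linarith [h.K_nonneg])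
    _ = _ := by ring

theorem D_D_cube (k l : Fin 2) (p : 𝓢(Plane, ℝ)) :
    D l (D k (p * p * p)) = (3 : ℝ) • (p * p) * D l (D k p) + (6 : ℝ) • (p * D l p * D k p) := by
  ext x
  simp only [D_mul, D_add, add_apply, schwartz_mul_apply, smul_apply, smul_eq_mul]
  ring

theorem D_D_D_cube (k l m : Fin 2) (p : 𝓢(Plane, ℝ)) :
    D m (D l (D k (p * p * p))) = (3 : ℝ) • (p * p) * D m (D l (D k p)) +
      (6 : ℝ) • (D m p * D l p * D k p + p * D k p * D m (D l p) + p * D l p * D m (D k p) +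
        p * D m p * D l (D k p)) := by
  ext x
  simp only [D_mul, D_add, add_apply, schwartz_mul_apply, smul_apply, smul_eq_mul]
  ring

theorem nrm_D_mul_mul_D_le (hp : EnergyBound p K H) (j k l : Fin 2) :
    nrm (D j (p * D l p * D k p)) ≤ 3 * (K ^ 2 * H) := by
  have e : D j (p * D l p * D k p) = D j p * D l p * D k p + p * D k p * D j (D l p) +
      p * D l p * D j (D k p) := by
    ext x
    simp only [D_mul, add_apply, schwartz_mul_apply]
    ring
  have hH : ∀ {a b c : 𝓢(Plane, ℝ)}, (∀ x, |a x| ≤ K) → (∀ x, |b x| ≤ K) → nrm c ≤ H →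
      nrm (a * b * c) ≤ K ^ 2 * H := fun ha hb hc =>
    (nrm_mul_mul_le ha hb).trans (mul_le_mul_of_nonneg_left hc (sq_nonneg K))
  rw [e]
  refine (nrm_add_le _ _).trans ((add_le_add (nrm_add_le _ _) le_rfl).trans ?_)
  have h1 := hH (hp.sup1 j) (hp.sup1 l) (hp.l2_1 k)
  have h2 := hH hp.sup0 (hp.sup1 k) (hp.l2_2 l j)
  have h3 := hH hp.sup0 (hp.sup1 l) (hp.l2_2 k j)
  linarith

/-- The remainder in the third derivatives of `p³`, differentiated once more. The terms
`p ∂²p ∂²p` are controlled by the Gagliardo–Nirenberg inequality. -/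
theorem nrm_D_remainder_le (hp : EnergyBound p K H) (j k l m : Fin 2) :
    nrm (D j (D m p * D l p * D k p + p * D k p * D m (D l p) + p * D l p * D m (D k p) +
        p * D m p * D l (D k p))) ≤ 18 * (K ^ 2 * H) := by
  have hK := hp.K_nonneg
  have t1 : ∀ {a b c : 𝓢(Plane, ℝ)}, (∀ x, |a x| ≤ K) → (∀ x, |b x| ≤ K) → nrm c ≤ H →
      nrm (a * b * c) ≤ K ^ 2 * H := fun ha hb hc =>
    (nrm_mul_mul_le ha hb).trans (mul_le_mul_of_nonneg_left hc (sq_nonneg K))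
  have hsq : ∀ k l, nrm (D l (D k p) * D l (D k p)) ≤ 3 * K * H := fun k l =>
    (nrm_D_sq_le l (hp.sup1 k)).trans
      (mul_le_mul_of_nonneg_left (hp.l2_3 k l l) (by positivity))
  have t2 : ∀ k l m n, nrm (p * D l (D k p) * D m (D n p)) ≤ 3 * (K ^ 2 * H) := fun k l m n =>
    (nrm_mul_mul_le_of_sq hp.sup0 (hsq k l) (hsq n m)).trans_eq (by ring)
  have e : D j (D m p * D l p * D k p + p * D k p * D m (D l p) + p * D l p * D m (D k p) +
        p * D m p * D l (D k p)) =
      (D l p * D k p * D j (D m p) + D m p * D k p * D j (D l p) + D m p * D l p * D j (D k p)) +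
      (D j p * D k p * D m (D l p) + p * D j (D k p) * D m (D l p) +
        p * D k p * D j (D m (D l p))) +
      (D j p * D l p * D m (D k p) + p * D j (D l p) * D m (D k p) +
        p * D l p * D j (D m (D k p))) +
      (D j p * D m p * D l (D k p) + p * D j (D m p) * D l (D k p) +
        p * D m p * D j (D l (D k p))) := by
    ext x
    simp only [D_mul, D_add, add_apply, schwartz_mul_apply]
    ring
  have t3 : ∀ {a b c : 𝓢(Plane, ℝ)} {A B C : ℝ}, nrm a ≤ A → nrm b ≤ B → nrm c ≤ C →
      nrm (a + b + c) ≤ A + B + C := fun ha hb hc =>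
    (nrm_add_le _ _).trans (add_le_add ((nrm_add_le _ _).trans (add_le_add ha hb)) hc)
  rw [e]
  have g0 := t3 (t1 (hp.sup1 l) (hp.sup1 k) (hp.l2_2 m j)) (t1 (hp.sup1 m) (hp.sup1 k) (hp.l2_2 l j))
    (t1 (hp.sup1 m) (hp.sup1 l) (hp.l2_2 k j))
  have g1 := t3 (t1 (hp.sup1 j) (hp.sup1 k) (hp.l2_2 l m)) (t2 k j m l)
    (t1 hp.sup0 (hp.sup1 k) (hp.l2_3 l m j))
  have g2 := t3 (t1 (hp.sup1 j) (hp.sup1 l) (hp.l2_2 k m)) (t2 l j m k)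
    (t1 hp.sup0 (hp.sup1 l) (hp.l2_3 k m j))
  have g3 := t3 (t1 (hp.sup1 j) (hp.sup1 m) (hp.l2_2 k l)) (t2 m j l k)
    (t1 hp.sup0 (hp.sup1 m) (hp.l2_3 k l j))
  refine (nrm_add_le _ _).trans ((add_le_add (t3 g0 g1 g2) g3).trans ?_)
  linarith

/-- The estimate for one derivative `v = ∂^α p`: the term in which all derivatives fall on one
factor is controlled by the commutator estimate, the remainder `F` by Cauchy–Schwarz. -/
theorem exists_norm_cutForm_le : ∃ C : ℝ, 0 < C ∧ ∀ {r : ℝ}, 0 < r → ∀ {p : 𝓢(Plane, ℝ)} {K H : ℝ},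
    EnergyBound p K H → ∀ (j : Fin 2) (v F w : 𝓢(Plane, ℝ)) (c A : ℝ), |c| ≤ 3 → nrm v ≤ H →
      w = c • (p * p) * v + F → nrm (D j F) ≤ A * (K ^ 2 * H) →
      ‖cutForm r (cx v) (cx (D j w))‖ ≤ (C + A) * (K ^ 2 * H ^ 2) := by
  obtain ⟨C, hC, hcomm⟩ := exists_norm_cutForm_deriv_mul_le
  refine ⟨12 * C, by positivity, fun {r} hr {p K H} hp j v F w c A hc hv hw hF => ?_⟩
  have hH := hp.H_nonneg
  have h1 := hcomm j hr v (c • (p * p)) (c • (p * p) * v) (12 * K ^ 2) (by positivity)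
    (fun x y => by
      simp only [smul_apply, smul_eq_mul]
      rw [← mul_sub, abs_mul]
      calc _ ≤ 3 * (4 * K ^ 2 * ‖x - y‖) :=
            mul_le_mul hc (hp.lip x y) (abs_nonneg _) (by norm_num)
        _ = _ := by ring) (fun x => rfl)
  have h2 : ∫ x, v x ^ 2 ≤ H ^ 2 := by
    have h3 := nrm_sq v
    simp only [Real.norm_eq_abs, sq_abs] at h3
    rw [← h3]
    exact pow_le_pow_left₀ (nrm_nonneg v) hv 2
  have h3 := (norm_cutForm_le r (cx v) (cx (D j F))).trans
    (mul_le_mul ((nrm_cx v).trans_le hv) ((nrm_cx _).trans_le hF) (nrm_nonneg _) hH)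
  rw [hw, D_add, cx_add, cutForm_add_right]
  rw [← cx_D] at h1
  refine (norm_add_le _ _).trans ((add_le_add (h1.trans (mul_le_mul_of_nonneg_left h2
    (by positivity))) h3).trans_eq (by ring))

end energy

/-- The symbol `(1 + |ζ|²)³ χ(rξ) i (ζ_a + ζ_b)`. -/
noncomputable def lossSymbol (r : ℝ) (ξ : Plane) : ℂ :=
  ((bracket ξ ^ 3 * cut r ξ * (2 * Real.pi * (ξ 0 + ξ 1)) : ℝ) : ℂ) * Complex.I

/-- The form governing the growth of the truncated energy: the truncated `H³` pairing of `u` with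
`(∂_a + ∂_b) q` in terms of the Fourier transforms `U` and `Q` of `u` and `q`. -/
noncomputable def lossForm (r : ℝ) (U Q : Plane → ℂ) : ℂ :=
  ∫ ξ, lossSymbol r ξ * (starRingEnd ℂ (U ξ) * Q ξ)

theorem bracket_eq (ξ : Plane) :
    bracket ξ = 1 + ((2 * Real.pi * ξ 0) ^ 2 + (2 * Real.pi * ξ 1) ^ 2) := by
  rw [bracket, norm_sq_plane]; simp

/-- The expansion `(1 + |ζ|²)³ = 1 + 3 |ζ|² + 3 |ζ|⁴ + |ζ|⁶` in terms of derivatives. -/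
theorem lossForm_eq_sum (r : ℝ) (p q : 𝓢(Plane, ℝ)) :
    lossForm r (𝓕 (cx p) : 𝓢(Plane, ℂ)) (𝓕 (cx q) : 𝓢(Plane, ℂ)) =
      ∑ j, (cutForm r (cx p) (cx (D j q)) +
        ∑ k, (3 * cutForm r (cx (D k p)) (cx (D j (D k q))) +
          ∑ l, (3 * cutForm r (cx (D l (D k p))) (cx (D j (D l (D k q)))) +
            ∑ m, cutForm r (cx (D m (D l (D k p)))) (cx (D j (D m (D l (D k q)))))))) := by
  let I : (Plane → ℂ) → ℂ → Prop := fun f z => Integrable f ∧ ∫ ξ, f ξ = z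
  have base : ∀ f g : 𝓢(Plane, ℂ), I (fun ξ => (cut r ξ : ℂ) * (starRingEnd ℂ (𝓕 f ξ) * 𝓕 g ξ)) (cutForm r f g) :=
    fun f g => ⟨integrable_cutForm r f g, rfl⟩
  have three : ∀ {f z}, I f z → I (fun ξ => 3 * f ξ) (3 * z) :=
    fun h => ⟨h.1.const_mul 3, by rw [integral_const_mul, h.2]⟩
  have add : ∀ {f g z w}, I f z → I g w → I (fun ξ => f ξ + g ξ) (z + w) :=
    fun h h' => ⟨h.1.add h'.1, by rw [integral_add h.1 h'.1, h.2, h'.2]⟩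
  have sum : ∀ {f : Fin 2 → Plane → ℂ} {z : Fin 2 → ℂ}, (∀ i, I (f i) (z i)) →
      I (fun ξ => ∑ i, f i ξ) (∑ i, z i) := fun h => by
    simpa only [Fin.sum_univ_two] using add (h 0) (h 1)
  have key := sum fun j => add (base (cx p) (cx (D j q))) (sum fun k =>
    add (three (base (cx (D k p)) (cx (D j (D k q))))) (sum fun l =>
      add (three (base (cx (D l (D k p))) (cx (D j (D l (D k q)))))) (sum fun m =>
        base (cx (D m (D l (D k p)))) (cx (D j (D m (D l (D k q))))))))
  rw [← key.2, lossForm]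
  refine integral_congr_ae (Eventually.of_forall fun ξ => ?_)
  simp only [lossSymbol, bracket_eq, fourier_cx_D, map_mul, Complex.conj_I, Complex.conj_ofReal,
    map_ofNat, Fin.sum_univ_two]
  have hI : Complex.I ^ 2 = -1 := Complex.I_sq
  have hI3 : Complex.I ^ 3 = -Complex.I := by rw [pow_succ, hI]; ring
  have hI5 : Complex.I ^ 5 = Complex.I := by
    rw [show 5 = 2 + 3 by norm_num, pow_add, hI, hI3]; ring
  have hI7 : Complex.I ^ 7 = -Complex.I := by
    rw [show 7 = 2 + 5 by norm_num, pow_add, hI, hI5]; ring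
  push_cast
  ring_nf
  rw [hI3, hI5, hI7]
  ring

/-- The energy estimate: for real Schwartz functions, the growth form on `(p, p³)` is bounded
without loss of derivatives, uniformly in the frequency cutoff. -/
theorem exists_norm_lossForm_le : ∃ C : ℝ, 0 < C ∧ ∀ {r : ℝ}, 0 < r →
    ∀ {p : 𝓢(Plane, ℝ)} {K H : ℝ}, EnergyBound p K H →
      ‖lossForm r (𝓕 (cx p) : 𝓢(Plane, ℂ)) (𝓕 (cx (p * p * p)) : 𝓢(Plane, ℂ))‖ ≤
        C * (K ^ 2 * H ^ 2) := by
  obtain ⟨C, hC, h⟩ := exists_norm_cutForm_le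
  refine ⟨2 * (27 * C + 1080), by positivity, fun {r} hr {p K H} hp => ?_⟩
  set X := K ^ 2 * H ^ 2 with hX
  have hX0 : 0 ≤ X := by positivity
  have hD0 : ∀ j, nrm (D j (0 : 𝓢(Plane, ℝ))) = 0 := fun j => by
    have : D j (0 : 𝓢(Plane, ℝ)) = 0 := by simpa using D_smul j 0 (0 : 𝓢(Plane, ℝ))
    rw [this]
    simpa using nrm_smul 0 (0 : 𝓢(Plane, ℝ))
  have b0 : ∀ j, ‖cutForm r (cx p) (cx (D j (p * p * p)))‖ ≤ C * X := fun j => by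
    have := h hr hp j p 0 (p * p * p) 1 0 (by norm_num) hp.l2_0 (by simp) (by simp [hD0])
    simpa using this
  have b1 : ∀ j k, ‖cutForm r (cx (D k p)) (cx (D j (D k (p * p * p))))‖ ≤ C * X := fun j k => by
    have := h hr hp j (D k p) 0 (D k (p * p * p)) 3 0 (by norm_num) (hp.l2_1 k)
      (by ext x; simp [D_mul]; ring) (by simp [hD0])
    simpa using this
  have b2 : ∀ j k l, ‖cutForm r (cx (D l (D k p))) (cx (D j (D l (D k (p * p * p)))))‖ ≤
      (C + 18) * X := fun j k l => by
    refine h hr hp j _ _ _ 3 18 (by norm_num) (hp.l2_2 k l) (D_D_cube k l p) ?_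
    rw [D_smul, nrm_smul, abs_of_pos (by norm_num)]
    have := nrm_D_mul_mul_D_le hp j k l
    linarith
  have b3 : ∀ j k l m, ‖cutForm r (cx (D m (D l (D k p))))
      (cx (D j (D m (D l (D k (p * p * p))))))‖ ≤ (C + 108) * X := fun j k l m => by
    refine h hr hp j _ _ _ 3 108 (by norm_num) (hp.l2_3 k l m) (D_D_D_cube k l m p) ?_
    rw [D_smul, nrm_smul, abs_of_pos (by norm_num)]
    have := nrm_D_remainder_le hp j k l m
    linarith
  have hsum : ∀ {f : Fin 2 → ℂ} {A : ℝ}, (∀ i, ‖f i‖ ≤ A) → ‖∑ i, f i‖ ≤ 2 * A := fun hf => by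
    rw [Fin.sum_univ_two]
    exact (norm_add_le _ _).trans (by linarith [hf 0, hf 1])
  have h3 : ∀ {z : ℂ} {A : ℝ}, ‖z‖ ≤ A → ‖3 * z‖ ≤ 3 * A := fun hz => by
    rw [norm_mul, Complex.norm_ofNat]; linarith
  rw [lossForm_eq_sum]
  refine (hsum fun j => norm_add_le_of_le (b0 j) (hsum fun k => norm_add_le_of_le (h3 (b1 j k))
    (hsum fun l => norm_add_le_of_le (h3 (b2 j k l)) (hsum fun m => b3 j k l m)))).trans_eq ?_
  ring

/-! ### The energy estimate for `H³` functions with bounded first derivatives -/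

theorem fourier_sub_Lp (f g : Lp ℂ 2 (volume : Measure Plane)) :
    (𝓕 (f - g) : Lp ℂ 2 (volume : Measure Plane)) = 𝓕 f - 𝓕 g :=
  (Lp.fourierTransformₗᵢ Plane ℂ).map_sub f g

/-- Multiplication by a Schwartz function as an operator on `L²`. -/
noncomputable def mulOp (m : 𝓢(Plane, ℂ)) :
    Lp ℂ 2 (volume : Measure Plane) →L[ℂ] Lp ℂ 2 (volume : Measure Plane) :=
  (ContinuousLinearMap.mul ℂ ℂ).holderL volume ⊤ 2 2 (m.toLp ⊤ volume)

theorem coeFn_mulOp (m : 𝓢(Plane, ℂ)) (g : Lp ℂ 2 (volume : Measure Plane)) :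
    mulOp m g =ᵐ[volume] fun ξ => m ξ * g ξ := by
  filter_upwards [(ContinuousLinearMap.mul ℂ ℂ).coeFn_holder (r := 2) (m.toLp ⊤ volume) g,
    m.coeFn_toLp ⊤ volume] with ξ h1 h2
  rw [mulOp, ContinuousLinearMap.holderL_apply_apply, h1, h2]
  rfl

theorem inner_mulOp (m : 𝓢(Plane, ℂ)) (f g : Lp ℂ 2 (volume : Measure Plane)) :
    inner ℂ f (mulOp m g) = ∫ ξ, m ξ * (starRingEnd ℂ (f ξ) * g ξ) := by
  rw [L2.inner_def]
  refine integral_congr_ae ?_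
  filter_upwards [coeFn_mulOp m g] with ξ h
  rw [h, RCLike.inner_apply]
  ring

/-- A smooth symbol cut off at frequency `1 / r`, as a Schwartz function. -/
noncomputable def cutSymbol {r : ℝ} (hr : 0 < r) {a : Plane → ℂ} (ha : ContDiff ℝ ∞ a) :
    𝓢(Plane, ℂ) :=
  HasCompactSupport.toSchwartzMap (f := fun ξ => (cut r ξ : ℂ) * a ξ)
    (((hasCompactSupport_cut hr).comp_left (g := Complex.ofReal) Complex.ofReal_zero).mul_right)
    ((Complex.ofRealCLM.contDiff.comp (contDiff_cut r)).mul ha)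

@[simp] theorem cutSymbol_apply {r : ℝ} (hr : 0 < r) {a : Plane → ℂ} (ha : ContDiff ℝ ∞ a)
    (ξ : Plane) : cutSymbol hr ha ξ = (cut r ξ : ℂ) * a ξ := rfl

theorem contDiff_bracket : ContDiff ℝ ∞ bracket := by
  unfold bracket
  exact contDiff_const.add ((contDiff_const_smul _).norm_sq ℝ)

/-- The symbol `(1 + |ζ|²)³ i (ζ_a + ζ_b)`. -/
noncomputable def fluxSymbol (ξ : Plane) : ℂ :=
  ((bracket ξ ^ 3 * (2 * Real.pi * (ξ 0 + ξ 1)) : ℝ) : ℂ) * Complex.I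

theorem contDiff_fluxSymbol : ContDiff ℝ ∞ fluxSymbol := by
  unfold fluxSymbol
  have h := contDiff_bracket
  have h1 : ContDiff ℝ ∞ fun ξ : Plane => bracket ξ ^ 3 * (2 * Real.pi * (ξ 0 + ξ 1)) := by fun_prop
  exact (Complex.ofRealCLM.contDiff.comp h1).mul contDiff_const

theorem lossForm_eq_inner {r : ℝ} (hr : 0 < r) (U Q : Lp ℂ 2 (volume : Measure Plane)) :
    lossForm r U Q = inner ℂ U (mulOp (cutSymbol hr contDiff_fluxSymbol) Q) := by
  rw [inner_mulOp, lossForm]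
  refine integral_congr_ae (Eventually.of_forall fun ξ => ?_)
  simp only [cutSymbol_apply, fluxSymbol, lossSymbol]
  push_cast
  ring

theorem lossForm_congr (r : ℝ) {U U' Q Q' : Plane → ℂ} (h : U =ᵐ[volume] U')
    (h' : Q =ᵐ[volume] Q') : lossForm r U Q = lossForm r U' Q' := by
  refine integral_congr_ae ?_
  filter_upwards [h, h'] with ξ h1 h2
  rw [h1, h2]

theorem norm_synth_le {C : ℝ} (hC0 : 0 < C) (hC : ∀ (o : Option (Fin 2)) {U : Plane → ℂ},
    AEStronglyMeasurable U → ∫⁻ ξ, ENNReal.ofReal |amp o ξ| * ‖U ξ‖ₑ ≤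
      ENNReal.ofReal C * sobolevSq U ^ (1 / 2 : ℝ)) (o : Option (Fin 2)) {U : Plane → ℂ}
    (hU : AEStronglyMeasurable U) {ε : ℝ} (hε : 0 ≤ ε) (h : sobolevSq U ≤ ENNReal.ofReal (ε ^ 2))
    (x : Plane) : ‖synth o U x‖ ≤ C * ε := by
  have h1 : ‖synth o U x‖ₑ ≤ ENNReal.ofReal (C * ε) := by
    refine (enorm_integral_le_lintegral_enorm _).trans ?_
    simp only [enorm_mul, enorm_exp_mul_I, enorm_amp, one_mul]
    refine (hC o hU).trans ?_
    rw [ENNReal.ofReal_mul hC0.le]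
    gcongr
    refine (ENNReal.rpow_le_rpow h (by norm_num)).trans_eq ?_
    rw [ENNReal.ofReal_rpow_of_nonneg (by positivity) (by norm_num), ← Real.sqrt_eq_rpow,
      Real.sqrt_sq hε]
  rw [← ofReal_norm] at h1
  exact (ENNReal.ofReal_le_ofReal_iff (by positivity)).1 h1

theorem synth_sub (o : Option (Fin 2)) {U V : Plane → ℂ} (hU : AEStronglyMeasurable U)
    (hV : AEStronglyMeasurable V) (hU' : sobolevSq U ≠ ⊤) (hV' : sobolevSq V ≠ ⊤) (x : Plane) :
    synth o (fun ξ => U ξ - V ξ) x = synth o U x - synth o V x := by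
  rw [synth, synth, synth, ← integral_sub (integrable_synth o hU hU' x) (integrable_synth o hV hV' x)]
  refine integral_congr_ae (Eventually.of_forall fun ξ => ?_)
  ring

theorem fourierInv_eq_synth (U : Plane → ℂ) (x : Plane) : 𝓕⁻ U x = synth none U x := by
  rw [Real.fourierInv_eq', synth]
  refine integral_congr_ae (Eventually.of_forall fun ξ => ?_)
  simp [amp]

/-- A function in `H³` is given almost everywhere by the Fourier inversion integral. -/
theorem ae_eq_synth {g : Lp ℂ 2 (volume : Measure Plane)}
    (h : sobolevSq (𝓕 g : Lp ℂ 2 (volume : Measure Plane)) ≠ ⊤) :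
    g =ᵐ[volume] synth none (𝓕 g : Lp ℂ 2 (volume : Measure Plane)) := by
  set U : Lp ℂ 2 (volume : Measure Plane) := 𝓕 g with hU
  have h1 : Integrable U := by
    have := integrable_synth none (Lp.aestronglyMeasurable U) h 0
    simpa [amp] using this
  have h2 := fourierInv_toLp_ae_eq h1 (Lp.memLp U)
  rw [Lp.toLp_coeFn, hU, FourierTransform.fourierInv_fourier_eq] at h2
  filter_upwards [h2] with x hx
  rw [hx, fourierInv_eq_synth]

theorem schwartz_eq_synth (f : 𝓢(Plane, ℂ)) (x : Plane) :
    f x = synth none (𝓕 f : 𝓢(Plane, ℂ)) x := by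
  rw [← fourierInv_eq_synth, ← SchwartzMap.fourierInv_coe, FourierTransform.fourierInv_fourier_eq]

theorem deriv_eq_synth (j : Fin 2) (f : 𝓢(Plane, ℂ)) (x : Plane) :
    (∂_{unitVec j} f) x = 2 * Real.pi * Complex.I * synth (some j) (𝓕 f : 𝓢(Plane, ℂ)) x := by
  rw [schwartz_eq_synth, synth, synth, ← integral_const_mul]
  refine integral_congr_ae (Eventually.of_forall fun ξ => ?_)
  simp only [amp, fourier_deriv_apply]
  push_cast
  ring

/-- The cube of a real `L²` function, if it belongs to `L²`, and zero otherwise. -/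
noncomputable def cube (g : Lp ℝ 2 (volume : Measure Plane)) : Lp ℝ 2 (volume : Measure Plane) := by
  classical
  exact if h : MemLp (fun x => g x ^ 3) 2 (volume : Measure Plane) then h.toLp else 0

theorem coeFn_cube {g : Lp ℝ 2 (volume : Measure Plane)} {K : ℝ} (h : ∀ᵐ x, |g x| ≤ K) :
    cube g =ᵐ[volume] fun x => g x ^ 3 := by
  have : MemLp (fun x => g x ^ 3) 2 (volume : Measure Plane) := by
    refine (Lp.memLp g).of_le_mul (c := K ^ 2) ((Lp.aestronglyMeasurable g).pow 3) ?_
    filter_upwards [h] with x hx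
    rw [norm_pow, Real.norm_eq_abs, pow_succ]
    gcongr
  rw [cube, dif_pos this]
  exact this.coeFn_toLp

theorem coeFn_complexify (g : Lp ℝ 2 (volume : Measure Plane)) :
    complexify g =ᵐ[volume] fun x => (g x : ℂ) := by
  filter_upwards [Complex.ofRealCLM.coeFn_compLp g] with x hx
  rw [complexify, hx, Complex.ofRealCLM_apply]

/-- The real part of a Schwartz function. -/
noncomputable def rePart (f : 𝓢(Plane, ℂ)) : 𝓢(Plane, ℝ) :=
  SchwartzMap.postcompCLM Complex.reCLM f

@[simp] theorem rePart_apply (f : 𝓢(Plane, ℂ)) (x : Plane) : rePart f x = (f x).re := rfl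

theorem D_rePart (j : Fin 2) (f : 𝓢(Plane, ℂ)) : D j (rePart f) = rePart (∂_{unitVec j} f) := by
  ext x
  rw [D_apply, rePart_apply, SchwartzMap.lineDerivOp_apply_eq_fderiv]
  have h : (⇑(rePart f) : Plane → ℝ) = Complex.reCLM ∘ f := rfl
  rw [h, fderiv_comp x Complex.reCLM.differentiableAt f.differentiableAt]
  simp

theorem nrm_rePart_le (f : 𝓢(Plane, ℂ)) : nrm (rePart f) ≤ nrm f := by
  have : nrm (rePart f) ≤ 1 * nrm f := nrm_le fun x => by
    rw [one_mul, rePart_apply]; exact Complex.abs_re_le_norm _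
  simpa using this

/-- The `H³` norm as the `L²` norm of `(1 + |ζ|²)^{3/2} V`. -/
theorem sobolevSq_eq_norm_sq {V : Plane → ℂ} {G : Lp ℂ 2 (volume : Measure Plane)}
    (h : ∀ᵐ ξ, G ξ = ((bracket ξ ^ (3 / 2 : ℝ) : ℝ) : ℂ) * V ξ) :
    sobolevSq V = ENNReal.ofReal (‖G‖ ^ 2) := by
  rw [ENNReal.ofReal_pow (norm_nonneg _), Lp.norm_def, ENNReal.ofReal_toReal (Lp.eLpNorm_ne_top _),
    eLpNorm_two_sq, sobolevSq]
  refine lintegral_congr_ae ?_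
  filter_upwards [h] with ξ hξ
  have hb := bracket_pos ξ
  rw [hξ, enorm_mul, mul_pow, ← ofReal_norm ((bracket ξ ^ (3 / 2 : ℝ) : ℝ) : ℂ), Complex.norm_real,
    Real.norm_of_nonneg (by positivity), ← ENNReal.ofReal_pow (by positivity), ← Real.rpow_natCast,
    ← Real.rpow_natCast, ← Real.rpow_mul hb.le]
  norm_num

theorem nrm_le_of_sobolevSq {f g : 𝓢(Plane, ℂ)} {H : ℝ} (hH : 0 ≤ H)
    (h : sobolevSq (𝓕 f : 𝓢(Plane, ℂ)) ≤ ENNReal.ofReal (H ^ 2))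
    (hg : ∀ ξ, ‖𝓕 g ξ‖ ^ 2 ≤ bracket ξ ^ 3 * ‖𝓕 f ξ‖ ^ 2) : nrm g ≤ H := by
  rw [nrm, ← SchwartzMap.norm_fourier_toL2_eq]
  refine (sq_le_sq₀ (norm_nonneg _) hH).1 ((ENNReal.ofReal_le_ofReal_iff (sq_nonneg H)).1 ?_)
  refine le_trans ?_ h
  rw [ENNReal.ofReal_pow (norm_nonneg _), Lp.norm_def, ENNReal.ofReal_toReal (Lp.eLpNorm_ne_top _),
    eLpNorm_two_sq, sobolevSq]
  refine lintegral_mono_ae ?_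
  filter_upwards [(𝓕 g : 𝓢(Plane, ℂ)).coeFn_toLp 2 volume] with ξ hξ
  have hb := bracket_pos ξ
  rw [hξ, ← ofReal_norm, ← ofReal_norm, ← ENNReal.ofReal_pow (norm_nonneg _),
    ← ENNReal.ofReal_pow (norm_nonneg _), ← ENNReal.ofReal_mul (by positivity)]
  exact ENNReal.ofReal_le_ofReal (hg ξ)

theorem angular_sq_le_bracket (j : Fin 2) (ξ : Plane) : (2 * Real.pi * ξ j) ^ 2 ≤ bracket ξ := by
  rw [bracket_eq]
  fin_cases j <;> simp only [Fin.zero_eta, Fin.mk_one] <;>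
    nlinarith [sq_nonneg (2 * Real.pi * ξ 0), sq_nonneg (2 * Real.pi * ξ 1)]

theorem norm_fourier_deriv_sq_le (j : Fin 2) (f : 𝓢(Plane, ℂ)) (ξ : Plane) :
    ‖𝓕 (∂_{unitVec j} f) ξ‖ ^ 2 ≤ bracket ξ * ‖𝓕 f ξ‖ ^ 2 := by
  have e : (2 * Real.pi * Complex.I * ξ j : ℂ) = ((2 * Real.pi * ξ j : ℝ) : ℂ) * Complex.I := by
    push_cast; ring
  rw [fourier_deriv_apply, norm_mul, mul_pow, e, norm_mul, Complex.norm_I, mul_one,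
    Complex.norm_real, Real.norm_eq_abs, sq_abs]
  gcongr
  exact angular_sq_le_bracket j ξ

theorem hasTemperateGrowth_bracket_rpow (s : ℝ) :
    Function.HasTemperateGrowth fun ξ : Plane => ((bracket ξ ^ s : ℝ) : ℂ) := by
  have h1 : Function.HasTemperateGrowth fun ξ : Plane => (2 * Real.pi) • ξ :=
    ((2 * Real.pi) • ContinuousLinearMap.id ℝ Plane).hasTemperateGrowth
  have h2 := (Function.hasTemperateGrowth_one_add_norm_sq_rpow Plane s).comp h1
  exact (Complex.ofRealCLM.hasTemperateGrowth).comp h2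

/-- A Schwartz function whose derivatives up to order one are bounded by `K` and whose `H³` norm is
at most `H` has a real part with the same bounds, up to a constant. -/
theorem energyBound_rePart {f : 𝓢(Plane, ℂ)} {K H : ℝ} (hK : 0 ≤ K) (hH : 0 ≤ H)
    (hs : ∀ o x, ‖synth o (𝓕 f : 𝓢(Plane, ℂ)) x‖ ≤ K)
    (h : sobolevSq (𝓕 f : 𝓢(Plane, ℂ)) ≤ ENNReal.ofReal (H ^ 2)) :
    EnergyBound (rePart f) (2 * Real.pi * K) H := by
  have hpi : 1 ≤ 2 * Real.pi := by linarith [Real.two_le_pi]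
  have b1 : ∀ ξ, 1 ≤ bracket ξ := one_le_bracket
  refine ⟨fun x => ?_, fun j x => ?_, ?_, fun k => ?_, fun k l => ?_, fun k l m => ?_⟩
  · refine (Complex.abs_re_le_norm _).trans ?_
    rw [schwartz_eq_synth]
    exact (hs none x).trans (le_mul_of_one_le_left hK hpi)
  · rw [D_rePart]
    refine (Complex.abs_re_le_norm _).trans ?_
    rw [deriv_eq_synth, norm_mul, norm_mul, Complex.norm_I, mul_one]
    refine mul_le_mul (le_of_eq ?_) (hs _ x) (norm_nonneg _) (by positivity)
    rw [norm_mul, Complex.norm_real, Real.norm_of_nonneg Real.pi_pos.le]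
    norm_num
  · refine (nrm_rePart_le _).trans (nrm_le_of_sobolevSq hH h fun ξ => ?_)
    exact le_mul_of_one_le_left (by positivity) (one_le_pow₀ (b1 ξ))
  · rw [D_rePart]
    refine (nrm_rePart_le _).trans (nrm_le_of_sobolevSq hH h fun ξ => ?_)
    refine (norm_fourier_deriv_sq_le k f ξ).trans ?_
    gcongr
    exact le_self_pow₀ (b1 ξ) (by norm_num)
  · rw [D_rePart, D_rePart]
    refine (nrm_rePart_le _).trans (nrm_le_of_sobolevSq hH h fun ξ => ?_)
    refine (norm_fourier_deriv_sq_le l _ ξ).trans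
      ((mul_le_mul_of_nonneg_left (norm_fourier_deriv_sq_le k f ξ) (bracket_pos ξ).le).trans ?_)
    rw [← mul_assoc, ← sq]
    gcongr
    · exact b1 ξ
    · norm_num
  · rw [D_rePart, D_rePart, D_rePart]
    refine (nrm_rePart_le _).trans (nrm_le_of_sobolevSq hH h fun ξ => ?_)
    have hb := (bracket_pos ξ).le
    refine (norm_fourier_deriv_sq_le m _ ξ).trans
      ((mul_le_mul_of_nonneg_left ((norm_fourier_deriv_sq_le l _ ξ).trans
        (mul_le_mul_of_nonneg_left (norm_fourier_deriv_sq_le k f ξ) hb)) hb).trans_eq ?_)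
    ring

/-- Approximation of an `H³` function with bounded first derivatives by Schwartz functions with
almost the same bounds: the Fourier transform is approximated in the weighted `L²` space, which by
Sobolev embedding also controls the first derivatives uniformly. -/
theorem exists_energyBound_approx {u : Lp ℝ 2 (volume : Measure Plane)} {K H : ℝ} (hK : 0 ≤ K)
    (hH : 0 ≤ H)
    (hs : ∀ o x, ‖synth o (𝓕 (complexify u) : Lp ℂ 2 (volume : Measure Plane)) x‖ ≤ K)
    (h : sobolevSq (𝓕 (complexify u) : Lp ℂ 2 (volume : Measure Plane)) ≤ ENNReal.ofReal (H ^ 2))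
    {ε : ℝ} (hε : 0 < ε) :
    ∃ p : 𝓢(Plane, ℝ), EnergyBound p (2 * Real.pi * (K + ε)) (H + ε) ∧
      ‖(cx p).toLp 2 volume - complexify u‖ ≤ ε := by
  obtain ⟨C, hC0, hC⟩ := exists_lintegral_amp_le
  set U : Lp ℂ 2 (volume : Measure Plane) := 𝓕 (complexify u) with hU
  have hUfin : sobolevSq U ≠ ⊤ := ne_top_of_le_ne_top ENNReal.ofReal_ne_top h
  have hUm := Lp.aestronglyMeasurable U
  set b : Plane → ℂ := fun ξ => ((bracket ξ ^ (3 / 2 : ℝ) : ℝ) : ℂ) with hb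
  set b' : Plane → ℂ := fun ξ => ((bracket ξ ^ (-(3 / 2) : ℝ) : ℝ) : ℂ) with hb'
  have hb't : Function.HasTemperateGrowth b' := hasTemperateGrowth_bracket_rpow _
  have hbb : ∀ ξ, b ξ * b' ξ = 1 := fun ξ => by
    simp only [hb, hb']
    rw [← Complex.ofReal_mul, ← Real.rpow_add (bracket_pos ξ)]
    norm_num
  have hbm : AEStronglyMeasurable b (volume : Measure Plane) :=
    (Complex.continuous_ofReal.comp (continuous_bracket.rpow_const
      fun ξ => Or.inl (bracket_pos ξ).ne')).aestronglyMeasurable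
  have hGmem : MemLp (fun ξ => b ξ * U ξ) 2 (volume : Measure Plane) := by
    refine ⟨hbm.mul hUm, ?_⟩
    have e : eLpNorm (fun ξ => b ξ * U ξ) 2 (volume : Measure Plane) ^ 2 = sobolevSq U := by
      rw [eLpNorm_two_sq, sobolevSq]
      refine lintegral_congr fun ξ => ?_
      have hbp := bracket_pos ξ
      rw [enorm_mul, mul_pow, ← ofReal_norm (b ξ), Complex.norm_real,
        Real.norm_of_nonneg (by positivity), ← ENNReal.ofReal_pow (by positivity),
        ← Real.rpow_natCast, ← Real.rpow_natCast, ← Real.rpow_mul hbp.le]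
      norm_num
    exact lt_top_iff_ne_top.2 fun ht => hUfin (by rw [← e, ht]; simp)
  set G := hGmem.toLp with hG
  have hGn : ‖G‖ ≤ H := by
    refine (sq_le_sq₀ (norm_nonneg _) hH).1 ((ENNReal.ofReal_le_ofReal_iff (sq_nonneg H)).1 ?_)
    rwa [← sobolevSq_eq_norm_sq (V := U) hGmem.coeFn_toLp]
  -- `C` is the constant of the Sobolev embedding
  set δ := ε / (C + 1) with hδ
  have hδ0 : 0 < δ := by positivity
  have hδε : δ ≤ ε := div_le_self hε.le (by linarith)
  have hδC : C * δ ≤ ε := by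
    rw [hδ, mul_div_assoc', div_le_iff₀ (by positivity)]
    nlinarith
  -- `g` approximates `(1 + |ζ|²)^{3/2} U`, and dividing by the weight keeps it a Schwartz function
  obtain ⟨g, hg⟩ := (SchwartzMap.denseRange_toLpCLM (E := Plane) (F := ℂ) (μ := (volume : Measure Plane))
    (p := 2) (by norm_num)).exists_dist_lt G hδ0
  rw [dist_comm, dist_eq_norm] at hg
  change ‖g.toLp 2 volume - G‖ < δ at hg
  set W : 𝓢(Plane, ℂ) := SchwartzMap.smulLeftCLM ℂ b' g with hW
  have hWa : ∀ ξ, W ξ = b' ξ * g ξ := fun ξ => SchwartzMap.smulLeftCLM_apply_apply hb't g ξ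
  set f : 𝓢(Plane, ℂ) := 𝓕⁻ W with hf
  have hfW : (𝓕 f : 𝓢(Plane, ℂ)) = W := FourierTransform.fourier_fourierInv_eq W
  have hsW : sobolevSq W ≤ ENNReal.ofReal ((H + ε) ^ 2) := by
    rw [sobolevSq_eq_norm_sq (V := W) (G := g.toLp 2 volume)]
    · refine ENNReal.ofReal_le_ofReal (pow_le_pow_left₀ (norm_nonneg _) ?_ 2)
      have := norm_add_le (g.toLp 2 (volume : Measure Plane) - G) G
      rw [sub_add_cancel] at this
      linarith
    · filter_upwards [g.coeFn_toLp 2 volume] with ξ h1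
      rw [h1, hWa, ← mul_assoc]
      exact (by rw [hbb, one_mul] : g ξ = b ξ * b' ξ * g ξ)
  have hsWU : sobolevSq (fun ξ => W ξ - U ξ) ≤ ENNReal.ofReal (δ ^ 2) := by
    rw [sobolevSq_eq_norm_sq (V := fun ξ => W ξ - U ξ) (G := g.toLp 2 volume - G)]
    · exact ENNReal.ofReal_le_ofReal (pow_le_pow_left₀ (norm_nonneg _) hg.le 2)
    · filter_upwards [g.coeFn_toLp 2 volume, hGmem.coeFn_toLp,
        Lp.coeFn_sub (g.toLp 2 volume) G] with ξ h1 h2 h3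
      rw [h3, Pi.sub_apply, h1, h2, hWa, mul_sub, ← mul_assoc]
      exact (by rw [hbb, one_mul] : g ξ - b ξ * U ξ = b ξ * b' ξ * g ξ - b ξ * U ξ)
  have hWm : AEStronglyMeasurable W (volume : Measure Plane) := W.continuous.aestronglyMeasurable
  refine ⟨rePart f, energyBound_rePart (by positivity) (by positivity) (fun o x => ?_)
    (by rwa [hfW]), ?_⟩
  · rw [hfW]
    have h1 := norm_synth_le hC0 hC o (hWm.sub hUm) hδ0.le hsWU x
    have h2 := synth_sub o hWm hUm (ne_top_of_le_ne_top ENNReal.ofReal_ne_top hsW) hUfin x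
    have h3 : ‖synth o W x - synth o U x‖ ≤ ε := by rw [← h2]; exact h1.trans hδC
    have h4 := norm_add_le (synth o W x - synth o U x) (synth o U x)
    rw [sub_add_cancel] at h4
    linarith [hs o x]
  · have h1 : ‖(cx (rePart f)).toLp 2 volume - complexify u‖ ≤ ‖f.toLp 2 volume - complexify u‖ := by
      refine Lp.norm_le_norm_of_ae_le ?_
      filter_upwards [(cx (rePart f)).coeFn_toLp 2 volume, f.coeFn_toLp 2 volume,
        coeFn_complexify u, Lp.coeFn_sub ((cx (rePart f)).toLp 2 volume) (complexify u),
        Lp.coeFn_sub (f.toLp 2 volume) (complexify u)] with x h1 h2 h3 h4 h5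
      rw [h4, h5, Pi.sub_apply, Pi.sub_apply, h1, h2, h3, cx_apply, rePart_apply,
        ← Complex.ofReal_sub, Complex.norm_real, Real.norm_eq_abs]
      have := Complex.abs_re_le_norm (f x - (u x : ℂ))
      simpa using this
    refine h1.trans (le_trans ?_ hδε)
    have h2 : (𝓕 (f.toLp 2 volume - complexify u) : Lp ℂ 2 (volume : Measure Plane)) =
        W.toLp 2 volume - U := by
      rw [fourier_sub_Lp, SchwartzMap.toLp_fourier_eq, hfW]
    rw [← Lp.norm_fourier_eq, h2]
    refine (sq_le_sq₀ (norm_nonneg _) hδ0.le).1 ((ENNReal.ofReal_le_ofReal_iff (sq_nonneg δ)).1 ?_)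
    refine le_trans ?_ hsWU
    rw [ENNReal.ofReal_pow (norm_nonneg _), Lp.norm_def,
      ENNReal.ofReal_toReal (Lp.eLpNorm_ne_top _)]
    refine le_trans (le_of_eq ?_) eLpNorm_le_sobolevSq
    congr 1
    refine eLpNorm_congr_ae ?_
    filter_upwards [W.coeFn_toLp 2 volume, Lp.coeFn_sub (W.toLp 2 volume) U] with ξ h1 h3
    rw [h3, Pi.sub_apply, h1]

theorem ae_abs_le_of_synth_le {u : Lp ℝ 2 (volume : Measure Plane)} {K : ℝ}
    (hs : ∀ x, ‖synth none (𝓕 (complexify u) : Lp ℂ 2 (volume : Measure Plane)) x‖ ≤ K)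
    (h : sobolevSq (𝓕 (complexify u) : Lp ℂ 2 (volume : Measure Plane)) ≠ ⊤) :
    ∀ᵐ x, |u x| ≤ K := by
  filter_upwards [ae_eq_synth h, coeFn_complexify u] with x h1 h2
  rw [h2] at h1
  rw [← Real.norm_eq_abs, ← Complex.norm_real, h1]
  exact hs x

theorem abs_cube_sub_le {a b L : ℝ} (ha : |a| ≤ L) (hb : |b| ≤ L) :
    |a ^ 3 - b ^ 3| ≤ 3 * L ^ 2 * |a - b| := by
  rw [show a ^ 3 - b ^ 3 = (a ^ 2 + a * b + b ^ 2) * (a - b) by ring, abs_mul]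
  have hL : 0 ≤ L := (abs_nonneg a).trans ha
  have h1 : |a * b| ≤ L * L := by
    rw [abs_mul]; exact mul_le_mul ha hb (abs_nonneg _) hL
  have h2 : a ^ 2 ≤ L ^ 2 := sq_le_sq' (abs_le.1 ha).1 (abs_le.1 ha).2
  have h3 : b ^ 2 ≤ L ^ 2 := sq_le_sq' (abs_le.1 hb).1 (abs_le.1 hb).2
  gcongr
  refine (abs_add_le _ _).trans ((add_le_add (abs_add_le _ _) le_rfl).trans ?_)
  rw [abs_of_nonneg (sq_nonneg a), abs_of_nonneg (sq_nonneg b)]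
  linarith

/-- The energy estimate for a real `H³` function whose first derivatives are bounded by `K`. -/
theorem exists_norm_lossForm_cube_le : ∃ C : ℝ, 0 < C ∧ ∀ {r : ℝ}, 0 < r →
    ∀ {u : Lp ℝ 2 (volume : Measure Plane)} {K H : ℝ}, 0 ≤ K → 0 ≤ H →
    (∀ o x, ‖synth o (𝓕 (complexify u) : Lp ℂ 2 (volume : Measure Plane)) x‖ ≤ K) →
    sobolevSq (𝓕 (complexify u) : Lp ℂ 2 (volume : Measure Plane)) ≤ ENNReal.ofReal (H ^ 2) →
      ‖lossForm r (𝓕 (complexify u) : Lp ℂ 2 (volume : Measure Plane))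
        (𝓕 (complexify (cube u)) : Lp ℂ 2 (volume : Measure Plane))‖ ≤ C * (K ^ 2 * H ^ 2) := by
  obtain ⟨C, hC, hloss⟩ := exists_norm_lossForm_le
  refine ⟨C * (2 * Real.pi) ^ 2, by positivity, fun {r} hr {u K H} hK hH hs h => ?_⟩
  set U : Lp ℂ 2 (volume : Measure Plane) := 𝓕 (complexify u) with hU
  set Q : Lp ℂ 2 (volume : Measure Plane) := 𝓕 (complexify (cube u)) with hQ
  set A := mulOp (cutSymbol hr contDiff_fluxSymbol) with hA
  have huK : ∀ᵐ x, |u x| ≤ K :=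
    ae_abs_le_of_synth_le (hs none) (ne_top_of_le_ne_top ENNReal.ofReal_ne_top h)
  have hpi : 1 ≤ 2 * Real.pi := by linarith [Real.two_le_pi]
  -- the bound obtained from an `ε`-approximation; the second summand is the error of the form
  set B : ℝ → ℝ := fun ε => C * ((2 * Real.pi * (K + ε)) ^ 2 * (H + ε) ^ 2) +
    (ε * ‖A‖ * ‖Q‖ + (‖U‖ + ε) * ‖A‖ * (3 * (2 * Real.pi * (K + ε)) ^ 2 * ε)) with hB
  have key : ∀ ε > 0, ‖lossForm r U Q‖ ≤ B ε := by
    intro ε hε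
    obtain ⟨p, hp, hpu⟩ := exists_energyBound_approx hK hH hs h hε
    set L := 2 * Real.pi * (K + ε) with hL
    have hKL : K ≤ L := by
      rw [hL]
      nlinarith
    have hL0 : 0 ≤ L := hK.trans hKL
    set P := (𝓕 (cx p) : 𝓢(Plane, ℂ)).toLp 2 (volume : Measure Plane) with hP
    set P3 := (𝓕 (cx (p * p * p)) : 𝓢(Plane, ℂ)).toLp 2 (volume : Measure Plane) with hP3
    have h1 : ‖P - U‖ ≤ ε := by
      rw [hP, ← SchwartzMap.toLp_fourier_eq, hU, ← fourier_sub_Lp, Lp.norm_fourier_eq]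
      exact hpu
    have h2 : ‖P3 - Q‖ ≤ 3 * L ^ 2 * ε := by
      rw [hP3, ← SchwartzMap.toLp_fourier_eq, hQ, ← fourier_sub_Lp,
        Lp.norm_fourier_eq]
      refine le_trans (Lp.norm_le_mul_norm_of_ae_le_mul (c := 3 * L ^ 2)
        (g := (cx p).toLp 2 volume - complexify u) ?_)
        (mul_le_mul_of_nonneg_left hpu (by positivity))
      filter_upwards [(cx p).coeFn_toLp 2 volume, (cx (p * p * p)).coeFn_toLp 2 volume,
        coeFn_complexify u, coeFn_complexify (cube u), coeFn_cube huK,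
        Lp.coeFn_sub ((cx p).toLp 2 volume) (complexify u),
        Lp.coeFn_sub ((cx (p * p * p)).toLp 2 volume) (complexify (cube u)), huK]
        with x e1 e2 e3 e4 e5 e6 e7 e8
      rw [e6, e7, Pi.sub_apply, Pi.sub_apply, e1, e2, e3, e4, e5, cx_apply, cx_apply,
        ← Complex.ofReal_sub, ← Complex.ofReal_sub, Complex.norm_real, Complex.norm_real,
        schwartz_mul_apply, schwartz_mul_apply, Real.norm_eq_abs, Real.norm_eq_abs,
        show p x * p x * p x = p x ^ 3 by ring]
      exact abs_cube_sub_le (hp.sup0 x) (e8.trans hKL)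
    have h3 : ‖lossForm r P P3‖ ≤ C * (L ^ 2 * (H + ε) ^ 2) := by
      rw [lossForm_congr r ((𝓕 (cx p) : 𝓢(Plane, ℂ)).coeFn_toLp 2 volume)
        ((𝓕 (cx (p * p * p)) : 𝓢(Plane, ℂ)).coeFn_toLp 2 volume)]
      exact hloss hr hp
    have h4 : lossForm r U Q = lossForm r P P3 - (inner ℂ (P - U) (A Q) + inner ℂ P (A (P3 - Q))) := by
      rw [lossForm_eq_inner hr, lossForm_eq_inner hr, map_sub, inner_sub_left, inner_sub_right]
      ring
    have h5 : ‖inner ℂ (P - U) (A Q)‖ ≤ ε * ‖A‖ * ‖Q‖ := by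
      refine (norm_inner_le_norm _ _).trans ?_
      rw [mul_assoc]
      exact mul_le_mul h1 (A.le_opNorm Q) (norm_nonneg _) hε.le
    have h6 : ‖inner ℂ P (A (P3 - Q))‖ ≤ (‖U‖ + ε) * ‖A‖ * (3 * L ^ 2 * ε) := by
      refine (norm_inner_le_norm _ _).trans ?_
      rw [mul_assoc]
      refine mul_le_mul ?_ ((A.le_opNorm _).trans (mul_le_mul_of_nonneg_left h2 (norm_nonneg _)))
        (norm_nonneg _) (by positivity)
      have := norm_add_le (P - U) U
      rw [sub_add_cancel] at this
      linarith
    rw [h4]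
    refine (norm_sub_le _ _).trans (add_le_add h3 ((norm_add_le _ _).trans (add_le_add h5 h6)))
  have hcont : Continuous B := by rw [hB]; fun_prop
  have hlim : Tendsto B (𝓝[>] 0) (𝓝 (B 0)) := hcont.continuousAt.tendsto.mono_left nhdsWithin_le_nhds
  have := ge_of_tendsto hlim (eventually_nhdsWithin_of_forall key)
  refine this.trans_eq ?_
  simp only [hB]
  ring

/-! ### The equation integrated in time and tested against Schwartz functions -/

/-- The `L²` pairing with a real Schwartz function. -/
noncomputable def pair (f : 𝓢(Plane, ℝ)) : Lp ℝ 2 (volume : Measure Plane) →L[ℝ] ℝ :=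
  innerSL ℝ (f.toLp 2 volume)

theorem pair_apply (f : 𝓢(Plane, ℝ)) (a : Lp ℝ 2 (volume : Measure Plane)) :
    pair f a = ∫ x, a x * f x := by
  rw [pair, innerSL_apply_apply, L2.inner_def]
  refine integral_congr_ae ?_
  filter_upwards [f.coeFn_toLp 2 volume] with x hx
  rw [hx]
  rfl

theorem pair_add (f g : 𝓢(Plane, ℝ)) : pair (f + g) = pair f + pair g := by
  have : (f + g).toLp 2 (volume : Measure Plane) = f.toLp 2 volume + g.toLp 2 volume :=
    map_add (SchwartzMap.toLpCLM ℝ ℝ 2 volume) f g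
  rw [pair, this, map_add]; rfl

theorem pair_smul (c : ℝ) (f : 𝓢(Plane, ℝ)) : pair (c • f) = c • pair f := by
  have : (c • f).toLp 2 (volume : Measure Plane) = c • f.toLp 2 volume :=
    map_smul (SchwartzMap.toLpCLM ℝ ℝ 2 volume) c f
  rw [pair, this, map_smul]; rfl

/-- The operator `∂_a³ + ∂_b³`. -/
noncomputable def dispOp (f : 𝓢(Plane, ℝ)) : 𝓢(Plane, ℝ) := D 0 (D 0 (D 0 f)) + D 1 (D 1 (D 1 f))

/-- The operator `∂_a + ∂_b`. -/
noncomputable def transOp (f : 𝓢(Plane, ℝ)) : 𝓢(Plane, ℝ) := D 0 f + D 1 f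

/-- The dilation `x ↦ f (r x)`. -/
noncomputable def dil {r : ℝ} (hr : r ≠ 0) (f : 𝓢(Plane, ℝ)) : 𝓢(Plane, ℝ) :=
  SchwartzMap.compCLMOfContinuousLinearEquiv ℝ
    (ContinuousLinearEquiv.smulLeft (R₁ := ℝ) (M₁ := Plane) (Units.mk0 r hr)) f

@[simp] theorem dil_apply {r : ℝ} (hr : r ≠ 0) (f : 𝓢(Plane, ℝ)) (x : Plane) :
    dil hr f x = f (r • x) := rfl

theorem D_dil {r : ℝ} (hr : r ≠ 0) (j : Fin 2) (f : 𝓢(Plane, ℝ)) :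
    D j (dil hr f) = r • dil hr (D j f) := by
  ext x
  have h : (⇑(dil hr f) : Plane → ℝ) = fun x => f (r • x) := rfl
  rw [D_apply, h, fderiv_comp_smul]
  change r • fderiv ℝ f (r • x) (unitVec j) = r • D j f (r • x)
  rw [D_apply]

/-- Multiplication by a dilated function tends weakly to multiplication by its value at zero. -/
theorem tendsto_pair_dil_mul {r : ℕ → ℝ} (hr : ∀ n, r n ≠ 0) (hr0 : Tendsto r atTop (𝓝 0))
    (f g : 𝓢(Plane, ℝ)) (a : Lp ℝ 2 (volume : Measure Plane)) :
    Tendsto (fun n => pair (dil (hr n) f * g) a) atTop (𝓝 (f 0 * pair g a)) := by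
  simp only [pair_apply]
  rw [← integral_const_mul]
  have hag : Integrable fun x => a x * g x := (Lp.memLp a).integrable_mul (g.memLp 2 volume)
  have ha := Lp.aestronglyMeasurable a
  refine tendsto_integral_of_dominated_convergence
    (fun x => SchwartzMap.seminorm ℝ 0 0 f * ‖a x * g x‖) (fun n => ?_) (hag.norm.const_mul _)
    (fun n => Eventually.of_forall fun x => ?_) (Eventually.of_forall fun x => ?_)
  · exact ha.mul (SchwartzMap.continuous _).aestronglyMeasurable
  · rw [schwartz_mul_apply, dil_apply, show a x * (f (r n • x) * g x) =
      f (r n • x) * (a x * g x) by ring, norm_mul]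
    gcongr
    exact SchwartzMap.norm_le_seminorm ℝ f _
  · simp only [schwartz_mul_apply, dil_apply]
    have h1 : Tendsto (fun n => f (r n • x)) atTop (𝓝 (f 0)) := by
      have := (f.continuous.tendsto ((0 : ℝ) • x)).comp (hr0.smul_const x)
      simpa [Function.comp_def] using this
    have h2 := h1.mul_const (a x * g x)
    refine h2.congr fun n => ?_
    ring

theorem D_D_D_dil_mul {r : ℝ} (hr : r ≠ 0) (j : Fin 2) (f g : 𝓢(Plane, ℝ)) :
    D j (D j (D j (dil hr f * g))) = r ^ 3 • (dil hr (D j (D j (D j f))) * g) +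
      (3 * r ^ 2) • (dil hr (D j (D j f)) * D j g) + (3 * r) • (dil hr (D j f) * D j (D j g)) +
        dil hr f * D j (D j (D j g)) := by
  ext x
  simp only [D_mul, D_add, D_dil, D_smul, add_apply, schwartz_mul_apply, smul_apply, smul_eq_mul]
  ring

/-- A linear relation between test functions of compact support extends to Schwartz functions: the
derivatives of a dilated cutoff carry powers of the dilation parameter, which tends to zero. -/
theorem pair_eq_of_compactSupport {a b c : Lp ℝ 2 (volume : Measure Plane)}
    (h : ∀ f : 𝓢(Plane, ℝ), HasCompactSupport f →
      pair f a = pair (dispOp f) b + pair (transOp f) c) (g : 𝓢(Plane, ℝ)) :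
    pair g a = pair (dispOp g) b + pair (transOp g) c := by
  set χ : 𝓢(Plane, ℝ) := HasCompactSupport.toSchwartzMap (f := bump) bump.hasCompactSupport
    bump.contDiff with hχ
  have hχ0 : χ 0 = 1 := bump.one_of_mem_closedBall (by simp [bump])
  set r : ℕ → ℝ := fun n => 1 / ((n : ℝ) + 1) with hrdef
  have hr : ∀ n, r n ≠ 0 := fun n => by positivity
  have hr0 : Tendsto r atTop (𝓝 0) := tendsto_one_div_add_atTop_nhds_zero_nat
  have T := fun f g a => tendsto_pair_dil_mul hr hr0 f g a
  have h1 : Tendsto (fun n => pair (dil (hr n) χ * g) a) atTop (𝓝 (pair g a)) := by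
    have := T χ g a
    rwa [hχ0, one_mul] at this
  have h3 : ∀ j, Tendsto (fun n => pair (D j (D j (D j (dil (hr n) χ * g)))) b) atTop
      (𝓝 (pair (D j (D j (D j g))) b)) := by
    intro j
    have := ((((hr0.pow 3).mul (T (D j (D j (D j χ))) g b)).add
      (((hr0.pow 2).const_mul 3).mul (T (D j (D j χ)) (D j g) b))).add
      ((hr0.const_mul 3).mul (T (D j χ) (D j (D j g)) b))).add (T χ (D j (D j (D j g))) b)
    simp only [ne_eq, OfNat.ofNat_ne_zero, not_false_eq_true, zero_pow, zero_mul, mul_zero,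
      zero_add, hχ0, one_mul] at this
    refine this.congr fun n => ?_
    simp only [D_D_D_dil_mul, pair_add, pair_smul, add_apply, smul_apply, smul_eq_mul]
  have h4 : ∀ j, Tendsto (fun n => pair (D j (dil (hr n) χ * g)) c) atTop
      (𝓝 (pair (D j g) c)) := by
    intro j
    have := (hr0.mul (T (D j χ) g c)).add (T χ (D j g) c)
    simp only [zero_mul, zero_add, hχ0, one_mul] at this
    refine this.congr fun n => ?_
    have e : D j (dil (hr n) χ * g) = r n • (dil (hr n) (D j χ) * g) + dil (hr n) χ * D j g := by
      ext x
      simp only [D_mul, D_dil, add_apply, schwartz_mul_apply, smul_apply, smul_eq_mul]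
      ring
    simp only [e, pair_add, pair_smul, add_apply, smul_apply, smul_eq_mul]
  have h5 := ((h3 0).add (h3 1)).add ((h4 0).add (h4 1))
  simp only [dispOp, transOp, pair_add, add_apply]
  refine tendsto_nhds_unique h1 (h5.congr fun n => ?_)
  have hc : HasCompactSupport (dil (hr n) χ * g) :=
    HasCompactSupport.mul_right (f := fun x => χ (r n • x))
      (HasCompactSupport.comp_smul (f := χ) bump.hasCompactSupport (hr n))
  rw [h _ hc]
  simp only [dispOp, transOp, pair_add, add_apply]

theorem pderiv_eq_D (j : Fin 2) (f : 𝓢(Plane, ℝ)) : pderiv j f = D j f := by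
  ext x
  rw [D_apply, pderiv]

theorem norm_complexify (g : Lp ℝ 2 (volume : Measure Plane)) : ‖complexify g‖ = ‖g‖ := by
  refine le_antisymm (Lp.norm_le_norm_of_ae_le ?_) (Lp.norm_le_norm_of_ae_le ?_) <;>
  · filter_upwards [coeFn_complexify g] with x hx
    simp [hx]

/-- `complexify` followed by the Fourier transform, as a real linear operator. -/
noncomputable def fourierReal : Lp ℝ 2 (volume : Measure Plane) →L[ℝ] Lp ℂ 2 (volume : Measure Plane) :=
  ((Lp.fourierTransformₗᵢ Plane ℂ).toContinuousLinearEquiv.toContinuousLinearMap.restrictScalars ℝ).comp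
    (Complex.ofRealCLM.compLpL 2 volume)

theorem fourierReal_apply (g : Lp ℝ 2 (volume : Measure Plane)) :
    fourierReal g = 𝓕 (complexify g) := rfl

theorem norm_fourierReal (g : Lp ℝ 2 (volume : Measure Plane)) : ‖fourierReal g‖ = ‖g‖ := by
  rw [fourierReal_apply, Lp.norm_fourier_eq, norm_complexify]

theorem normH3_sq (g : Lp ℝ 2 (volume : Measure Plane)) :
    normH3 g ^ 2 = sobolevSq (fourierReal g) := by
  rw [normH3, ← ENNReal.rpow_natCast, ← ENNReal.rpow_mul]
  norm_num
  rfl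

theorem enorm_le_normH3 (g : Lp ℝ 2 (volume : Measure Plane)) : ‖g‖ₑ ≤ normH3 g := by
  refine ENNReal_sq_le_sq ?_
  rw [normH3_sq]
  refine le_trans (le_of_eq ?_) eLpNorm_le_sobolevSq
  rw [← Lp.enorm_def, ← ofReal_norm, ← ofReal_norm, norm_fourierReal]

theorem norm_cube_sub_le {a b : Lp ℝ 2 (volume : Measure Plane)} {L : ℝ}
    (ha : ∀ᵐ x, |a x| ≤ L) (hb : ∀ᵐ x, |b x| ≤ L) : ‖cube a - cube b‖ ≤ 3 * L ^ 2 * ‖a - b‖ := by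
  refine Lp.norm_le_mul_norm_of_ae_le_mul ?_
  filter_upwards [ha, hb, coeFn_cube ha, coeFn_cube hb, Lp.coeFn_sub a b,
    Lp.coeFn_sub (cube a) (cube b)] with x h1 h2 h3 h4 h5 h6
  rw [h5, h6, Pi.sub_apply, Pi.sub_apply, h3, h4]
  exact abs_cube_sub_le h1 h2

section solution

variable {T : ℝ} {u : ℝ → Lp ℝ 2 (volume : Measure Plane)}

theorem IsSolution.continuousOn (h : IsSolution T u) : ContinuousOn u (Icc 1 T) := by
  intro t ht
  rw [ContinuousWithinAt, tendsto_iff_edist_tendsto_0]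
  refine tendsto_of_tendsto_of_tendsto_of_le_of_le tendsto_const_nhds (h.continuous_H3 t ht)
    (fun _ => zero_le) fun s => ?_
  rw [edist_eq_enorm_sub]
  exact enorm_le_normH3 _

theorem continuousOn_cube (hu : ContinuousOn u (Icc 1 T)) {L : ℝ}
    (hL : ∀ t ∈ Icc 1 T, ∀ᵐ x, |u t x| ≤ L) : ContinuousOn (fun t => cube (u t)) (Icc 1 T) := by
  intro t ht
  rw [ContinuousWithinAt, tendsto_iff_norm_sub_tendsto_zero]
  have h1 := ((tendsto_iff_norm_sub_tendsto_zero.1 (hu t ht)).const_mul (3 * L ^ 2))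
  rw [mul_zero] at h1
  refine squeeze_zero' (Eventually.of_forall fun s => norm_nonneg _) ?_ h1
  filter_upwards [self_mem_nhdsWithin] with s hs
  exact norm_cube_sub_le (hL s hs) (hL t ht)

/-- The equation tested against a compactly supported function. -/
theorem IsSolution.hasDerivWithinAt_pair (h : IsSolution T u) {L : ℝ}
    (hL : ∀ t ∈ Icc 1 T, ∀ᵐ x, |u t x| ≤ L) {f : 𝓢(Plane, ℝ)} (hf : HasCompactSupport f) {t : ℝ}
    (ht : t ∈ Icc 1 T) :
    HasDerivWithinAt (fun s => pair f (u s))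
      (pair (dispOp f) (u t) + pair (transOp f) (cube (u t))) (Icc 1 T) t := by
  have key := h.equation f (f.smooth ⊤) hf t ht
  simp only [pderiv_eq_D] at key
  simp only [← pair_apply] at key
  convert! key using 1
  have h1 : Integrable fun x => u t x * dispOp f x :=
    (Lp.memLp (u t)).integrable_mul ((dispOp f).memLp 2 volume)
  have h2 : Integrable fun x => cube (u t) x * transOp f x :=
    (Lp.memLp (cube (u t))).integrable_mul ((transOp f).memLp 2 volume)
  rw [pair_apply, pair_apply, ← integral_add h1 h2]
  refine integral_congr_ae ?_
  filter_upwards [coeFn_cube (hL t ht)] with x hx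
  rw [hx]
  rfl

/-- The time integral `∫_1^t v` of a function on `[1,T]`, which is extended by its end values to
make the integrand continuous on the line. -/
noncomputable def primitive {E : Type*} [NormedAddCommGroup E] [NormedSpace ℝ E] {T : ℝ}
    (hT : 1 ≤ T) (v : ℝ → E) (t : ℝ) : E :=
  ∫ s in (1 : ℝ)..t, v (projIcc 1 T hT s)

theorem hasDerivWithinAt_primitive {E : Type*} [NormedAddCommGroup E] [NormedSpace ℝ E]
    [CompleteSpace E] {T : ℝ} (hT : 1 ≤ T) {v : ℝ → E} (hv : ContinuousOn v (Icc 1 T)) {t : ℝ}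
    (ht : t ∈ Icc 1 T) : HasDerivWithinAt (primitive hT v) (v t) (Icc 1 T) t := by
  have hc : Continuous fun s => v (projIcc 1 T hT s) :=
    (continuousOn_iff_continuous_domRestrict.1 hv).comp continuous_projIcc
  have := intervalIntegral.integral_hasDerivAt_right (hc.intervalIntegrable 1 t)
    hc.stronglyMeasurable.stronglyMeasurableAtFilter hc.continuousAt
  rw [projIcc_of_mem hT ht] at this
  exact this.hasDerivWithinAt

/-- The equation, integrated in time. -/
theorem IsSolution.pair_sub (h : IsSolution T u) (hT : 1 ≤ T) {L : ℝ}
    (hL : ∀ t ∈ Icc 1 T, ∀ᵐ x, |u t x| ≤ L) (f : 𝓢(Plane, ℝ)) {t : ℝ} (ht : t ∈ Icc 1 T) :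
    pair f (u t - u 1) = pair (dispOp f) (primitive hT u t) +
      pair (transOp f) (primitive hT (fun s => cube (u s)) t) := by
  refine pair_eq_of_compactSupport (fun f hf => ?_) f
  -- for a fixed compactly supported `f` the difference of both sides has zero derivative in time
  have hu := h.continuousOn
  have hq := continuousOn_cube hu hL
  have hd : ∀ s ∈ Icc 1 T, HasDerivWithinAt (fun s => pair f (u s) -
      (pair (dispOp f) (primitive hT u s) +
        pair (transOp f) (primitive hT (fun s => cube (u s)) s))) 0 (Icc 1 T) s := by
    intro s hs
    have h1 := h.hasDerivWithinAt_pair hL hf hs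
    have h2 := (pair (dispOp f)).hasFDerivAt.comp_hasDerivWithinAt s
      (hasDerivWithinAt_primitive hT hu hs)
    have h3 := (pair (transOp f)).hasFDerivAt.comp_hasDerivWithinAt s
      (hasDerivWithinAt_primitive hT hq hs)
    have h4 := h1.sub (h2.add h3)
    rw [sub_self] at h4
    exact h4
  have h1 := Convex.norm_image_sub_le_of_norm_hasDerivWithin_le (C := 0) hd (fun s _ => by simp)
    (convex_Icc 1 T) (left_mem_Icc.2 hT) ht
  rw [zero_mul, norm_le_zero_iff, sub_eq_zero] at h1
  have h2 : ∀ v : ℝ → Lp ℝ 2 (volume : Measure Plane), primitive hT v 1 = 0 := fun v => by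
    simp [primitive]
  rw [h2, h2, map_zero, map_zero, add_zero, sub_zero] at h1
  rw [map_sub, ← h1]
  ring

end solution

/-! ### The equation on the Fourier side and the truncated energy -/

/-- The imaginary part of a Schwartz function. -/
noncomputable def imPart (f : 𝓢(Plane, ℂ)) : 𝓢(Plane, ℝ) :=
  SchwartzMap.postcompCLM Complex.imCLM f

@[simp] theorem imPart_apply (f : 𝓢(Plane, ℂ)) (x : Plane) : imPart f x = (f x).im := rfl

theorem D_imPart (j : Fin 2) (f : 𝓢(Plane, ℂ)) : D j (imPart f) = imPart (∂_{unitVec j} f) := by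
  ext x
  rw [D_apply, imPart_apply, SchwartzMap.lineDerivOp_apply_eq_fderiv]
  have h : (⇑(imPart f) : Plane → ℝ) = Complex.imCLM ∘ f := rfl
  rw [h, fderiv_comp x Complex.imCLM.differentiableAt f.differentiableAt]
  simp

theorem inner_toLp (f : 𝓢(Plane, ℂ)) (X : Lp ℂ 2 (volume : Measure Plane)) :
    inner ℂ (f.toLp 2 volume) X = ∫ ξ, starRingEnd ℂ (f ξ) * X ξ := by
  rw [L2.inner_def]
  refine integral_congr_ae ?_
  filter_upwards [f.coeFn_toLp 2 volume] with ξ h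
  rw [h, RCLike.inner_apply, mul_comm]

theorem inner_complexify (f : 𝓢(Plane, ℂ)) (a : Lp ℝ 2 (volume : Measure Plane)) :
    inner ℂ (f.toLp 2 volume) (complexify a) =
      (pair (rePart f) a : ℂ) - Complex.I * (pair (imPart f) a : ℂ) := by
  have h1 : Integrable fun x => a x * rePart f x :=
    (Lp.memLp a).integrable_mul ((rePart f).memLp 2 volume)
  have h2 : Integrable fun x => a x * imPart f x :=
    (Lp.memLp a).integrable_mul ((imPart f).memLp 2 volume)
  rw [inner_toLp, pair_apply, pair_apply, ← integral_complex_ofReal, ← integral_complex_ofReal,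
    ← integral_const_mul, ← integral_sub h1.ofReal (h2.ofReal.const_mul _)]
  refine integral_congr_ae ?_
  filter_upwards [coeFn_complexify a] with x hx
  rw [hx]
  apply Complex.ext <;> simp <;> ring

/-- The operator `∂_a³ + ∂_b³` on complex Schwartz functions. -/
noncomputable def dispOpC (f : 𝓢(Plane, ℂ)) : 𝓢(Plane, ℂ) :=
  ∂_{unitVec 0} (∂_{unitVec 0} (∂_{unitVec 0} f)) + ∂_{unitVec 1} (∂_{unitVec 1} (∂_{unitVec 1} f))

/-- The operator `∂_a + ∂_b` on complex Schwartz functions. -/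
noncomputable def transOpC (f : 𝓢(Plane, ℂ)) : 𝓢(Plane, ℂ) := ∂_{unitVec 0} f + ∂_{unitVec 1} f

theorem rePart_add (f g : 𝓢(Plane, ℂ)) : rePart (f + g) = rePart f + rePart g := map_add _ _ _

theorem imPart_add (f g : 𝓢(Plane, ℂ)) : imPart (f + g) = imPart f + imPart g := map_add _ _ _

/-- A linear relation between real test functions extends to complex ones. -/
theorem inner_eq_of_pair_eq {a b c : Lp ℝ 2 (volume : Measure Plane)}
    (h : ∀ f, pair f a = pair (dispOp f) b + pair (transOp f) c) (f : 𝓢(Plane, ℂ)) :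
    inner ℂ (f.toLp 2 volume) (complexify a) =
      inner ℂ ((dispOpC f).toLp 2 volume) (complexify b) +
        inner ℂ ((transOpC f).toLp 2 volume) (complexify c) := by
  have e1 : dispOp (rePart f) = rePart (dispOpC f) := by
    simp only [dispOp, dispOpC, D_rePart, rePart_add]
  have e2 : transOp (rePart f) = rePart (transOpC f) := by
    simp only [transOp, transOpC, D_rePart, rePart_add]
  have e3 : dispOp (imPart f) = imPart (dispOpC f) := by
    simp only [dispOp, dispOpC, D_imPart, imPart_add]
  have e4 : transOp (imPart f) = imPart (transOpC f) := by
    simp only [transOp, transOpC, D_imPart, imPart_add]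
  rw [inner_complexify, inner_complexify, inner_complexify, h, h, e1, e2, e3, e4]
  push_cast
  ring

/-- The symbol `i (ζ_a³ + ζ_b³)`. -/
noncomputable def dispSymbol (ξ : Plane) : ℂ :=
  (((2 * Real.pi * ξ 0) ^ 3 + (2 * Real.pi * ξ 1) ^ 3 : ℝ) : ℂ) * Complex.I

/-- The symbol `i (ζ_a + ζ_b)`. -/
noncomputable def transSymbol (ξ : Plane) : ℂ :=
  ((2 * Real.pi * (ξ 0 + ξ 1) : ℝ) : ℂ) * Complex.I

theorem contDiff_dispSymbol : ContDiff ℝ ∞ dispSymbol := by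
  have h1 : ContDiff ℝ ∞ fun ξ : Plane => (2 * Real.pi * ξ 0) ^ 3 + (2 * Real.pi * ξ 1) ^ 3 := by
    fun_prop
  exact (Complex.ofRealCLM.contDiff.comp h1).mul contDiff_const

theorem contDiff_transSymbol : ContDiff ℝ ∞ transSymbol := by
  have h1 : ContDiff ℝ ∞ fun ξ : Plane => 2 * Real.pi * (ξ 0 + ξ 1) := by fun_prop
  exact (Complex.ofRealCLM.contDiff.comp h1).mul contDiff_const

section symbols

variable {r : ℝ} (hr : 0 < r) {w : Plane → ℝ} (hw : ContDiff ℝ ∞ w)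

/-- The real Fourier multiplier `w`, cut off at frequency `1 / r`. -/
noncomputable def realMul : 𝓢(Plane, ℂ) :=
  cutSymbol hr (a := fun ξ => (w ξ : ℂ)) (Complex.ofRealCLM.contDiff.comp hw)

/-- The cut-off multiplier with symbol `w i (ζ_a³ + ζ_b³)`. -/
noncomputable def dispMul : 𝓢(Plane, ℂ) :=
  cutSymbol hr (a := fun ξ => (w ξ : ℂ) * dispSymbol ξ)
    ((Complex.ofRealCLM.contDiff.comp hw).mul contDiff_dispSymbol)

/-- The cut-off multiplier with symbol `w i (ζ_a + ζ_b)`. -/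
noncomputable def transMul : 𝓢(Plane, ℂ) :=
  cutSymbol hr (a := fun ξ => (w ξ : ℂ) * transSymbol ξ)
    ((Complex.ofRealCLM.contDiff.comp hw).mul contDiff_transSymbol)

theorem realMul_apply (ξ : Plane) : realMul hr hw ξ = (cut r ξ : ℂ) * (w ξ : ℂ) := rfl

theorem dispMul_apply (ξ : Plane) :
    dispMul hr hw ξ = (cut r ξ : ℂ) * ((w ξ : ℂ) * dispSymbol ξ) := rfl

theorem transMul_apply (ξ : Plane) :
    transMul hr hw ξ = (cut r ξ : ℂ) * ((w ξ : ℂ) * transSymbol ξ) := rfl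

/-- The weak form `a = -(∂_a³ + ∂_b³) b - (∂_a + ∂_b) c` of a linear equation, as an identity between
Fourier transforms after multiplication by a cut-off symbol. -/
theorem mulOp_eq_of_pair_eq {a b c : Lp ℝ 2 (volume : Measure Plane)}
    (h : ∀ f, pair f a = pair (dispOp f) b + pair (transOp f) c) :
    mulOp (realMul hr hw) (fourierReal a) =
      mulOp (dispMul hr hw) (fourierReal b) - mulOp (transMul hr hw) (fourierReal c) := by
  -- test against a Schwartz function `g`; the relation is applied to `𝓕⁻ (m g)`
  refine DenseRange.eq_of_inner_right ℂ (SchwartzMap.denseRange_toLpCLM (E := Plane) (F := ℂ)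
    (μ := (volume : Measure Plane)) (p := 2) (by norm_num)) fun g => ?_
  rw [SchwartzMap.toLpCLM_apply, inner_sub_right]
  set m := realMul hr hw with hm
  have hmt : Function.HasTemperateGrowth m := m.hasTemperateGrowth
  set f : 𝓢(Plane, ℂ) := 𝓕⁻ (SchwartzMap.smulLeftCLM ℂ m g) with hf
  have hfa : ∀ ξ, 𝓕 f ξ = m ξ * g ξ := fun ξ => by
    rw [hf, FourierTransform.fourier_fourierInv_eq]
    exact SchwartzMap.smulLeftCLM_apply_apply hmt g ξ
  have pl : ∀ (k : 𝓢(Plane, ℂ)) (x : Lp ℝ 2 (volume : Measure Plane)),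
      inner ℂ (k.toLp 2 volume) (complexify x) =
        ∫ ξ, starRingEnd ℂ (𝓕 k ξ) * (fourierReal x) ξ := fun k x => by
    rw [← Lp.inner_fourier_eq, SchwartzMap.toLp_fourier_eq, inner_toLp, fourierReal_apply]
  have pr : ∀ (n : 𝓢(Plane, ℂ)) (X : Lp ℂ 2 (volume : Measure Plane)),
      inner ℂ (g.toLp 2 volume) (mulOp n X) = ∫ ξ, n ξ * (starRingEnd ℂ (g ξ) * X ξ) :=
    fun n X => by
      rw [inner_toLp]
      refine integral_congr_ae ?_
      filter_upwards [coeFn_mulOp n X] with ξ hξ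
      rw [hξ]
      ring
  have key := inner_eq_of_pair_eq h f
  rw [pl, pl, pl] at key
  rw [pr, pr, pr]
  have hI3 : Complex.I ^ 3 = -Complex.I := by rw [pow_succ, Complex.I_sq]; ring
  convert key using 1
  · refine integral_congr_ae (Eventually.of_forall fun ξ => ?_)
    simp only [hfa, hm, realMul_apply, map_mul, Complex.conj_ofReal]
    ring
  · rw [sub_eq_add_neg, ← integral_neg]
    congr 1 <;> refine integral_congr_ae (Eventually.of_forall fun ξ => ?_)
    · simp only [dispOpC, FourierTransform.fourier_add, add_apply, fourier_deriv_apply, hfa, hm,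
        realMul_apply, dispMul_apply, dispSymbol, map_add, map_mul, Complex.conj_ofReal,
        Complex.conj_I, map_ofNat]
      push_cast
      ring_nf
      rw [hI3]
      ring
    · simp only [transOpC, FourierTransform.fourier_add, add_apply, fourier_deriv_apply, hfa, hm,
        realMul_apply, transMul_apply, transSymbol, map_add, map_mul, Complex.conj_ofReal,
        Complex.conj_I, map_ofNat]
      push_cast
      ring

/-- A cut-off of the Fourier transform of a solution is differentiable in time, as a function with
values in `L²`. -/
theorem IsSolution.hasDerivWithinAt_mulOp {T : ℝ} {u : ℝ → Lp ℝ 2 (volume : Measure Plane)}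
    (h : IsSolution T u) (hT : 1 ≤ T) {L : ℝ}
    (hL : ∀ t ∈ Icc 1 T, ∀ᵐ x, |u t x| ≤ L) {t : ℝ} (ht : t ∈ Icc 1 T) :
    HasDerivWithinAt (fun s => mulOp (realMul hr hw) (fourierReal (u s)))
      (mulOp (dispMul hr hw) (fourierReal (u t)) -
        mulOp (transMul hr hw) (fourierReal (cube (u t)))) (Icc 1 T) t := by
  set A : Lp ℝ 2 (volume : Measure Plane) →L[ℝ] Lp ℂ 2 (volume : Measure Plane) :=
    ((mulOp (dispMul hr hw)).restrictScalars ℝ).comp fourierReal with hA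
  set B : Lp ℝ 2 (volume : Measure Plane) →L[ℝ] Lp ℂ 2 (volume : Measure Plane) :=
    ((mulOp (transMul hr hw)).restrictScalars ℝ).comp fourierReal with hB
  have h1 := A.hasFDerivAt.comp_hasDerivWithinAt t (hasDerivWithinAt_primitive hT h.continuousOn ht)
  have h2 := B.hasFDerivAt.comp_hasDerivWithinAt t
    (hasDerivWithinAt_primitive hT (continuousOn_cube h.continuousOn hL) ht)
  refine ((h1.sub h2).const_add (mulOp (realMul hr hw) (fourierReal (u 1)))).congr_of_mem
    (fun s hs => ?_) ht
  have := mulOp_eq_of_pair_eq hr hw fun f => h.pair_sub hT hL f hs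
  rw [map_sub, map_sub, sub_eq_iff_eq_add'] at this
  exact this

end symbols

theorem inner_mulOp_mulOp {m n k : 𝓢(Plane, ℂ)} (c : ℂ)
    (h : ∀ ξ, starRingEnd ℂ (m ξ) * n ξ = c * k ξ) (f g : Lp ℂ 2 (volume : Measure Plane)) :
    inner ℂ (mulOp m f) (mulOp n g) = c * inner ℂ f (mulOp k g) := by
  rw [inner_mulOp, inner_mulOp, ← integral_const_mul]
  refine integral_congr_ae ?_
  filter_upwards [coeFn_mulOp m f] with ξ hξ
  rw [hξ, map_mul, ← mul_assoc c, ← h]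
  ring

/-- A cutoff at twice the frequency is equal to one where the original one is nonzero. -/
theorem cut_half_mul_cut (r : ℝ) (ξ : Plane) : cut (r / 2) ξ * cut r ξ = cut r ξ := by
  by_cases h : ‖r • ξ‖ < 2
  · rw [cut_eq_one, one_mul]
    have : (r / 2) • ξ = (1 / 2 : ℝ) • (r • ξ) := by rw [smul_smul]; congr 1; ring
    rw [this, norm_smul]
    norm_num
    linarith
  · have : cut r ξ = 0 := bump.zero_of_le_dist (by simpa [bump] using h)
    rw [this, mul_zero]

theorem contDiff_bracket_pow : ContDiff ℝ ∞ fun ξ => bracket ξ ^ 3 := contDiff_bracket.pow 3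

/-- The squared `H³` norm of `g`, cut off at frequency `1 / r`. -/
noncomputable def energy {r : ℝ} (hr : 0 < r) (g : Lp ℝ 2 (volume : Measure Plane)) : ℝ :=
  (inner ℂ (fourierReal g) (mulOp (realMul hr contDiff_bracket_pow) (fourierReal g))).re

/-- The growth of the truncated energy. The dispersive term, whose symbol is imaginary,
does not contribute. -/
theorem IsSolution.hasDerivWithinAt_energy {r : ℝ} (hr : 0 < r) {T : ℝ}
    {u : ℝ → Lp ℝ 2 (volume : Measure Plane)}
    (h : IsSolution T u) (hT : 1 ≤ T) {L : ℝ}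
    (hL : ∀ t ∈ Icc 1 T, ∀ᵐ x, |u t x| ≤ L) {t : ℝ} (ht : t ∈ Icc 1 T) :
    HasDerivWithinAt (fun s => energy hr (u s))
      (-2 * (lossForm r (fourierReal (u t)) (fourierReal (cube (u t)))).re) (Icc 1 T) t := by
  -- the energy is `⟨χ(rξ/2) U, (1 + |ζ|²)³ χ(rξ) U⟩`, in which both factors are differentiable
  have hr2 : 0 < r / 2 := by positivity
  have hone : ContDiff ℝ ∞ fun _ : Plane => (1 : ℝ) := contDiff_const
  have cc : ∀ ξ, (cut (r / 2) ξ : ℂ) * (cut r ξ : ℂ) = (cut r ξ : ℂ) := fun ξ => by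
    rw [← Complex.ofReal_mul, cut_half_mul_cut]
  set W := contDiff_bracket_pow with hW
  set U := fourierReal (u t) with hU
  set Q := fourierReal (cube (u t)) with hQ
  have hd := Complex.reCLM.hasFDerivAt.comp_hasDerivWithinAt t
    (HasDerivWithinAt.inner ℂ (h.hasDerivWithinAt_mulOp hr2 hone hT hL ht)
    (h.hasDerivWithinAt_mulOp hr W hT hL ht))
  have hdisp : ∀ ξ, starRingEnd ℂ (dispSymbol ξ) = -dispSymbol ξ := fun ξ => by
    simp only [dispSymbol, map_mul, Complex.conj_ofReal, Complex.conj_I]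
    ring
  have p0 : ∀ f g, inner ℂ (mulOp (realMul hr2 hone) f) (mulOp (realMul hr W) g) =
      inner ℂ f (mulOp (realMul hr W) g) := fun f g => by
    rw [inner_mulOp_mulOp 1 (k := realMul hr W), one_mul]
    intro ξ
    simp only [realMul_apply, map_mul, Complex.conj_ofReal]
    push_cast; linear_combination (bracket ξ ^ 3 : ℂ) * cc ξ
  have p1 : inner ℂ (mulOp (realMul hr2 hone) U) (mulOp (dispMul hr W) U) =
      inner ℂ U (mulOp (dispMul hr W) U) := by
    rw [inner_mulOp_mulOp 1 (k := dispMul hr W), one_mul]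
    intro ξ
    simp only [realMul_apply, dispMul_apply, map_mul, Complex.conj_ofReal]
    push_cast; linear_combination (bracket ξ ^ 3 * dispSymbol ξ) * cc ξ
  have p2 : inner ℂ (mulOp (dispMul hr2 hone) U) (mulOp (realMul hr W) U) =
      -inner ℂ U (mulOp (dispMul hr W) U) := by
    rw [inner_mulOp_mulOp (-1) (k := dispMul hr W), neg_one_mul]
    intro ξ
    simp only [realMul_apply, dispMul_apply, map_mul, Complex.conj_ofReal, hdisp]
    push_cast; linear_combination (-bracket ξ ^ 3 * dispSymbol ξ) * cc ξ
  have p3 : inner ℂ (mulOp (realMul hr2 hone) U) (mulOp (transMul hr W) Q) = lossForm r U Q := by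
    rw [lossForm_eq_inner hr, inner_mulOp_mulOp 1 (k := cutSymbol hr contDiff_fluxSymbol), one_mul]
    intro ξ
    simp only [realMul_apply, transMul_apply, cutSymbol_apply, fluxSymbol, transSymbol, map_mul,
      Complex.conj_ofReal]
    push_cast
    linear_combination (bracket ξ ^ 3 * (2 * Real.pi * (ξ 0 + ξ 1)) * Complex.I) * cc ξ
  have p4 : inner ℂ (mulOp (transMul hr2 hone) Q) (mulOp (realMul hr W) U) =
      starRingEnd ℂ (lossForm r U Q) := by
    rw [← inner_conj_symm, lossForm_eq_inner hr,
      inner_mulOp_mulOp 1 (k := cutSymbol hr contDiff_fluxSymbol), one_mul]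
    intro ξ
    simp only [realMul_apply, transMul_apply, cutSymbol_apply, fluxSymbol, transSymbol, map_mul,
      Complex.conj_ofReal]
    push_cast
    linear_combination (bracket ξ ^ 3 * (2 * Real.pi * (ξ 0 + ξ 1)) * Complex.I) * cc ξ
  simp only [inner_sub_left, inner_sub_right, ← hU, ← hQ, p1, p2, p3, p4] at hd
  convert! hd using 1
  · ext s
    simp only [Function.comp_apply, p0]
    rfl
  · simp
    ring

theorem ofReal_energy {r : ℝ} (hr : 0 < r) (g : Lp ℝ 2 (volume : Measure Plane)) :
    ENNReal.ofReal (energy hr g) =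
      ∫⁻ ξ, ENNReal.ofReal (bracket ξ ^ 3 * cut r ξ) * ‖fourierReal g ξ‖ₑ ^ 2 := by
  set U := fourierReal g with hU
  have hi := L2.integrable_inner (𝕜 := ℂ) U (mulOp (realMul hr contDiff_bracket_pow) U)
  have e : (fun ξ => RCLike.re (inner ℂ (U ξ) (mulOp (realMul hr contDiff_bracket_pow) U ξ)))
      =ᵐ[volume] fun ξ => bracket ξ ^ 3 * cut r ξ * ‖U ξ‖ ^ 2 := by
    filter_upwards [coeFn_mulOp (realMul hr contDiff_bracket_pow) U] with ξ hξ
    rw [hξ, realMul_apply, RCLike.inner_apply, mul_assoc, RCLike.mul_conj]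
    simp only [← Complex.ofReal_mul, ← Complex.ofReal_pow, RCLike.re_to_complex,
      Complex.coe_algebraMap, Complex.ofReal_re]
    ring
  have hnn : ∀ ξ, 0 ≤ bracket ξ ^ 3 * cut r ξ := fun ξ =>
    mul_nonneg (pow_nonneg (bracket_pos ξ).le 3) (cut_nonneg r ξ)
  have h1 : energy hr g = ∫ ξ, bracket ξ ^ 3 * cut r ξ * ‖U ξ‖ ^ 2 := by
    rw [← integral_congr_ae e, integral_re hi, energy, L2.inner_def]
    rfl
  rw [h1, ofReal_integral_eq_lintegral_ofReal ((integrable_congr e).1 hi.re)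
    (Eventually.of_forall fun ξ => mul_nonneg (hnn ξ) (sq_nonneg _))]
  refine lintegral_congr fun ξ => ?_
  rw [ENNReal.ofReal_mul (hnn ξ), ENNReal.ofReal_pow (norm_nonneg _), ofReal_norm]

theorem ofReal_energy_le {r : ℝ} (hr : 0 < r) (g : Lp ℝ 2 (volume : Measure Plane)) :
    ENNReal.ofReal (energy hr g) ≤ normH3 g ^ 2 := by
  rw [ofReal_energy, normH3_sq, sobolevSq]
  gcongr with ξ
  exact mul_le_of_le_one_right (pow_nonneg (bracket_pos ξ).le 3) (cut_le_one r ξ)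

/-- Bounds on the truncated energies pass to the limit by Fatou's lemma. -/
theorem normH3_sq_le_of_energy_le {g : Lp ℝ 2 (volume : Measure Plane)} {B : ℝ≥0∞}
    (h : ∀ {r : ℝ} (hr : 0 < r), ENNReal.ofReal (energy hr g) ≤ B) : normH3 g ^ 2 ≤ B := by
  set r : ℕ → ℝ := fun n => 1 / ((n : ℝ) + 1) with hrdef
  have hr : ∀ n, 0 < r n := fun n => by positivity
  have hr0 : Tendsto r atTop (𝓝 0) := tendsto_one_div_add_atTop_nhds_zero_nat
  set F : ℕ → Plane → ℝ≥0∞ := fun n ξ =>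
    ENNReal.ofReal (bracket ξ ^ 3 * cut (r n) ξ) * ‖fourierReal g ξ‖ₑ ^ 2 with hF
  have hFm : ∀ n, AEMeasurable (F n) := fun n => by
    have h1 := (contDiff_cut (r n)).continuous
    have h2 := continuous_bracket
    exact ((h2.pow 3).mul h1).measurable.ennreal_ofReal.aemeasurable.mul
      ((Lp.aestronglyMeasurable (fourierReal g)).enorm.pow_const 2)
  have h1 : ∀ ξ, liminf (fun n => F n ξ) atTop =
      ENNReal.ofReal (bracket ξ ^ 3) * ‖fourierReal g ξ‖ₑ ^ 2 := fun ξ => by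
    refine Tendsto.liminf_eq (tendsto_const_nhds.congr' ?_)
    have h2 : Tendsto (fun n => ‖r n • ξ‖) atTop (𝓝 0) := by
      have := (hr0.smul_const ξ).norm
      simpa using this
    filter_upwards [h2.eventually (ge_mem_nhds (zero_lt_one' ℝ))] with n hn
    rw [hF]
    simp only
    rw [cut_eq_one hn, mul_one]
  rw [normH3_sq, sobolevSq, ← lintegral_congr h1]
  refine (lintegral_liminf_le' hFm).trans ?_
  refine liminf_le_of_le (by isBoundedDefault) fun b hb => ?_
  obtain ⟨n, hn⟩ := hb.exists
  exact hn.trans ((ofReal_energy (hr n) g).symm.trans_le (h (hr n)))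

/-! ### Integration of the growth estimate -/

/-- A function whose growth rate is at most `B t^{-31/30}` grows by at most `30 B` on `[1,T]`. -/
theorem le_add_of_deriv_le {E E' : ℝ → ℝ} {T B : ℝ} (hB : 0 ≤ B)
    (hd : ∀ t ∈ Icc 1 T, HasDerivWithinAt E (E' t) (Icc 1 T) t)
    (hE : ∀ t ∈ Icc 1 T, E' t ≤ B * t ^ (-(31 / 30) : ℝ)) {t : ℝ} (ht : t ∈ Icc 1 T) :
    E t ≤ E 1 + 30 * B := by
  have hpos : ∀ s ∈ Icc 1 T, (0 : ℝ) < s := fun s hs => by linarith [hs.1]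
  have hd2 : ∀ s ∈ Icc 1 T, HasDerivWithinAt (fun s => E s + 30 * B * s ^ (-(1 / 30) : ℝ))
      (E' s + 30 * B * (-(1 / 30) * s ^ (-(1 / 30) - 1 : ℝ))) (Icc 1 T) s := fun s hs =>
    (hd s hs).add (((Real.hasDerivAt_rpow_const (Or.inl (hpos s hs).ne')).const_mul _).hasDerivWithinAt)
  -- `-30 s^{-1/30}` is a primitive of `s^{-31/30}`
  have hanti : AntitoneOn (fun s => E s + 30 * B * s ^ (-(1 / 30) : ℝ)) (Icc 1 T) := by
    refine antitoneOn_of_hasDerivWithinAt_nonpos (convex_Icc 1 T)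
      (fun s hs => (hd2 s hs).continuousWithinAt)
      (fun s hs => (hd2 s (interior_subset hs)).mono interior_subset) fun s hs => ?_
    have h1 := hE s (interior_subset hs)
    rw [show (-(1 / 30) - 1 : ℝ) = -(31 / 30) by norm_num]
    linarith
  have h1 := hanti (left_mem_Icc.2 (ht.1.trans ht.2)) ht ht.1
  simp only [Real.one_rpow, mul_one] at h1
  have h2 : 0 ≤ 30 * B * t ^ (-(1 / 30) : ℝ) :=
    mul_nonneg (by positivity) (Real.rpow_nonneg (hpos t ht).le _)
  linarith

end MZK

theorem mainTheorem4 :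
    ∃ C : ℝ≥0, 0 < C ∧
      ∀ (T : ℝ) (u : ℝ → Lp ℝ 2 (volume : Measure MZK.Plane)),
        1 < T → MZK.IsSolution T u →
          ∀ t ∈ Set.Icc (1 : ℝ) T,
            MZK.normH3 (u t) ≤ MZK.normH3 (u 1) + (C : ℝ≥0∞) * MZK.normX T u ^ 2 := by
  obtain ⟨C₁, hC₁, hdecay⟩ := MZK.exists_norm_synth_le
  obtain ⟨C₂, hC₂, hgrowth⟩ := MZK.exists_norm_lossForm_cube_le
  set A : ℝ := 60 * (C₂ * C₁ ^ 2) with hA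
  have hA0 : 0 < A := by positivity
  refine ⟨(Real.sqrt A).toNNReal, Real.toNNReal_pos.2 (Real.sqrt_pos.2 hA0), fun T u hT hu t ht => ?_⟩
  -- if the norm is infinite, so is the right-hand side, as the constant is positive
  rcases eq_or_ne (MZK.normX T u) ⊤ with htop | hfin
  · rw [htop]
    simp [ENNReal.mul_top, hA0]
  set M : ℝ := (MZK.normX T u).toReal with hM
  have hM0 : 0 ≤ M := ENNReal.toReal_nonneg
  have hMX : ENNReal.ofReal M = MZK.normX T u := ENNReal.ofReal_toReal hfin
  have hle : ∀ s ∈ Icc 1 T, max (MZK.normH3 (u s)) (max (MZK.weightedNorm 0 (MZK.profile u s))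
      (MZK.weightedNorm 1 (MZK.profile u s))) ≤ ENNReal.ofReal M := fun s hs => by
    rw [hMX]
    exact le_iSup₂_of_le (f := fun t (_ : t ∈ Icc (1 : ℝ) T) => max (MZK.normH3 (u t))
      (max (MZK.weightedNorm 0 (MZK.profile u t)) (MZK.weightedNorm 1 (MZK.profile u t)))) s hs le_rfl
  have hsob : ∀ s ∈ Icc 1 T, MZK.sobolevSq (MZK.fourierReal (u s)) ≤ ENNReal.ofReal (M ^ 2) :=
    fun s hs => by
      rw [← MZK.normH3_sq, ENNReal.ofReal_pow hM0]
      exact pow_le_pow_left' ((le_max_left _ _).trans (hle s hs)) 2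
  have hsynth : ∀ s ∈ Icc 1 T, ∀ o x, ‖MZK.synth o (MZK.fourierReal (u s)) x‖ ≤
      C₁ * s ^ (-(31 / 60) : ℝ) * M := fun s hs o x => by
    refine hdecay o (MZK.complexify (u s)) hs.1 hM0 (hsob s hs) (fun i => ?_) x
    have h1 := (le_max_right _ _).trans (hle s hs)
    fin_cases i
    · exact (le_max_left _ _).trans h1
    · exact (le_max_right _ _).trans h1
  have hbdd : ∀ s ∈ Icc 1 T, ∀ᵐ x, |u s x| ≤ C₁ * M := fun s hs => by
    refine MZK.ae_abs_le_of_synth_le (fun x => (hsynth s hs none x).trans ?_)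
      (ne_top_of_le_ne_top ENNReal.ofReal_ne_top (hsob s hs))
    gcongr
    exact mul_le_of_le_one_right hC₁.le (Real.rpow_le_one_of_one_le_of_nonpos hs.1 (by norm_num))
  have hsq : MZK.normH3 (u t) ^ 2 ≤ MZK.normH3 (u 1) ^ 2 + ENNReal.ofReal (A * M ^ 4) := by
    refine MZK.normH3_sq_le_of_energy_le fun {r} hr => ?_
    have h1 := MZK.le_add_of_deriv_le (B := 2 * (C₂ * C₁ ^ 2 * M ^ 4)) (by positivity)
      (fun s hs => hu.hasDerivWithinAt_energy hr hT.le hbdd hs) (fun s hs => ?_) ht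
    · refine (ENNReal.ofReal_le_ofReal h1).trans (ENNReal.ofReal_add_le.trans ?_)
      refine add_le_add (MZK.ofReal_energy_le hr (u 1)) (le_of_eq ?_)
      rw [hA]
      congr 1
      ring
    · have hs0 : 0 < s := by linarith [hs.1]
      have h2 := hgrowth hr (u := u s) (K := C₁ * s ^ (-(31 / 60) : ℝ) * M) (by positivity) hM0
        (hsynth s hs) (hsob s hs)
      have h3 := (neg_le_abs _).trans ((Complex.abs_re_le_norm _).trans h2)
      have h4 : (s ^ (-(31 / 60) : ℝ)) ^ 2 = s ^ (-(31 / 30) : ℝ) := by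
        rw [← Real.rpow_natCast, ← Real.rpow_mul hs0.le]
        norm_num
      rw [mul_pow, mul_pow, h4] at h3
      change -2 * (MZK.lossForm r (𝓕 (MZK.complexify (u s)) : Lp ℂ 2 (volume : Measure MZK.Plane))
        (𝓕 (MZK.complexify (MZK.cube (u s))) : Lp ℂ 2 (volume : Measure MZK.Plane))).re ≤ _
      linarith
  refine (ENNReal.pow_le_pow_left_iff two_ne_zero).1 (hsq.trans ?_)
  have e : ENNReal.ofReal (A * M ^ 4) =
      (((Real.sqrt A).toNNReal : ℝ≥0∞) * MZK.normX T u ^ 2) ^ 2 := by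
    change _ = (ENNReal.ofReal (Real.sqrt A) * _) ^ 2
    rw [← hMX, ← ENNReal.ofReal_pow hM0,
      ← ENNReal.ofReal_mul (Real.sqrt_nonneg A), ← ENNReal.ofReal_pow (by positivity), mul_pow,
      Real.sq_sqrt hA0.le]
    congr 1
    ring
  rw [e, add_sq]
  exact add_le_add le_self_add le_rfl
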